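/- **Bilocality scenario.** Two independent sources emit states $\rho_1$ on $H_A\otimes H_{B_1}\otimes H_{E_1}$ and $\rho_2$ on $H_{B_2}\otimes H_C\otimes H_{E_2}$ (Hilbert spaces of arbitrary dimension). Alice measures $H_A$ with POVMs $\{A_x^a\}_a$, $x,a\in\{0,1\}$; Bob measures $H_{B_1}\otimes H_{B_2}$ with one four-outcome POVM $\{B^b\}$, $b=(b_0,b_1)\in\{0,1\}^2$; Charlie measures $H_C$ with POVMs $\{C_z^c\}_c$, $z,c\in\{0,1\}$. The observed behaviour is $p(abc|xz)=\mathrm{tr}\big((\rho_1\otimes\rho_2)\,A_x^aB^bC_z^c\big)$. **Eavesdroppers.** A *weak eavesdropper* performs a joint POVM on $H_{E_1}\otimes H_{E_2}$, whose outcome $e$ is her guess. A *double eavesdropper* consists of a POVM (with finitely many outcomes $e$) on $H_{E_1}$ and another one (outcomes $f$) on $H_{E_2}$, the guess being a function of $(e,f)$. In both cases the sum over the eavesdropper's outcomes of the joint distribution with $a,b,c$ must reproduce $p$. The states, the parties' measurements and the Hilbert spaces are otherwise arbitrary. $P_{\rm guess}(ABC|E)$ and $P_{\rm guess}(AC|E)$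 denote the supremum, over all such strategies in the given scenario, of the probability that for $x=z=0$ the guess equals $(a,b,c)$, respectively $(a,c)$, and $H_{\min}(\cdot|E,x=0,z=0)=-\log_2P_{\rm guess}(\cdot|E)$. **Proposition.** Let $0<|\delta|\le\pi/6$, and let $p$ be a behaviour that arises from a quantum strategy in the bilocality scenario. Put $p(b|xz)=\sum_{ac}p(abc|xz)$, $p(ac|b,x,z)=p(abc|xz)/p(b|xz)$ and $\langle A_xC_z\rangle_b=\sum_{ac}(-1)^{a+c}p(ac|b,x,z)$. Suppose that every $b=(b_0,b_1)$ occurs with positive probability and that for every $b$ $$\langle A_0C_1\rangle_b=(-1)^{b_0}\cos\delta,\quad \langle A_1C_0\rangle_b=(-1)^{b_1}\cos\delta,\quad \langle A_0C_0\rangle_b=0,\quad \langle A_1C_1\rangle_b=\delta_{b_0,b_1}(-1)^{b_0}\sin(2\delta),$$ where $\delta_{b_0,b_1}$ is the Kronecker delta. Then, both in the double-eavesdropper and in the weak-eavesdropper scenario, the "informed guess" is optimal: the largest guessing probabilities exist and are $$P_{\rm guess}(ABC|E)=\max_{abc}p(abc|00),\qquad P_{\rm guess}(AC|E)=\sum_b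 p(b|00)\,\max_{ac}p(ac|b,0,0).$$ Consequently $$H_{\min}(ABC|E,x=0,z=0)=-\log_2\max_{abc}p(abc|00),\qquad H_{\min}(AC|E,x=0,z=0)=-\log_2\sum_b p(b|00)\max_{ac}p(ac|b,0,0).$$ -/

import Mathlib

open scoped InnerProductSpace

noncomputable section

namespace Bilocal

/-! ### Hilbert spaces, composite systems, states and measurements

Every complex Hilbert space is `ℓ²(ι)` for the index set `ι` of an orthonormal basis, and
`ℓ²(ι) ⊗ ℓ²(κ) = ℓ²(ι × κ)`. The index sets are arbitrary, so the dimensions are arbitrary, finite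
or infinite. -/

/-- The Hilbert space `ℓ²(ι)` with orthonormal basis indexed by `ι`. -/
abbrev Hilb (ι : Type) : Type := lp (fun _ : ι => ℂ) 2

/-- Bounded operators on `ℓ²(ι)`. -/
abbrev Op (ι : Type) : Type := Hilb ι →L[ℂ] Hilb ι

open Classical in
/-- The matrix element `⟨e_i, X e_j⟩` of a bounded operator. -/
def matElem {ι : Type} (X : Op ι) (i j : ι) : ℂ :=
  (X (lp.single 2 j (1 : ℂ)) : ι → ℂ) i

lemma memℓp_prodVec {ι κ : Type} (u : Hilb ι) (v : Hilb κ) :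
    Memℓp (fun p : ι × κ => u p.1 * v p.2) 2 := by
  have h2 : 0 < (2 : ENNReal).toReal := by norm_num
  refine memℓp_gen ?_
  have hu := (lp.memℓp u).summable h2
  have hv := (lp.memℓp v).summable h2
  refine (hu.mul_of_nonneg hv (fun _ => by positivity) (fun _ => by positivity)).congr ?_
  rintro ⟨i, j⟩
  simp [mul_pow]

/-- The product vector `u ⊗ v`. -/
def prodVec {ι κ : Type} (u : Hilb ι) (v : Hilb κ) : Hilb (ι × κ) :=
  ⟨fun p => u p.1 * v p.2, memℓp_prodVec u v⟩

/-- A density operator `∑ k, |ψ k⟩⟨ψ k|` (not necessarily normalised vectors `ψ k`), given by a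
countable decomposition into pure states. The traces of the summands add up to one. -/
def IsState {ι : Type} (ψ : ℕ → Hilb ι) : Prop :=
  HasSum (fun k => ‖ψ k‖ ^ 2) 1

/-- `tr (X (ρ ⊗ σ))` for the density operators `ρ = ∑ k, |ψ k⟩⟨ψ k|`, `σ = ∑ l, |φ l⟩⟨φ l|`. -/
def trProd {ι κ : Type} (ψ : ℕ → Hilb ι) (φ : ℕ → Hilb κ) (X : Op (ι × κ)) : ℂ :=
  ∑' k : ℕ × ℕ, ⟪prodVec (ψ k.1) (φ k.2), X (prodVec (ψ k.1) (φ k.2))⟫_ℂ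

/-- A POVM with finite outcome set `O`. -/
def IsPOVM {ι O : Type} [Fintype O] (E : O → Op ι) : Prop :=
  (∀ o, (E o).IsPositive) ∧ ∑ o, E o = 1

open Classical in
/-- The basis index set `τ` is a product `σ × κ` with coordinate maps `see` and `rest`; the operator
`X` is of the form `M ⊗ 1`, i.e. it acts non-trivially on the factor `ℓ²(σ)` only. -/
def ActsOn {τ σ κ : Type} (see : τ → σ) (rest : τ → κ) (X : Op τ) : Prop :=
  ∃ M : σ → σ → ℂ, ∀ i j, matElem X i j = if rest i = rest j then M (see i) (see j) else 0

/-! ### The bilocality network with side systems for the eavesdropper -/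

/-- The outcomes of Bob: `b = (b₀, b₁)`. -/
abbrev BobOut : Type := Fin 2 × Fin 2

/-- A quantum strategy in the bilocality network. Source one emits a state on
`H_A ⊗ H_{B₁} ⊗ H_{E₁}`, source two, independently, a state on `H_{B₂} ⊗ H_C ⊗ H_{E₂}`. Alice
measures `H_A` (setting `x`), Bob measures `H_{B₁} ⊗ H_{B₂}` (no setting, four outcomes), Charlie
measures `H_C` (setting `z`). The systems `E₁`, `E₂` are not measured by the three parties. -/
structure Strategy where
  /-- index sets of orthonormal bases of `H_A, H_{B₁}, H_{E₁}, H_{B₂}, H_C, H_{E₂}` -/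
  (α β₁ ε₁ β₂ γ ε₂ : Type)
  /-- the state of the first source -/
  ψ : ℕ → Hilb (α × β₁ × ε₁)
  ψ_state : IsState ψ
  /-- the state of the second source -/
  φ : ℕ → Hilb (β₂ × γ × ε₂)
  φ_state : IsState φ
  /-- `A x a` is the effect of outcome `a` of Alice's measurement `x` -/
  A : Fin 2 → Fin 2 → Op ((α × β₁ × ε₁) × (β₂ × γ × ε₂))
  A_povm : ∀ x, IsPOVM (A x)
  A_local : ∀ x a, ActsOn (fun t => t.1.1) (fun t => (t.1.2, t.2)) (A x a)
  /-- `B b` is the effect of Bob's outcome `b` -/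
  B : BobOut → Op ((α × β₁ × ε₁) × (β₂ × γ × ε₂))
  B_povm : IsPOVM B
  B_local : ∀ b, ActsOn (fun t => (t.1.2.1, t.2.1)) (fun t => (t.1.1, t.1.2.2, t.2.2)) (B b)
  /-- `C z c` is the effect of outcome `c` of Charlie's measurement `z` -/
  C : Fin 2 → Fin 2 → Op ((α × β₁ × ε₁) × (β₂ × γ × ε₂))
  C_povm : ∀ z, IsPOVM (C z)
  C_local : ∀ z c, ActsOn (fun t => t.2.2.1) (fun t => (t.1, t.2.1, t.2.2.2)) (C z c)

namespace Strategy

/-- Index set of the global Hilbert space. -/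
abbrev Idx (S : Strategy) : Type := (S.α × S.β₁ × S.ε₁) × (S.β₂ × S.γ × S.ε₂)

/-- `tr (A_x^a B^b C_z^c X ρ)` with `ρ` the product of the two source states. -/
def prob (S : Strategy) (X : Op S.Idx) (a : Fin 2) (b : BobOut) (c x z : Fin 2) : ℝ :=
  (trProd S.ψ S.φ (S.A x a * S.B b * S.C z c * X)).re

/-- The operator acts only on `E₁`. -/
def ActsOnE₁ (S : Strategy) (X : Op S.Idx) : Prop :=
  ActsOn (fun t : S.Idx => t.1.2.2) (fun t => (t.1.1, t.1.2.1, t.2)) X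

/-- The operator acts only on `E₂`. -/
def ActsOnE₂ (S : Strategy) (X : Op S.Idx) : Prop :=
  ActsOn (fun t : S.Idx => t.2.2.2) (fun t => (t.1, t.2.1, t.2.2.1)) X

/-- The operator acts only on `E₁` and `E₂`, possibly jointly. -/
def ActsOnE (S : Strategy) (X : Op S.Idx) : Prop :=
  ActsOn (fun t : S.Idx => (t.1.2.2, t.2.2.2))
    (fun t => ((t.1.1, t.1.2.1), (t.2.1, t.2.2.1))) X

end Strategy

/-- Behaviours of the bilocality scenario: `p a b c x z` stands for `p(a b c | x z)`. -/
abbrev Behaviour : Type := Fin 2 → BobOut → Fin 2 → Fin 2 → Fin 2 → ℝ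

/-- The behaviour arises from a quantum strategy in the bilocality network. -/
def IsQuantum (p : Behaviour) : Prop :=
  ∃ S : Strategy, ∀ a b c x z, p a b c x z = S.prob 1 a b c x z

/-! ### Postselected correlations -/

/-- `p(b | x z)`. -/
def probB (p : Behaviour) (b : BobOut) (x z : Fin 2) : ℝ :=
  ∑ a, ∑ c, p a b c x z

/-- `p(a c | b, x, z)`. -/
def condAC (p : Behaviour) (a c : Fin 2) (b : BobOut) (x z : Fin 2) : ℝ :=
  p a b c x z / probB p b x z

/-- The postselected correlator `⟨A_x C_z⟩_b = ∑ a c, (-1)^(a+c) p(a c | b, x, z)`. -/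
def corr (p : Behaviour) (x z : Fin 2) (b : BobOut) : ℝ :=
  ∑ a : Fin 2, ∑ c : Fin 2, (-1 : ℝ) ^ ((a : ℕ) + (c : ℕ)) * condAC p a c b x z

/-- The tilted self-testing relations with parameter `δ`. Every outcome `b` occurs, so that
conditioning on it makes sense. -/
structure TiltedRelations (δ : ℝ) (p : Behaviour) : Prop where
  pos : ∀ b x z, 0 < probB p b x z
  corr01 : ∀ b, corr p 0 1 b = (-1) ^ (b.1 : ℕ) * Real.cos δ
  corr10 : ∀ b, corr p 1 0 b = (-1) ^ (b.2 : ℕ) * Real.cos δ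
  corr00 : ∀ b, corr p 0 0 b = 0
  corr11 : ∀ b, corr p 1 1 b = if b.1 = b.2 then (-1) ^ (b.1 : ℕ) * Real.sin (2 * δ) else 0

/-! ### Guessing probabilities and min-entropies

`tgt a b c : G` is the part of the outcomes that is to be guessed, for the settings `x = z = 0`. -/

/-- Guessing probabilities attainable by a weak eavesdropper who stays unnoticed: one eavesdropper,
who receives a system from each of the two independent sources and measures both jointly. -/
def weakGuessProbs {G : Type} [Fintype G] (p : Behaviour) (tgt : Fin 2 → BobOut → Fin 2 → G) :
    Set ℝ :=
  {g | ∃ (S : Strategy) (E : G → Op S.Idx),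
      IsPOVM E ∧ (∀ e, S.ActsOnE (E e)) ∧
      (∀ a b c x z, ∑ e, S.prob (E e) a b c x z = p a b c x z) ∧
      g = ∑ a, ∑ b, ∑ c, S.prob (E (tgt a b c)) a b c 0 0}

/-- Guessing probabilities attainable by a double eavesdropper who stays unnoticed: two
eavesdroppers, each of whom measures a system from one source; the guess is a function of their two
outcomes. -/
def doubleGuessProbs {G : Type} [DecidableEq G] (p : Behaviour)
    (tgt : Fin 2 → BobOut → Fin 2 → G) : Set ℝ :=
  {g | ∃ (S : Strategy) (m n : ℕ) (E : Fin m → Op S.Idx) (F : Fin n → Op S.Idx)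
      (guess : Fin m → Fin n → G),
      IsPOVM E ∧ (∀ e, S.ActsOnE₁ (E e)) ∧ IsPOVM F ∧ (∀ f, S.ActsOnE₂ (F f)) ∧
      (∀ a b c x z, ∑ e, ∑ f, S.prob (E e * F f) a b c x z = p a b c x z) ∧
      g = ∑ a, ∑ b, ∑ c, ∑ e, ∑ f,
        if guess e f = tgt a b c then S.prob (E e * F f) a b c 0 0 else 0}

/-- The min-entropy in bits: minus the logarithm of the optimal guessing probability. -/
def minEntropy (guessProbs : Set ℝ) : ℝ := -Real.logb 2 (sSup guessProbs)

/-- The outcomes of all three parties are to be guessed. -/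
def tgtABC (a : Fin 2) (b : BobOut) (c : Fin 2) : Fin 2 × BobOut × Fin 2 := (a, b, c)

/-- The outcomes of Alice and Charlie are to be guessed. -/
def tgtAC (a : Fin 2) (_b : BobOut) (c : Fin 2) : Fin 2 × Fin 2 := (a, c)

/-- The informed guess of all outcomes: `max_{abc} p(a b c | 0 0)`. -/
def informedABC (p : Behaviour) : ℝ :=
  ⨆ t : Fin 2 × BobOut × Fin 2, p t.1 t.2.1 t.2.2 0 0

/-- The informed guess of the outer outcomes: `∑ b, p(b) max_{ac} p(a c | b, 0, 0)`. -/
def informedAC (p : Behaviour) : ℝ :=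
  ∑ b, probB p b 0 0 * ⨆ t : Fin 2 × Fin 2, condAC p t.1 t.2 b 0 0

end Bilocal

end

/-!
Every strategy that reproduces `p` makes the sixteen outcomes `(a, b, c)` for the settings `0`, `0`
equally likely, and they stay equally likely given any outcome of the eavesdropper. So every
admissible strategy guesses `(a, b, c)` with probability exactly `1 / 16` and `(a, c)` with
probability exactly `4 / 16`, and these are the values of the informed guess.

Write `A x`, `C z` for the observables of Alice and Charlie, `s = sin δ` and `c = cos δ`. The
relations would hold in the ideal situation where the state postselected on Bob's outcome is a Bell
state, `A 0 = Z`, `A 1 = c X + s Z`, and likewise on Charlie's side with `Z` and `X` exchanged. The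
proof recovers as much of this structure as it needs.

*Ideal parts.* For the two outcomes with `b₀ = b₁` the four correlators are extremal: they determine
the vectors `A x Ψ`, `C z Ψ` up to isometry (`extremal_vectors`), so that on the postselected
vectors `A 0`, `A 1` square to one and have anticommutator `2 s` (`SwapModel.diagonal_relations`,
`anticommutator_apply`; this divides by `s`, hence needs `δ ≠ 0`). These relations extend to the
range of a projection `P` that lies in the von Neumann algebra of Alice's observables and fixes the
postselected vectors (`exists_idealProjection`). There is a similar projection `Q` for Charlie.

*Rigidity.* The outcomes `01` and `10` are not extremal by themselves. Together they fix the values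
of two correlators of `B (0, 1) - B (1, 0)`, namely with `(A 0 - A 1) (C 1 + C 0) / 4` and
`(A 0 + A 1) (C 1 - C 0) / 4`. Both are split into four blocks along `P`, `1 - P` and `Q`, `1 - Q`.
The ideal block satisfies a Tsirelson bound (`SwapModel.ideal_block_le`); the blocks with one
non-ideal side and the one with two are bounded by the Cauchy-Schwarz inequality and the
independence of the two sources (`mixed_block_le`, `sq_double_block_le`). Since `cos δ ^ 2 ≥ 3 / 4`,
these bounds are compatible with the two values only if `1 - P` and `1 - Q` have weight zero
(`nonideal_weights_eq_zero`, `SwapModel.apply_ideal_eq`).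

*Uniformity.* Hence on the support of the state `A 0` and the normalised rest of `A 1` are
anticommuting unitaries `Z`, `X`, the same is true for Charlie's `Z'`, `X'`, and every outcome of Bob
correlates `Z` with `Z'` and `X` with `X'` perfectly (`SwapModel.exists_pauliModel`). Moving one of
these unitaries around an expectation value, once through an anticommuting operator and once through
its commuting partner, shows that `B b * G * T` has expectation zero for `T` equal to `Z`, `X`,
`Z X` or `X'` and every `G` of the eavesdropper (`SwapModel.stateFun_mul_pauli`). This makes `a` and
`c` uniform given `b` and `G` (`SwapModel.outer_uniform`). Summed over `b`, it says that `Z`, `X`,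
`Z X` have expectation zero together with any operator on `E₁`; since the sources are independent,
they are then also uncorrelated with Charlie's operators, whether the eavesdropper measures `E₁` and
`E₂` separately or jointly (`Strategy.double_split`, `Strategy.weak_split`). But these correlators
are the Fourier coefficients of the distribution of `b`, so `b` is uniform as well
(`SwapModel.bob_uniform`).
-/

open scoped InnerProductSpace
open ContinuousLinearMap

namespace Bilocal

set_option linter.unusedSectionVars false

/-! ### Functionals of density operators -/

section VectorStates

variable {H : Type*} [NormedAddCommGroup H] [InnerProductSpace ℂ H] [CompleteSpace H]
  {κ : Type*}

lemma summable_inner_apply {Ψ : κ → H} (hΨ : Summable fun k => ‖Ψ k‖ ^ 2) (X : H →L[ℂ] H) :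
    Summable fun k => ⟪Ψ k, X (Ψ k)⟫_ℂ := by
  refine Summable.of_norm_bounded (hΨ.mul_left ‖X‖) fun k => ?_
  calc ‖⟪Ψ k, X (Ψ k)⟫_ℂ‖ ≤ ‖Ψ k‖ * ‖X (Ψ k)‖ := norm_inner_le_norm _ _
    _ ≤ ‖Ψ k‖ * (‖X‖ * ‖Ψ k‖) := by gcongr; exact X.le_opNorm _
    _ = ‖X‖ * ‖Ψ k‖ ^ 2 := by ring

/-- The functional `X ↦ tr (ρ X)` of the operator `ρ = ∑ k, |Ψ k⟩⟨Ψ k|`. -/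
noncomputable def stateFun (Ψ : κ → H) (hΨ : Summable fun k => ‖Ψ k‖ ^ 2) :
    (H →L[ℂ] H) →ₗ[ℂ] ℂ where
  toFun X := ∑' k, ⟪Ψ k, X (Ψ k)⟫_ℂ
  map_add' X Y := by
    rw [← (summable_inner_apply hΨ X).tsum_add (summable_inner_apply hΨ Y)]
    simp
  map_smul' c X := by
    simp [tsum_mul_left]

variable (Ψ : κ → H) (hΨ : Summable fun k => ‖Ψ k‖ ^ 2)

lemma stateFun_apply (X : H →L[ℂ] H) : stateFun Ψ hΨ X = ∑' k, ⟪Ψ k, X (Ψ k)⟫_ℂ := rfl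

lemma stateFun_star (X : H →L[ℂ] H) :
    stateFun Ψ hΨ (star X) = (starRingEnd ℂ) (stateFun Ψ hΨ X) := by
  simp only [stateFun_apply, Complex.conj_tsum]
  refine tsum_congr fun k => ?_
  rw [star_eq_adjoint, adjoint_inner_right, inner_conj_symm]

lemma stateFun_re_nonneg {X : H →L[ℂ] H} (hX : 0 ≤ X) : 0 ≤ (stateFun Ψ hΨ X).re := by
  rw [stateFun_apply, Complex.re_tsum (summable_inner_apply hΨ X)]
  exact tsum_nonneg fun k => ((nonneg_iff_isPositive X).1 hX).re_inner_nonneg_right (Ψ k)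

lemma stateFun_re_mono {X Y : H →L[ℂ] H} (h : X ≤ Y) :
    (stateFun Ψ hΨ X).re ≤ (stateFun Ψ hΨ Y).re := by
  have := stateFun_re_nonneg Ψ hΨ (sub_nonneg.2 h)
  simpa using this

/-- A positive operator of expectation zero annihilates all vectors of the decomposition. -/
lemma apply_eq_zero_of_stateFun_re_eq_zero {X : H →L[ℂ] H} (hX : 0 ≤ X)
    (h : (stateFun Ψ hΨ X).re = 0) (k : κ) : X (Ψ k) = 0 := by
  have hpos := fun k => ((nonneg_iff_isPositive X).1 hX).re_inner_nonneg_right (Ψ k)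
  rw [stateFun_apply, Complex.re_tsum (summable_inner_apply hΨ X)] at h
  have hs := (Complex.hasSum_re (summable_inner_apply hΨ X).hasSum).summable
  have h0 := (hasSum_zero_iff_of_nonneg hpos).1 (h ▸ hs.hasSum)
  have hk : (⟪Ψ k, X (Ψ k)⟫_ℂ).re = 0 := congrFun h0 k
  -- `⟨Ψ k, X Ψ k⟩ = ‖√X Ψ k‖²`
  set Y := CFC.sqrt X with hY
  have hYsa : star Y = Y := (CFC.sqrt_nonneg X).isSelfAdjoint
  have hYY : Y * Y = X := CFC.sqrt_mul_sqrt_self X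
  have : ⟪Ψ k, X (Ψ k)⟫_ℂ = ⟪Y (Ψ k), Y (Ψ k)⟫_ℂ := by
    rw [← hYY, mul_apply_eq_comp]
    conv_rhs => rw [← adjoint_inner_right, ← star_eq_adjoint, hYsa]
  rw [this, inner_self_eq_norm_sq_to_K] at hk
  have hz : Y (Ψ k) = 0 := by
    have : ‖Y (Ψ k)‖ ^ 2 = 0 := by exact_mod_cast hk
    simpa using this
  rw [← hYY, mul_apply_eq_comp, hz, map_zero]

lemma stateFun_congr {X Y : H →L[ℂ] H} (h : ∀ k, X (Ψ k) = Y (Ψ k)) :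
    stateFun Ψ hΨ X = stateFun Ψ hΨ Y := by
  simp [stateFun_apply, h]

lemma stateFun_one (h1 : HasSum (fun k => ‖Ψ k‖ ^ 2) 1) : stateFun Ψ hΨ 1 = 1 := by
  rw [stateFun_apply]
  have : (fun k => ⟪Ψ k, (1 : H →L[ℂ] H) (Ψ k)⟫_ℂ) = fun k => ((‖Ψ k‖ ^ 2 : ℝ) : ℂ) := by
    funext k
    simp [inner_self_eq_norm_sq_to_K]
  rw [this, ← Complex.ofReal_tsum, h1.tsum_eq, Complex.ofReal_one]

/-- The real bilinear form `(X, Y) ↦ Re tr (ρ X* P Y)`. -/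
noncomputable def stateForm (P : H →L[ℂ] H) : LinearMap.BilinForm ℝ (H →L[ℂ] H) :=
  LinearMap.mk₂ ℝ (fun X Y => (stateFun Ψ hΨ (star X * P * Y)).re)
    (fun X X' Y => by simp [add_mul])
    (fun c X Y => by
      have : star (c • X) * P * Y = (c : ℂ) • (star X * P * Y) := by
        rw [star_smul, smul_mul_assoc, smul_mul_assoc]; simp
      rw [this, map_smul]; simp)
    (fun X Y Y' => by simp [mul_add])
    (fun c X Y => by
      have : star X * P * (c • Y) = (c : ℂ) • (star X * P * Y) := by
        rw [mul_smul_comm]; simp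
      rw [this, map_smul]; simp)

lemma stateForm_apply (P X Y : H →L[ℂ] H) :
    stateForm Ψ hΨ P X Y = (stateFun Ψ hΨ (star X * P * Y)).re := rfl

variable {Ψ hΨ}

lemma stateForm_symm {P : H →L[ℂ] H} (hP : 0 ≤ P) (X Y : H →L[ℂ] H) :
    stateForm Ψ hΨ P X Y = stateForm Ψ hΨ P Y X := by
  have : star X * P * Y = star (star Y * P * X) := by
    simp [mul_assoc, hP.isSelfAdjoint.star_eq]
  rw [stateForm_apply, this, stateFun_star, stateForm_apply, Complex.conj_re]

lemma stateForm_nonneg {P : H →L[ℂ] H} (hP : 0 ≤ P) (X : H →L[ℂ] H) :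
    0 ≤ stateForm Ψ hΨ P X X :=
  stateFun_re_nonneg Ψ hΨ (star_left_conjugate_nonneg hP X)

/-- The Cauchy-Schwarz inequality. -/
lemma stateForm_sq_le {P : H →L[ℂ] H} (hP : 0 ≤ P) (X Y : H →L[ℂ] H) :
    stateForm Ψ hΨ P X Y ^ 2 ≤ stateForm Ψ hΨ P X X * stateForm Ψ hΨ P Y Y :=
  (stateForm Ψ hΨ P).apply_sq_le_of_symm (stateForm_nonneg hP)
    ⟨fun X Y => stateForm_symm hP X Y⟩ X Y

end VectorStates

/-! ### Extremal correlations -/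

/-- Real vectors of length at most `√p` attaining the tilted correlations are coplanar in the way
of the ideal qubit observables. The four inner products leave no freedom because
`(c + s) ‖D₁ - D₂‖² + (c - s) ‖D₁ + D₂‖²`, with `D₁`, `D₂` the two defects, is at most zero. -/
lemma extremal_vectors {V : Type*} [AddCommGroup V] [Module ℝ V] (β : LinearMap.BilinForm ℝ V)
    (hsymm : ∀ x y, β x y = β y x) (hpos : ∀ x, 0 ≤ β x x) {s c p : ℝ} (hsc : s ^ 2 + c ^ 2 = 1)
    (hs : |s| < c) {a₀ a₁ c₀ c₁ : V} (ha₀ : β a₀ a₀ ≤ p) (ha₁ : β a₁ a₁ ≤ p) (hc₀ : β c₀ c₀ ≤ p)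
    (hc₁ : β c₁ c₁ ≤ p) (h01 : β a₀ c₁ = c * p) (h10 : β a₁ c₀ = c * p) (h00 : β a₀ c₀ = 0)
    (h11 : β a₁ c₁ = 2 * s * c * p) :
    (β a₀ a₀ = p ∧ β a₁ a₁ = p ∧ β c₀ c₀ = p ∧ β c₁ c₁ = p) ∧
      β (a₁ - c • c₀ - s • a₀) (a₁ - c • c₀ - s • a₀) = 0 ∧
      β (c₁ - c • a₀ - s • c₀) (c₁ - c • a₀ - s • c₀) = 0 := by
  obtain ⟨hs1, hs2⟩ := abs_lt.1 hs
  have hc : 0 < c := (abs_nonneg s).trans_lt hs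
  set D₁ := a₁ - c • c₀ - s • a₀ with hD₁
  set D₂ := c₁ - c • a₀ - s • c₀ with hD₂
  have e1 : β D₁ D₁ = β a₁ a₁ + c ^ 2 * β c₀ c₀ + s ^ 2 * β a₀ a₀ - 2 * c * (c * p)
      - 2 * s * β a₀ a₁ := by
    simp only [hD₁, map_sub, map_smul, LinearMap.sub_apply, LinearMap.smul_apply, smul_eq_mul,
      hsymm c₀ a₁, hsymm c₀ a₀, hsymm a₁ a₀, h10, h00]
    ring
  have e2 : β D₂ D₂ = β c₁ c₁ + c ^ 2 * β a₀ a₀ + s ^ 2 * β c₀ c₀ - 2 * c * (c * p)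
      - 2 * s * β c₀ c₁ := by
    simp only [hD₂, map_sub, map_smul, LinearMap.sub_apply, LinearMap.smul_apply, smul_eq_mul,
      hsymm c₁ a₀, hsymm c₀ a₀, hsymm c₁ c₀, h01, h00]
    ring
  have e3 : β D₁ D₂ = c * s * (β a₀ a₀ + β c₀ c₀) - c * (β a₀ a₁ + β c₀ c₁) := by
    simp only [hD₁, hD₂, map_sub, map_smul, LinearMap.sub_apply, LinearMap.smul_apply, smul_eq_mul,
      hsymm c₀ a₀, hsymm a₁ a₀, h01, h00, h10, h11]
    ring
  have em : β (D₁ - D₂) (D₁ - D₂) = β D₁ D₁ + β D₂ D₂ - 2 * β D₁ D₂ := by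
    simp only [map_sub, LinearMap.sub_apply, hsymm D₂ D₁]; ring
  have ep : β (D₁ + D₂) (D₁ + D₂) = β D₁ D₁ + β D₂ D₂ + 2 * β D₁ D₂ := by
    simp only [map_add, LinearMap.add_apply, hsymm D₂ D₁]; ring
  have key : (c + s) * β (D₁ - D₂) (D₁ - D₂) + (c - s) * β (D₁ + D₂) (D₁ + D₂)
      = 2 * c * ((β a₁ a₁ - p) + (β c₁ c₁ - p))
        + 2 * c * (1 - 2 * s ^ 2) * ((β a₀ a₀ - p) + (β c₀ c₀ - p)) := by
    have hc2 : c ^ 2 = 1 - s ^ 2 := by linarith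
    rw [em, ep, e1, e2, e3]
    linear_combination (2 * c * (β a₀ a₀ + β c₀ c₀) - 8 * c * p) * hc2
  have hk : 0 < 1 - 2 * s ^ 2 := by nlinarith
  have pm := mul_nonneg (by linarith : (0 : ℝ) ≤ c + s) (hpos (D₁ - D₂))
  have pp := mul_nonneg (by linarith : (0 : ℝ) ≤ c - s) (hpos (D₁ + D₂))
  have hck : 0 < 2 * c * (1 - 2 * s ^ 2) := by positivity
  have q1 : 0 ≤ 2 * c * (p - β a₁ a₁) := mul_nonneg (by linarith) (by linarith)
  have q2 : 0 ≤ 2 * c * (p - β c₁ c₁) := mul_nonneg (by linarith) (by linarith)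
  have q3 : 0 ≤ 2 * c * (1 - 2 * s ^ 2) * (p - β a₀ a₀) := mul_nonneg hck.le (by linarith)
  have q4 : 0 ≤ 2 * c * (1 - 2 * s ^ 2) * (p - β c₀ c₀) := mul_nonneg hck.le (by linarith)
  have z1 : 2 * c * (p - β a₁ a₁) = 0 := by linarith
  have z2 : 2 * c * (p - β c₁ c₁) = 0 := by linarith
  have z3 : 2 * c * (1 - 2 * s ^ 2) * (p - β a₀ a₀) = 0 := by linarith
  have z4 : 2 * c * (1 - 2 * s ^ 2) * (p - β c₀ c₀) = 0 := by linarith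
  have zm : (c + s) * β (D₁ - D₂) (D₁ - D₂) = 0 := by linarith
  have zp : (c - s) * β (D₁ + D₂) (D₁ + D₂) = 0 := by linarith
  have zm' := (mul_eq_zero.1 zm).resolve_left (by linarith)
  have zp' := (mul_eq_zero.1 zp).resolve_left (by linarith)
  have hsum : β D₁ D₁ + β D₂ D₂ = 0 := by linarith
  have n1 := hpos D₁
  have n2 := hpos D₂
  refine ⟨⟨?_, ?_, ?_, ?_⟩, by linarith, by linarith⟩
  · linarith [(mul_eq_zero.1 z3).resolve_left hck.ne']
  · linarith [(mul_eq_zero.1 z1).resolve_left (by linarith)]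
  · linarith [(mul_eq_zero.1 z4).resolve_left hck.ne']
  · linarith [(mul_eq_zero.1 z2).resolve_left (by linarith)]

/-! ### The ideal subspace of a pair of observables -/

section IdealSubspace

variable {H : Type*} [NormedAddCommGroup H] [InnerProductSpace ℂ H] [CompleteSpace H]

/-- The projection onto a subspace reducing `T` commutes with `T`. -/
lemma commute_starProjection {K : Submodule ℂ H} [K.HasOrthogonalProjection] {T : H →L[ℂ] H}
    (h : ∀ v ∈ K, T v ∈ K) (h' : ∀ v ∈ K, star T v ∈ K) : Commute K.starProjection T := by
  ext v
  simp only [mul_apply_eq_comp]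
  refine Submodule.eq_starProjection_of_mem_orthogonal (h _ (K.starProjection_apply_mem v)) ?_
  rw [← map_sub]
  intro w hw
  have := K.sub_starProjection_mem_orthogonal v _ (h' w hw)
  rwa [star_eq_adjoint, adjoint_inner_left] at this

/-- Let `𝓧` be a set of vectors on which the observables `A₀`, `A₁` satisfy the relations of two
qubit observables at a fixed angle, and on which each of them acts like some operator commuting with
both. The projection onto the closed span of the orbits of `𝓧` under the commutant of `A₀`, `A₁`
then lies in the bicommutant, and the relations hold on its range. -/
lemma exists_idealProjection {A₀ A₁ : H →L[ℂ] H} (hA₀ : IsSelfAdjoint A₀) (hA₁ : IsSelfAdjoint A₁)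
    (r : ℂ) (𝓧 : Set H) (h0 : ∀ χ ∈ 𝓧, A₀ (A₀ χ) = χ) (h1 : ∀ χ ∈ 𝓧, A₁ (A₁ χ) = χ)
    (h01 : ∀ χ ∈ 𝓧, A₀ (A₁ χ) + A₁ (A₀ χ) = r • χ)
    (hT0 : ∀ χ ∈ 𝓧, ∃ T, Commute T A₀ ∧ Commute T A₁ ∧ A₀ χ = T χ)
    (hT1 : ∀ χ ∈ 𝓧, ∃ T, Commute T A₀ ∧ Commute T A₁ ∧ A₁ χ = T χ) :
    ∃ P : H →L[ℂ] H, IsStarProjection P ∧ Commute P A₀ ∧ Commute P A₁ ∧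
      (∀ Y, Commute Y A₀ → Commute Y A₁ → Commute P Y) ∧ (∀ χ ∈ 𝓧, P χ = χ) ∧
      A₀ * A₀ * P = P ∧ A₁ * A₁ * P = P ∧ (A₀ * A₁ + A₁ * A₀) * P = r • P := by
  -- Commutant elements map the orbits to themselves; `A₀` and `A₁` do so because on `𝓧` they act
  -- like commutant elements.
  set gen : Set H := {v | ∃ T χ, Commute T A₀ ∧ Commute T A₁ ∧ χ ∈ 𝓧 ∧ v = T χ} with hgen
  set K : Submodule ℂ H := (Submodule.span ℂ gen).topologicalClosure with hK
  have hgK : ∀ v ∈ gen, v ∈ K := fun v hv =>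
    Submodule.le_topologicalClosure _ (Submodule.subset_span hv)
  have hmap : ∀ Y : H →L[ℂ] H, (∀ v ∈ gen, Y v ∈ gen) → ∀ v ∈ K, Y v ∈ K := by
    intro Y hY
    have hcl : IsClosed ((K.comap (Y : H →ₗ[ℂ] H) : Submodule ℂ H) : Set H) :=
      (Submodule.isClosed_topologicalClosure _).preimage Y.continuous
    exact Submodule.topologicalClosure_minimal _
      (Submodule.span_le.2 fun v hv => show Y v ∈ K from hgK _ (hY v hv)) hcl
  have hzero : ∀ Y : H →L[ℂ] H, (∀ v ∈ gen, Y v = 0) → ∀ v ∈ K, Y v = 0 := by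
    intro Y hY
    have hcl : IsClosed ((LinearMap.ker (Y : H →ₗ[ℂ] H) : Submodule ℂ H) : Set H) :=
      Y.isClosed_ker
    intro v hv
    exact Submodule.topologicalClosure_minimal _
      (Submodule.span_le.2 fun v hv => LinearMap.mem_ker.2 (hY v hv)) hcl hv
  have : CompleteSpace K := (Submodule.isClosed_topologicalClosure _).completeSpace_coe
  have hcomm : ∀ T : H →L[ℂ] H, Commute T A₀ → Commute T A₁ → ∀ v ∈ gen, T v ∈ gen := by
    rintro T hT₀ hT₁ v ⟨T', χ, h₀, h₁, hχ, rfl⟩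
    exact ⟨T * T', χ, hT₀.mul_left h₀, hT₁.mul_left h₁, hχ, rfl⟩
  have app : ∀ {T A : H →L[ℂ] H}, Commute T A → ∀ v, A (T v) = T (A v) := fun h v =>
    (DFunLike.congr_fun h.eq v).symm
  have hA₀gen : ∀ v ∈ gen, A₀ v ∈ gen := by
    rintro v ⟨T, χ, h₀, h₁, hχ, rfl⟩
    obtain ⟨T', h₀', h₁', hT'⟩ := hT0 χ hχ
    exact ⟨T * T', χ, h₀.mul_left h₀', h₁.mul_left h₁', hχ, by rw [app h₀, hT']; rfl⟩
  have hA₁gen : ∀ v ∈ gen, A₁ v ∈ gen := by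
    rintro v ⟨T, χ, h₀, h₁, hχ, rfl⟩
    obtain ⟨T', h₀', h₁', hT'⟩ := hT1 χ hχ
    exact ⟨T * T', χ, h₀.mul_left h₀', h₁.mul_left h₁', hχ, by rw [app h₁, hT']; rfl⟩
  -- An identity between operators in the bicommutant passes from `𝓧` to the whole subspace.
  have hrel : ∀ Y Z : H →L[ℂ] H, (∀ T, Commute T A₀ → Commute T A₁ → Commute T Y ∧ Commute T Z) →
      (∀ χ ∈ 𝓧, Y χ = Z χ) → Y * K.starProjection = Z * K.starProjection := by
    intro Y Z hYZ hχ
    ext v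
    have := hzero (Y - Z) (by
      rintro v ⟨T, χ, h₀, h₁, hχ', rfl⟩
      rw [sub_apply, app (hYZ T h₀ h₁).1, app (hYZ T h₀ h₁).2, hχ χ hχ', sub_self])
      _ (K.starProjection_apply_mem v)
    simpa [sub_eq_zero] using this
  refine ⟨K.starProjection, isStarProjection_starProjection, ?_, ?_, ?_, ?_, ?_, ?_, ?_⟩
  · refine commute_starProjection (hmap _ hA₀gen) (hmap _ ?_)
    rwa [hA₀.star_eq]
  · refine commute_starProjection (hmap _ hA₁gen) (hmap _ ?_)
    rwa [hA₁.star_eq]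
  · intro Y hY₀ hY₁
    refine commute_starProjection (hmap _ (hcomm Y hY₀ hY₁)) (hmap _ (hcomm _ ?_ ?_))
    · have := hY₀.star_star
      rwa [hA₀.star_eq] at this
    · have := hY₁.star_star
      rwa [hA₁.star_eq] at this
  · intro χ hχ
    exact K.starProjection_eq_self_iff.2
      (hgK _ ⟨1, χ, Commute.one_left _, Commute.one_left _, hχ, rfl⟩)
  · conv_rhs => rw [← one_mul K.starProjection]
    exact hrel _ _ (fun T h₀ h₁ => ⟨h₀.mul_right h₀, Commute.one_right _⟩) h0
  · conv_rhs => rw [← one_mul K.starProjection]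
    exact hrel _ _ (fun T h₀ h₁ => ⟨h₁.mul_right h₁, Commute.one_right _⟩) h1
  · rw [show r • K.starProjection = (r • (1 : H →L[ℂ] H)) * K.starProjection by simp]
    exact hrel _ _ (fun T h₀ h₁ => ⟨(h₀.mul_right h₁).add_right (h₁.mul_right h₀),
      (Commute.one_right _).smul_right _⟩) h01

end IdealSubspace

/-! ### Numerical estimates -/

lemma sqrt_mul_add_sqrt_mul_le {p q p' q' : ℝ} (hp : 0 ≤ p) (hq : 0 ≤ q) (hp' : 0 ≤ p')
    (hq' : 0 ≤ q') : √(p * q) + √(p' * q') ≤ √((p + p') * (q + q')) := by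
  refine Real.le_sqrt_of_sq_le ?_
  rw [Real.sqrt_mul hp, Real.sqrt_mul hp']
  have e1 := Real.sq_sqrt hp
  have e2 := Real.sq_sqrt hq
  have e3 := Real.sq_sqrt hp'
  have e4 := Real.sq_sqrt hq'
  rw [← e1, ← e2, ← e3, ← e4]
  simp only [Real.sqrt_sq (Real.sqrt_nonneg _)]
  nlinarith [sq_nonneg (√p * √q' - √p' * √q)]

/-- The three bounds belong to the weights `(1, 1)`, `(1/2, 3/2)`, `(3/2, 1/2)` of the two
constraints. The first one forces the component with the smaller of `G`, `L` to vanish, which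
contradicts the one giving more weight to it. -/
lemma eq_zero_of_mixed_bounds {K G L x y m : ℝ} (hK : 0 < K) (hm : 0 ≤ m) (hx : 0 ≤ x)
    (hy : 0 ≤ y) (hxy : x + y ≤ m) (hG : G ≤ K) (hL : L ≤ K) (hGL : G ≠ L)
    (h1 : K * m ≤ G * x + L * y) (h2 : 4 * K * m ≤ G * x + 9 * L * y)
    (h3 : 4 * K * m ≤ 9 * G * x + L * y) : m = 0 := by
  have z : (K - G) * x + (K - L) * y ≤ 0 := by nlinarith
  have zx : 0 ≤ (K - G) * x := mul_nonneg (by linarith) hx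
  have zy : 0 ≤ (K - L) * y := mul_nonneg (by linarith) hy
  rcases lt_or_gt_of_ne hGL with h | h
  · have : x = 0 := (mul_eq_zero.1 (le_antisymm (by linarith) zx)).resolve_left (by linarith)
    subst this
    nlinarith
  · have : y = 0 := (mul_eq_zero.1 (le_antisymm (by linarith) zy)).resolve_left (by linarith)
    subst this
    nlinarith

/-- The mixed block with weights `1/2`, `3/2` stays below the ideal value if the second component
is at most three eighths. -/
lemma sqrt_mixed_le {c G L x y a : ℝ} (hc : 0 ≤ c) (hc2 : 3 / 4 ≤ c ^ 2) (hGL : G + L = 1)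
    (hG0 : 0 ≤ G) (hG : G ≤ c ^ 2) (hL : L ≤ c ^ 2)
    (ha : 0 ≤ a) (hxy : x + y ≤ a) (hy : y ≤ 3 / 8 * a) (hy0 : 0 ≤ y) :
    √(a * ((1 / 2) ^ 2 * G * x + (3 / 2) ^ 2 * L * y)) ≤ c * a := by
  refine Real.sqrt_le_iff.2 ⟨by positivity, ?_⟩
  rw [show (c * a) ^ 2 = a * (c ^ 2 * a) by ring]
  refine mul_le_mul_of_nonneg_left ?_ ha
  have hx : G * x ≤ G * (a - y) := mul_le_mul_of_nonneg_left (by linarith) hG0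
  rcases le_total (G) (9 * L) with h | h
  · have : (9 * L - G) * y ≤ (9 * L - G) * (3 / 8 * a) :=
      mul_le_mul_of_nonneg_left hy (by linarith)
    have hLa : L * a ≤ c ^ 2 * a := mul_le_mul_of_nonneg_right hL ha
    have hca : 3 / 4 * a ≤ c ^ 2 * a := mul_le_mul_of_nonneg_right hc2 ha
    have hG' : G * a = a - L * a := by rw [show G = 1 - L by linarith]; ring
    nlinarith
  · have : (9 * L - G) * y ≤ 0 := mul_nonpos_of_nonpos_of_nonneg (by linarith) hy0
    have hGa : G * a ≤ c ^ 2 * a := mul_le_mul_of_nonneg_right hG ha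
    have : 0 ≤ c ^ 2 * a := by positivity
    nlinarith

/-- The excluded regime of the doubly non-ideal block: if the two non-ideal parts lean so much
towards one of the two pairs of observables that the correlator exceeds the ideal value, then
reweighting the two constraints gives a contradiction. -/
lemma false_of_leaning {c G L a₀ a₁ c₀ c₁ x y x' y' R₁ R₂ u₁₀ v₁₀ u₀₁ v₀₁ u₁₁ v₁₁ : ℝ}
    (hc : 3 / 4 < c) (hc2 : 3 / 4 ≤ c ^ 2) (hGL : G + L = 1)
    (hG0 : 0 ≤ G) (hG : G ≤ c ^ 2) (hL0 : 0 ≤ L) (hL : L ≤ c ^ 2)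
    (ha₀ : 0 ≤ a₀) (hc₀ : 0 ≤ c₀) (ha₁ : 0 < a₁) (hc₁ : 0 < c₁)
    (hx : 0 ≤ x) (hy : 0 ≤ y) (hxy : x + y ≤ a₁)
    (hx' : 0 ≤ x') (hy' : 0 ≤ y') (hxy' : x' + y' ≤ c₁)
    (hyR : y ≤ (a₁ - R₁) / 2) (hyR' : y' ≤ (c₁ - R₂) / 2)
    (hR₁ : 0 ≤ R₁) (hR₂ : 0 ≤ R₂) (hR : a₁ * c₁ / 4 ≤ R₁ * R₂)
    (h10 : 1 / 2 * u₁₀ + 3 / 2 * v₁₀ ≤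
      c₀ * √(a₁ * ((1 / 2) ^ 2 * L * x + (3 / 2) ^ 2 * G * y)))
    (h01 : 1 / 2 * u₀₁ + 3 / 2 * v₀₁ ≤
      a₀ * √(c₁ * ((1 / 2) ^ 2 * G * x' + (3 / 2) ^ 2 * L * y')))
    (hu : u₁₁ ^ 2 ≤ a₁ * c₁ * (x * x')) (hv : v₁₁ ^ 2 ≤ a₁ * c₁ * (y * y'))
    (hU : c / 2 * (a₁ * c₀ + a₀ * c₁ + a₁ * c₁) ≤ u₁₀ + u₀₁ + u₁₁)
    (hV : c / 2 * (a₁ * c₀ + a₀ * c₁ + a₁ * c₁) ≤ v₁₀ + v₀₁ + v₁₁) : False := by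
  have hc0 : 0 ≤ c := by linarith
  have hR₁' : R₁ ≤ a₁ := by linarith
  have hR₂' : R₂ ≤ c₁ := by linarith
  have hr1 : a₁ / 4 ≤ R₁ := by
    have : R₁ * R₂ ≤ R₁ * c₁ := mul_le_mul_of_nonneg_left hR₂' hR₁
    have : a₁ / 4 * c₁ ≤ R₁ * c₁ := by linarith
    exact le_of_mul_le_mul_right this hc₁
  have hr2 : c₁ / 4 ≤ R₂ := by
    have : R₁ * R₂ ≤ a₁ * R₂ := mul_le_mul_of_nonneg_right hR₁' hR₂
    have : a₁ * (c₁ / 4) ≤ a₁ * R₂ := by linarith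
    exact le_of_mul_le_mul_left this ha₁
  have b10 : c₀ * √(a₁ * ((1 / 2) ^ 2 * L * x + (3 / 2) ^ 2 * G * y)) ≤ c₀ * (c * a₁) :=
    mul_le_mul_of_nonneg_left (sqrt_mixed_le hc0 hc2 (by linarith) hL0 hL hG ha₁.le hxy
      (by linarith) hy) hc₀
  have b01 : a₀ * √(c₁ * ((1 / 2) ^ 2 * G * x' + (3 / 2) ^ 2 * L * y')) ≤ a₀ * (c * c₁) :=
    mul_le_mul_of_nonneg_left (sqrt_mixed_le hc0 hc2 (by linarith) hG0 hG hL hc₁.le hxy'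
      (by linarith) hy') ha₀
  -- With weights `1/2`, `3/2` the blocks with one non-ideal side stay within the ideal value, so the
  -- remaining block would have to reach `c q`, whereas it is at most `3 q / 4`.
  set q := a₁ * c₁ with hq
  have hq0 : 0 < q := mul_pos ha₁ hc₁
  have cs1 : √(x * x') + √(y * y') ≤ √q :=
    (sqrt_mul_add_sqrt_mul_le hx hx' hy hy').trans (Real.sqrt_le_sqrt
      (mul_le_mul hxy hxy' (by positivity) ha₁.le))
  have cs2 : √((a₁ - R₁) * (c₁ - R₂)) + √(R₁ * R₂) ≤ √q := by
    refine (sqrt_mul_add_sqrt_mul_le (by linarith) (by linarith) hR₁ hR₂).trans_eq ?_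
    rw [sub_add_cancel, sub_add_cancel]
  have hhalf : √q / 2 ≤ √(R₁ * R₂) := by
    refine Real.le_sqrt_of_sq_le ?_
    rw [div_pow, Real.sq_sqrt hq0.le]
    linarith
  have hyy : √(y * y') ≤ √((a₁ - R₁) * (c₁ - R₂)) / 2 := by
    refine Real.sqrt_le_iff.2 ⟨by positivity, ?_⟩
    rw [div_pow, Real.sq_sqrt (mul_nonneg (by linarith) (by linarith))]
    have := mul_le_mul hyR hyR' hy' (by linarith)
    linarith
  have bu : u₁₁ ≤ √q * √(x * x') := by
    rw [← Real.sqrt_mul hq0.le]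
    exact Real.le_sqrt_of_sq_le hu
  have bv : v₁₁ ≤ √q * √(y * y') := by
    rw [← Real.sqrt_mul hq0.le]
    exact Real.le_sqrt_of_sq_le hv
  have b11 : 1 / 2 * u₁₁ + 3 / 2 * v₁₁ ≤ 3 / 4 * q := by
    have h1 : 1 / 2 * √(x * x') + 3 / 2 * √(y * y') ≤ 3 / 4 * √q := by linarith
    have h2 := mul_le_mul_of_nonneg_left h1 (Real.sqrt_nonneg q)
    have h3 : √q * √q = q := Real.mul_self_sqrt hq0.le
    nlinarith
  have : 3 / 4 * q < c * q := mul_lt_mul_of_pos_right hc hq0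
  nlinarith

/-- The arithmetic behind rigidity. The index `0` refers to the ideal part and `1` to the rest, on
each side of the network; `u`, `v` are the contributions of the blocks to the two correlators. `R`
and `p` stand for the real and imaginary parts of the correlator of the two observables of one party,
and `x`, `y` for the weights of their half difference and half sum. The bounds on the blocks are compatible with the two constraints only if all the weight is ideal. -/
lemma nonideal_weights_eq_zero
    {c G L a₀ a₁ c₀ c₁ x y x' y' R₁ R₂ p₁ p₂ u₁₀ v₁₀ u₀₁ v₀₁ u₁₁ v₁₁ : ℝ}
    (hc : 0 < c) (hc2 : 3 / 4 ≤ c ^ 2) (hGL : G + L = 1) (hne : G ≠ L)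
    (hG0 : 0 ≤ G) (hG : G ≤ c ^ 2) (hL0 : 0 ≤ L) (hL : L ≤ c ^ 2)
    (ha₀ : 0 < a₀) (hc₀ : 0 < c₀) (ha₁ : 0 ≤ a₁) (hc₁ : 0 ≤ c₁)
    (hx : 0 ≤ x) (hy : 0 ≤ y) (hxy : x + y ≤ a₁)
    (hx' : 0 ≤ x') (hy' : 0 ≤ y') (hxy' : x' + y' ≤ c₁)
    (hxR : x ≤ (a₁ - R₁) / 2) (hyR : y ≤ (a₁ + R₁) / 2)
    (hxR' : x' ≤ (c₁ + R₂) / 2) (hyR' : y' ≤ (c₁ - R₂) / 2)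
    (h10 : ∀ k l : ℝ, 0 ≤ k → 0 ≤ l → k * u₁₀ + l * v₁₀ ≤
      c₀ * √(a₁ * (k ^ 2 * L * x + l ^ 2 * G * y)))
    (h01 : ∀ k l : ℝ, 0 ≤ k → 0 ≤ l → k * u₀₁ + l * v₀₁ ≤
      a₀ * √(c₁ * (k ^ 2 * G * x' + l ^ 2 * L * y')))
    (hu : u₁₁ ^ 2 ≤ a₁ * c₁ * (x * x')) (hv : v₁₁ ^ 2 ≤ a₁ * c₁ * (y * y'))
    (hs1 : 2 * (u₁₁ + v₁₁) ^ 2 ≤ a₁ * c₁ * (a₁ * c₁ - R₁ * R₂ + p₁ * p₂))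
    (hs2 : (u₁₁ + v₁₁) ^ 2 ≤ a₁ * c₁ * (a₁ * c₁ - p₁ * p₂))
    (hU : c / 2 * (a₁ * c₀ + a₀ * c₁ + a₁ * c₁) ≤ u₁₀ + u₀₁ + u₁₁)
    (hV : c / 2 * (a₁ * c₀ + a₀ * c₁ + a₁ * c₁) ≤ v₁₀ + v₀₁ + v₁₁) : a₁ = 0 ∧ c₁ = 0 := by
  have hc34 : 3 / 4 < c := by nlinarith
  have mixed : ∀ {m w z A B : ℝ}, 0 ≤ m → 0 ≤ w → 0 ≤ z → w + z ≤ m → A ≤ c ^ 2 → B ≤ c ^ 2 →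
      √(m * (1 ^ 2 * A * w + 1 ^ 2 * B * z)) ≤ c * m := by
    intro m w z A B hm hw hz hwz hA hB
    refine Real.sqrt_le_iff.2 ⟨by positivity, ?_⟩
    rw [show (c * m) ^ 2 = m * (c ^ 2 * m) by ring]
    refine mul_le_mul_of_nonneg_left ?_ hm
    have := mul_le_mul_of_nonneg_right hA hw
    have := mul_le_mul_of_nonneg_right hB hz
    have := mul_le_mul_of_nonneg_left hwz (sq_nonneg c)
    linarith
  -- One side is ideal.
  have single : ∀ {m w z t u v A B : ℝ}, 0 ≤ m → 0 ≤ w → 0 ≤ z → 0 ≤ A → 0 ≤ B → w + z ≤ m →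
      A ≤ c ^ 2 → B ≤ c ^ 2 → A ≠ B → 0 < t →
      (∀ k l : ℝ, 0 ≤ k → 0 ≤ l → k * u + l * v ≤ t * √(m * (k ^ 2 * A * w + l ^ 2 * B * z))) →
      c / 2 * (t * m) ≤ u → c / 2 * (t * m) ≤ v → m = 0 := by
    intro m w z t u v A B hm hw hz hA0 hB0 hwz hA hB hAB ht hb hu hv
    have step : ∀ k l : ℝ, 0 ≤ k → 0 ≤ l → k + l = 2 →
        c ^ 2 * m ≤ k ^ 2 * A * w + l ^ 2 * B * z ∨ m = 0 := by
      intro k l hk hl hkl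
      have h1 := hb k l hk hl
      have h2 := mul_le_mul_of_nonneg_left hu hk
      have h3 := mul_le_mul_of_nonneg_left hv hl
      have h4 : t * (c * m) ≤ t * √(m * (k ^ 2 * A * w + l ^ 2 * B * z)) := by
        refine le_trans ?_ h1
        have : k * (c / 2 * (t * m)) + l * (c / 2 * (t * m)) = t * (c * m) := by
          rw [← add_mul, hkl]; ring
        linarith
      have h5 := le_of_mul_le_mul_left h4 ht
      have h6 := pow_le_pow_left₀ (by positivity) h5 2
      rw [Real.sq_sqrt (by positivity)] at h6
      rcases hm.eq_or_lt with h0 | h0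
      · exact Or.inr h0.symm
      · refine Or.inl (le_of_mul_le_mul_left ?_ h0)
        linarith
    rcases step 1 1 (by norm_num) (by norm_num) (by norm_num) with h1 | h1
    on_goal 2 => exact h1
    rcases step (1 / 2) (3 / 2) (by norm_num) (by norm_num) (by norm_num) with h2 | h2
    on_goal 2 => exact h2
    rcases step (3 / 2) (1 / 2) (by norm_num) (by norm_num) (by norm_num) with h3 | h3
    on_goal 2 => exact h3
    exact eq_zero_of_mixed_bounds (by positivity) hm hw hz hwz hA hB hAB (by linarith)
      (by linarith) (by linarith)
  rcases ha₁.eq_or_lt with h | h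
  · subst h
    have hu0 : u₁₁ = 0 := pow_eq_zero_iff two_ne_zero |>.1 (le_antisymm (by linarith) (sq_nonneg _))
    have hv0 : v₁₁ = 0 := pow_eq_zero_iff two_ne_zero |>.1 (le_antisymm (by linarith) (sq_nonneg _))
    have h1 := h10 1 0 (by norm_num) le_rfl
    have h2 := h10 0 1 le_rfl (by norm_num)
    simp only [zero_mul, Real.sqrt_zero, mul_zero] at h1 h2
    exact ⟨rfl, single hc₁ hx' hy' hG0 hL0 hxy' hG hL hne ha₀ h01 (by linarith) (by linarith)⟩
  rcases hc₁.eq_or_lt with h' | h'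
  · subst h'
    have hu0 : u₁₁ = 0 := pow_eq_zero_iff two_ne_zero |>.1 (le_antisymm (by linarith) (sq_nonneg _))
    have hv0 : v₁₁ = 0 := pow_eq_zero_iff two_ne_zero |>.1 (le_antisymm (by linarith) (sq_nonneg _))
    have h1 := h01 1 0 (by norm_num) le_rfl
    have h2 := h01 0 1 le_rfl (by norm_num)
    simp only [zero_mul, Real.sqrt_zero, mul_zero] at h1 h2
    exact ⟨single ha₁ hx hy hL0 hG0 hxy hL hG hne.symm hc₀ h10 (by linarith) (by linarith), rfl⟩
  -- No side is ideal. With weights `1`, `1` the last block has to reach `c q` for `q = a₁ c₁`. Adding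
  -- its two bounds eliminates `p₁ p₂` and gives `R₁ R₂ ≤ -q / 4`, so that the two parts lean in
  -- opposite directions.
  exfalso
  have hq0 : 0 < a₁ * c₁ := mul_pos h h'
  have e10 := (h10 1 1 zero_le_one zero_le_one).trans
    (mul_le_mul_of_nonneg_left (mixed ha₁ hx hy hxy hL hG) hc₀.le)
  have e01 := (h01 1 1 zero_le_one zero_le_one).trans
    (mul_le_mul_of_nonneg_left (mixed hc₁ hx' hy' hxy' hG hL) ha₀.le)
  have e11 : c * (a₁ * c₁) ≤ u₁₁ + v₁₁ := by linarith
  have e11' : 3 / 4 * (a₁ * c₁) ^ 2 ≤ (u₁₁ + v₁₁) ^ 2 := by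
    have := pow_le_pow_left₀ (by positivity) e11 2
    rw [mul_pow] at this
    exact (mul_le_mul_of_nonneg_right hc2 (sq_nonneg _)).trans this
  have hRR : R₁ * R₂ ≤ -(a₁ * c₁) / 4 := by
    refine le_of_mul_le_mul_left ?_ hq0
    linarith
  rcases le_or_gt R₁ 0 with hR | hR
  · have hR2 : 0 ≤ R₂ := by
      by_contra! hneg
      linarith [mul_nonneg_of_nonpos_of_nonpos hR hneg.le]
    exact false_of_leaning hc34 hc2 hGL hG0 hG hL0 hL ha₀.le hc₀.le h h' hx hy hxy hx' hy' hxy'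
      (by linarith : y ≤ (a₁ - -R₁) / 2) hyR' (by linarith) hR2 (by linarith)
      (h10 _ _ (by norm_num) (by norm_num)) (h01 _ _ (by norm_num) (by norm_num)) hu hv hU hV
  · have hR2 : R₂ ≤ 0 := by
      by_contra! hneg
      linarith [mul_pos hR hneg]
    refine false_of_leaning (u₁₀ := v₁₀) (v₁₀ := u₁₀) (u₀₁ := v₀₁) (v₀₁ := u₀₁) hc34 hc2
      (by linarith : L + G = 1) hL0 hL hG0 hG ha₀.le hc₀.le h h' hy hx
      (by linarith) hy' hx' (by linarith) hxR (by linarith : x' ≤ (c₁ - -R₂) / 2) hR.le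
      (by linarith) (by linarith) ?_ ?_ hv hu hV hU
    · have := h10 (3 / 2) (1 / 2) (by norm_num) (by norm_num)
      rwa [add_comm, add_comm ((1 / 2 : ℝ) ^ 2 * G * y)]
    · have := h01 (3 / 2) (1 / 2) (by norm_num) (by norm_num)
      rwa [add_comm, add_comm ((1 / 2 : ℝ) ^ 2 * L * y')]

/-! ### Correlators of independent pairs of observables -/

section Blocks

variable {H : Type*} [NormedAddCommGroup H] [InnerProductSpace ℂ H] [CompleteSpace H]
  {κ : Type*} {Ψ : κ → H} {hΨ : Summable fun k => ‖Ψ k‖ ^ 2}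

lemma stateFun_im_eq_zero {T : H →L[ℂ] H} (hT : IsSelfAdjoint T) : (stateFun Ψ hΨ T).im = 0 := by
  have h := stateFun_star Ψ hΨ T
  rw [hT.star_eq] at h
  exact Complex.conj_eq_iff_im.1 h.symm

lemma stateFun_re_smul (r : ℝ) (T : H →L[ℂ] H) :
    (stateFun Ψ hΨ ((r : ℂ) • T)).re = r * (stateFun Ψ hΨ T).re := by
  rw [map_smul, smul_eq_mul, Complex.re_ofReal_mul]

/-- Two commuting star subalgebras that are independent in the state `ρ = ∑ k, |Ψ k⟩⟨Ψ k|`. -/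
structure Independent (Ψ : κ → H) (hΨ : Summable fun k => ‖Ψ k‖ ^ 2)
    (𝓢 𝓣 : StarSubalgebra ℂ (H →L[ℂ] H)) : Prop where
  comm : ∀ X ∈ 𝓢, ∀ Y ∈ 𝓣, X * Y = Y * X
  mul : ∀ X ∈ 𝓢, ∀ Y ∈ 𝓣, stateFun Ψ hΨ (X * Y) = stateFun Ψ hΨ X * stateFun Ψ hΨ Y

variable {𝓢 𝓣 : StarSubalgebra ℂ (H →L[ℂ] H)}

lemma Independent.symm (h : Independent Ψ hΨ 𝓢 𝓣) : Independent Ψ hΨ 𝓣 𝓢 where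
  comm X hX Y hY := (h.comm Y hY X hX).symm
  mul X hX Y hY := by rw [← h.comm Y hY X hX, h.mul Y hY X hX, mul_comm]

lemma Independent.re_mul (h : Independent Ψ hΨ 𝓢 𝓣) {X Y : H →L[ℂ] H} (hX : X ∈ 𝓢) (hY : Y ∈ 𝓣)
    (hXsa : IsSelfAdjoint X) : (stateFun Ψ hΨ (X * Y)).re =
      (stateFun Ψ hΨ X).re * (stateFun Ψ hΨ Y).re := by
  rw [h.mul X hX Y hY, Complex.mul_re, stateFun_im_eq_zero hXsa, zero_mul, sub_zero]

/-- A self-adjoint contraction of a third party, commuting with two algebras. -/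
structure ThirdParty (𝓢 𝓣 : StarSubalgebra ℂ (H →L[ℂ] H)) (S : H →L[ℂ] H) : Prop where
  sa : IsSelfAdjoint S
  sq_le : S * S ≤ 1
  left : ∀ X ∈ 𝓢, X * S = S * X
  right : ∀ Y ∈ 𝓣, Y * S = S * Y

lemma ThirdParty.symm {S : H →L[ℂ] H} (h : ThirdParty 𝓢 𝓣 S) : ThirdParty 𝓣 𝓢 S :=
  ⟨h.sa, h.sq_le, h.right, h.left⟩

lemma conj_contraction_le {T Z : H →L[ℂ] H} (hT1 : T * T ≤ 1) (hZ : 0 ≤ Z)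
    (hc : Z * T = T * Z) : T * Z * T ≤ Z := by
  have hcomm : Commute Z (1 - T * T) := (Commute.one_right Z).sub_right
    ((show Commute Z T from hc).mul_right (show Commute Z T from hc))
  have := Commute.mul_nonneg hZ (sub_nonneg.2 hT1) hcomm
  rw [← sub_nonneg]
  convert this using 1
  rw [mul_sub, mul_one, ← hc, mul_assoc]

lemma ThirdParty.conj_le {S : H →L[ℂ] H} (h : ThirdParty 𝓢 𝓣 S) {Z : H →L[ℂ] H} (hZ : 0 ≤ Z)
    (hc : Z * S = S * Z) : star S * Z * S ≤ Z := by
  rw [h.sa.star_eq]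
  exact conj_contraction_le h.sq_le hZ hc

/-- The Cauchy-Schwarz inequality for a correlator of two independent systems, mediated by a third
party. -/
lemma sq_correlator_le (hI : Independent Ψ hΨ 𝓢 𝓣) {S : H →L[ℂ] H} (hS : ThirdParty 𝓢 𝓣 S)
    {P L R Q L' R' : H →L[ℂ] H} (hP : P ∈ 𝓢) (hP0 : 0 ≤ P) (hL : L ∈ 𝓢) (hR : R ∈ 𝓢)
    (hQ : Q ∈ 𝓣) (hQ0 : 0 ≤ Q) (hL' : L' ∈ 𝓣) (hR' : R' ∈ 𝓣) :
    (stateFun Ψ hΨ (S * ((star L * P * R) * (star L' * Q * R')))).re ^ 2 ≤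
      ((stateFun Ψ hΨ (star L * P * L)).re * (stateFun Ψ hΨ (star L' * Q * L')).re) *
      ((stateFun Ψ hΨ (star R * P * R)).re * (stateFun Ψ hΨ (star R' * Q * R')).re) := by
  have hPQ : 0 ≤ P * Q := Commute.mul_nonneg hP0 hQ0 (hI.comm P hP Q hQ)
  have hLs := star_mem hL
  have hLs' := star_mem hL'
  have hRs := star_mem hR
  have hRs' := star_mem hR'
  have cs := stateForm_sq_le (hΨ := hΨ) (Ψ := Ψ) hPQ (L * L') (S * (R * R'))
  have c1 := fun X hX Y hY => (hI.comm X hX Y hY).symm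
  have c2 : ∀ X ∈ 𝓢, ∀ Y ∈ 𝓣, ∀ Z, Y * (X * Z) = X * (Y * Z) := fun X hX Y hY Z => by
    rw [← mul_assoc, c1 X hX Y hY, mul_assoc]
  have c3 : ∀ X ∈ 𝓢, ∀ Z, X * (S * Z) = S * (X * Z) := fun X hX Z => by
    rw [← mul_assoc, hS.left X hX, mul_assoc]
  have c4 : ∀ X ∈ 𝓣, ∀ Z, X * (S * Z) = S * (X * Z) := fun X hX Z => by
    rw [← mul_assoc, hS.right X hX, mul_assoc]
  have e1 : star (L * L') * (P * Q) * (S * (R * R')) =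
      S * ((star L * P * R) * (star L' * Q * R')) := by
    simp only [star_mul, mul_assoc, c3 _ hP, c3 _ hLs, c4 _ hQ, c4 _ hLs', c2 _ hR _ hQ,
      c2 _ hR _ hLs', c2 _ hP _ hLs', c2 _ hLs _ hLs']
  have e2 : ∀ {U U' : H →L[ℂ] H}, U ∈ 𝓢 → U' ∈ 𝓣 → star (U * U') * (P * Q) * (U * U') =
      (star U * P * U) * (star U' * Q * U') := by
    intro U U' hU hU'
    simp only [star_mul, mul_assoc, c2 _ hU _ hQ, c2 _ hU _ (star_mem hU'),
      c2 _ hP _ (star_mem hU'), c2 _ (star_mem hU) _ (star_mem hU')]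
  have e3 : ∀ {U U' : H →L[ℂ] H}, U ∈ 𝓢 → U' ∈ 𝓣 → (stateFun Ψ hΨ
      (star (U * U') * (P * Q) * (U * U'))).re =
      (stateFun Ψ hΨ (star U * P * U)).re * (stateFun Ψ hΨ (star U' * Q * U')).re := by
    intro U U' hU hU'
    rw [e2 hU hU', hI.re_mul (mul_mem (mul_mem (star_mem hU) hP) hU)
      (mul_mem (mul_mem (star_mem hU') hQ) hU') (hP0.isSelfAdjoint.conjugate' U)]
  have e4 : stateForm Ψ hΨ (P * Q) (S * (R * R')) (S * (R * R')) ≤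
      (stateFun Ψ hΨ (star R * P * R)).re * (stateFun Ψ hΨ (star R' * Q * R')).re := by
    rw [← e3 hR hR', stateForm_apply]
    refine stateFun_re_mono Ψ hΨ ?_
    have := star_left_conjugate_le_conjugate (hS.conj_le hPQ (by
      rw [mul_assoc, hS.right Q hQ, ← mul_assoc, hS.left P hP, mul_assoc])) (R * R')
    convert this using 1
    simp only [star_mul, mul_assoc]
  rw [stateForm_apply, e1, stateForm_apply, e3 hL hL'] at cs
  refine cs.trans (mul_le_mul_of_nonneg_left e4 ?_)
  rw [← e3 hL hL']
  exact stateFun_re_nonneg Ψ hΨ (star_left_conjugate_nonneg hPQ _)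

/-- The correlator of two observables `X`, `X'`, localised by `P` and `Q`. -/
lemma sq_block_le (hI : Independent Ψ hΨ 𝓢 𝓣) {S : H →L[ℂ] H} (hS : ThirdParty 𝓢 𝓣 S)
    {P X Q X' : H →L[ℂ] H} (hP : P ∈ 𝓢) (hP0 : 0 ≤ P) (hX : X ∈ 𝓢) (hXsa : IsSelfAdjoint X)
    (hXP : Commute X P) (hQ : Q ∈ 𝓣) (hQ0 : 0 ≤ Q) (hX' : X' ∈ 𝓣) (hXsa' : IsSelfAdjoint X')
    (hXQ : Commute X' Q) :
    (stateFun Ψ hΨ (S * ((X * P) * (X' * Q)))).re ^ 2 ≤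
      ((stateFun Ψ hΨ P).re * (stateFun Ψ hΨ Q).re) *
      ((stateFun Ψ hΨ (X * X * P)).re * (stateFun Ψ hΨ (X' * X' * Q)).re) := by
  have := sq_correlator_le hI hS hP hP0 (one_mem _) hX hQ hQ0 (one_mem _) hX'
  simp only [star_one, one_mul, mul_one, hXsa.star_eq, hXsa'.star_eq] at this
  rw [show X * P * X = X * X * P by rw [mul_assoc, ← hXP.eq, mul_assoc],
    show X' * Q * X' = X' * X' * Q by rw [mul_assoc, ← hXQ.eq, mul_assoc], ← hXP.eq, ← hXQ.eq]
    at this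
  exact this

end Blocks

/-! ### Blocks with one ideal side -/

section MixedBlock

variable {H : Type*} [NormedAddCommGroup H] [InnerProductSpace ℂ H] [CompleteSpace H]
  {κ : Type*} {Ψ : κ → H} {hΨ : Summable fun k => ‖Ψ k‖ ^ 2}
  {𝓢 𝓣 : StarSubalgebra ℂ (H →L[ℂ] H)}

/-- The two spectral projections `F₊`, `F₋` of `i X Y / (h g)` for anticommuting observables with
`X² = h²`, `Y² = g²` on the range of `Q`. The observable `X` exchanges them, and `Y` agrees on them
with `X` up to a phase. -/
lemma exists_sectors {X Y Q : H →L[ℂ] H} (hX : X ∈ 𝓣) (hXsa : IsSelfAdjoint X)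
    (hY : Y ∈ 𝓣) (hYsa : IsSelfAdjoint Y) (hQ : Q ∈ 𝓣) (hQp : IsStarProjection Q)
    (hXQ : Commute X Q) (hYQ : Commute Y Q) {h g : ℝ} (hh : 0 < h) (hg : 0 < g)
    (hX2 : X * X * Q = ((h ^ 2 : ℝ) : ℂ) • Q) (hY2 : Y * Y * Q = ((g ^ 2 : ℝ) : ℂ) • Q)
    (hanti : (X * Y + Y * X) * Q = 0) :
    ∃ F F' : H →L[ℂ] H, F ∈ 𝓣 ∧ F' ∈ 𝓣 ∧ IsStarProjection F ∧ IsStarProjection F' ∧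
      F + F' = Q ∧ F' * X * F = X * F ∧ F * X * F' = X * F' ∧
      X * X * F = ((h ^ 2 : ℝ) : ℂ) • F ∧ X * X * F' = ((h ^ 2 : ℝ) : ℂ) • F' ∧
      X * Q = X * F + X * F' ∧
      Y * Q = (-(Complex.I * g / h)) • (X * F) + (Complex.I * g / h) • (X * F') := by
  have hhC : (h : ℂ) ≠ 0 := by exact_mod_cast hh.ne'
  have hgC : (g : ℂ) ≠ 0 := by exact_mod_cast hg.ne'
  have hQQ : Q * Q = Q := hQp.isIdempotentElem
  have hQs : star Q = Q := hQp.isSelfAdjoint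
  have hYX : Y * X * Q = -(X * Y * Q) := by
    rw [add_mul] at hanti
    exact eq_neg_of_add_eq_zero_right hanti
  -- `W / (h g)` is a skew-adjoint unitary on the range of `Q`.
  set W := X * Y * Q with hW
  have hWs : star W = -W := by
    rw [hW, star_mul, star_mul, hXsa.star_eq, hYsa.star_eq, hQs, ← hYX,
      ← mul_assoc, ← hYQ.eq, mul_assoc, ← hXQ.eq, mul_assoc]
  have hQW : Q * W = W := by
    rw [hW, ← mul_assoc, ← mul_assoc, ← hXQ.eq, mul_assoc X Q Y, ← hYQ.eq, ← mul_assoc, mul_assoc,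
      hQQ]
  have hWQ : W * Q = W := by rw [hW, mul_assoc, hQQ]
  have hXW : X * W = ((h ^ 2 : ℝ) : ℂ) • (Y * Q) := by
    have : X * W = (X * X * Q) * Y := by
      rw [hW, mul_assoc, hYQ.eq, mul_assoc, mul_assoc]
    rw [this, hX2, smul_mul_assoc, hYQ.eq]
  have hWX : W * X = -(((h ^ 2 : ℝ) : ℂ) • (Y * Q)) := by
    rw [← hXW, hW, mul_assoc, ← hXQ.eq, ← mul_assoc, mul_assoc X Y X, mul_assoc X (Y * X) Q, hYX,
      mul_neg]
  have hWW : W * W = -(((h ^ 2 * g ^ 2 : ℝ) : ℂ) • Q) := by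
    have : W * W = W * X * (Y * Q) := by
      rw [hW]; simp only [mul_assoc]
    rw [this, hWX, neg_mul, smul_mul_assoc, mul_assoc Y Q, ← mul_assoc Q Y, ← hYQ.eq,
      mul_assoc Y Q Q, hQQ, ← mul_assoc, hY2, smul_smul]
    push_cast
    rfl
  set t : ℂ := Complex.I / (h * g) with ht
  have hts : (starRingEnd ℂ) t = -t := by
    simp [ht, neg_div]
  have htt : t * t * ((h ^ 2 * g ^ 2 : ℝ) : ℂ) = -1 := by
    rw [ht]
    push_cast
    field_simp
    exact Complex.I_sq
  have proj : ∀ e : ℂ, e * e = 1 → (starRingEnd ℂ) e = e →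
      IsStarProjection ((1 / 2 : ℂ) • (Q + (e * t) • W)) := by
    intro e he hes
    constructor
    · have : (e * t) * (e * t) * ((h ^ 2 * g ^ 2 : ℝ) : ℂ) = -1 := by
        rw [← htt]
        linear_combination (t * t * ((h ^ 2 * g ^ 2 : ℝ) : ℂ)) * he
      simp only [IsIdempotentElem, smul_mul_assoc, mul_smul_comm, add_mul, mul_add, hQQ, hQW, hWQ,
        hWW, smul_neg, smul_smul]
      rw [smul_add (e * t * (1 / 2)), smul_neg, smul_smul,
        show e * t * (1 / 2) * (e * t * ((h ^ 2 * g ^ 2 : ℝ) : ℂ)) = -(1 / 2) by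
          linear_combination (1 / 2) * this]
      module
    · rw [IsSelfAdjoint, star_smul, star_add, star_smul, hQs, hWs]
      simp only [Complex.star_def, map_mul, hts, hes, map_div₀, map_one, map_ofNat]
      simp
  have sw : ∀ e : ℂ, ((1 / 2 : ℂ) • (Q + (-e * t) • W)) * X = X * ((1 / 2 : ℂ) • (Q + (e * t) • W))
      := by
    intro e
    simp only [smul_mul_assoc, mul_smul_comm, add_mul, mul_add, hXW, hWX, hXQ.eq]
    module
  have hsum : (1 / 2 : ℂ) • (Q + ((1 : ℂ) * t) • W) + (1 / 2 : ℂ) • (Q + (-1 * t) • W) = Q := by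
    module
  have sq : ∀ e : ℂ, X * X * ((1 / 2 : ℂ) • (Q + (e * t) • W)) =
      ((h ^ 2 : ℝ) : ℂ) • ((1 / 2 : ℂ) • (Q + (e * t) • W)) := by
    intro e
    have : X * X * W = ((h ^ 2 : ℝ) : ℂ) • W := by
      rw [mul_assoc, hXW, mul_smul_comm, ← mul_assoc, ← hW]
    simp only [mul_smul_comm, mul_add, hX2, this]
    module
  have mem : ∀ e : ℂ, (1 / 2 : ℂ) • (Q + (e * t) • W) ∈ 𝓣 := fun e =>
    SMulMemClass.smul_mem _ (add_mem hQ (SMulMemClass.smul_mem _ (mul_mem (mul_mem hX hY) hQ)))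
  have p1 := proj 1 (by norm_num) (by simp)
  have p2 := proj (-1) (by norm_num) (by simp)
  have s1 := sw 1
  have s2 := sw (-1)
  rw [neg_neg] at s2
  refine ⟨_, _, mem 1, mem (-1), p1, p2, hsum, ?_, ?_, sq 1, sq (-1), ?_, ?_⟩
  · rw [s1, mul_assoc, p1.isIdempotentElem.eq]
  · rw [s2, mul_assoc, p2.isIdempotentElem.eq]
  · rw [← mul_add, hsum]
  · simp only [mul_smul_comm, mul_add, hXW, smul_smul]
    have e1 : Complex.I * g / h * (t * ((h ^ 2 : ℝ) : ℂ)) = -1 := by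
      rw [ht]; push_cast; field_simp; exact Complex.I_sq
    have e2 : -(Complex.I * g / h) * (1 / 2 * (1 * t * ((h ^ 2 : ℝ) : ℂ))) = 1 / 2 := by
      linear_combination (-1 / 2) * e1
    have e3 : (Complex.I * g / h) * (1 / 2 * (-1 * t * ((h ^ 2 : ℝ) : ℂ))) = 1 / 2 := by
      linear_combination (-1 / 2) * e1
    simp only [smul_add, smul_smul, mul_assoc] at e2 e3 ⊢
    rw [e2, e3]
    module

/-- The correlator of an arbitrary pair of observables `X`, `Y` with a pair of anticommuting ones.
The sectors of the latter contribute separately, and the cross terms of `X` and `Y` cancel between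
the two sectors. -/
lemma mixed_block_le (hI : Independent Ψ hΨ 𝓢 𝓣) {S : H →L[ℂ] H} (hS : ThirdParty 𝓢 𝓣 S)
    {P X Y Q X' Y' : H →L[ℂ] H} (hP : P ∈ 𝓢) (hP0 : 0 ≤ P) (hX : X ∈ 𝓢) (hXsa : IsSelfAdjoint X)
    (hXP : Commute X P) (hY : Y ∈ 𝓢) (hYsa : IsSelfAdjoint Y) (hYP : Commute Y P)
    (hX' : X' ∈ 𝓣) (hXsa' : IsSelfAdjoint X')
    (hY' : Y' ∈ 𝓣) (hYsa' : IsSelfAdjoint Y') (hQ : Q ∈ 𝓣) (hQp : IsStarProjection Q)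
    (hXQ : Commute X' Q) (hYQ : Commute Y' Q) {h g : ℝ} (hh : 0 < h) (hg : 0 < g)
    (hX2 : X' * X' * Q = ((h ^ 2 : ℝ) : ℂ) • Q) (hY2 : Y' * Y' * Q = ((g ^ 2 : ℝ) : ℂ) • Q)
    (hanti : (X' * Y' + Y' * X') * Q = 0) (k l : ℝ) :
    k * (stateFun Ψ hΨ (S * ((X * P) * (X' * Q)))).re
        + l * (stateFun Ψ hΨ (S * ((Y * P) * (Y' * Q)))).re ≤
      (stateFun Ψ hΨ Q).re * √((stateFun Ψ hΨ P).re *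
        (k ^ 2 * h ^ 2 * (stateFun Ψ hΨ (X * X * P)).re
          + l ^ 2 * g ^ 2 * (stateFun Ψ hΨ (Y * Y * P)).re)) := by
  obtain ⟨F, F', hF, hF', hFp, hFp', hFF, hsw, hsw', hsq, hsq', hXF, hYF⟩ :=
    exists_sectors hX' hXsa' hY' hYsa' hQ hQp hXQ hYQ hh hg hX2 hY2 hanti
  have hhC : (h : ℂ) ≠ 0 := by exact_mod_cast hh.ne'
  -- Within a sector `k X X' + l Y Y'` becomes `(k X ∓ μ Y) X'`.
  set μ : ℂ := l * (Complex.I * g / h) with hμ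
  have hμs : (starRingEnd ℂ) μ = -μ := by simp [hμ, neg_div]
  have hμμ : μ * μ = -((l ^ 2 * g ^ 2 / h ^ 2 : ℝ) : ℂ) := by
    rw [hμ]; push_cast; field_simp
    rw [Complex.I_sq]; ring
  set D := (k : ℂ) • X + (-μ) • Y with hD
  set D' := (k : ℂ) • X + μ • Y with hD'
  have mD : D ∈ 𝓢 := add_mem (SMulMemClass.smul_mem _ hX) (SMulMemClass.smul_mem _ hY)
  have mD' : D' ∈ 𝓢 := add_mem (SMulMemClass.smul_mem _ hX) (SMulMemClass.smul_mem _ hY)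
  have hDs : star D = D' := by
    simp [hD, hD', star_smul, hXsa.star_eq, hYsa.star_eq, hμs]
  have hDs' : star D' = D := by rw [← hDs, star_star]
  -- `X'` maps the sector `G` isometrically, up to the factor `h`, to the other sector `G'`.
  have sector : ∀ {D G G' : H →L[ℂ] H}, D ∈ 𝓢 → G ∈ 𝓣 → G' ∈ 𝓣 → IsStarProjection G →
      IsStarProjection G' → G' * X' * G = X' * G → X' * X' * G = ((h ^ 2 : ℝ) : ℂ) • G →
      (stateFun Ψ hΨ (S * ((P * D) * (X' * G)))).re ^ 2 ≤
        ((stateFun Ψ hΨ P).re * (stateFun Ψ hΨ G').re) *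
        ((stateFun Ψ hΨ (star D * P * D)).re * (h ^ 2 * (stateFun Ψ hΨ G).re)) := by
    intro D G G' mD mG mG' pG pG' hsw hsq
    have := sq_correlator_le hI hS hP hP0 (one_mem _) mD (one_mem _) zero_le_one mG'
      (mul_mem hX' mG)
    have e : star (X' * G) * (X' * G) = ((h ^ 2 : ℝ) : ℂ) • G := by
      rw [star_mul, hXsa'.star_eq, pG.isSelfAdjoint.star_eq, mul_assoc, ← mul_assoc X', hsq,
        mul_smul_comm, pG.isIdempotentElem.eq]
    simp only [star_one, one_mul, mul_one, pG'.isSelfAdjoint.star_eq, pG'.isIdempotentElem.eq] at this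
    rw [← mul_assoc G' X' G, hsw, e, map_smul, smul_eq_mul, Complex.re_ofReal_mul] at this
    exact this
  have b1 := sector mD hF hF' hFp hFp' hsw hsq
  have b2 := sector mD' hF' hF hFp' hFp hsw' hsq'
  have hsplit : k * (stateFun Ψ hΨ (S * ((X * P) * (X' * Q)))).re
        + l * (stateFun Ψ hΨ (S * ((Y * P) * (Y' * Q)))).re =
      (stateFun Ψ hΨ (S * ((P * D) * (X' * F)))).re
        + (stateFun Ψ hΨ (S * ((P * D') * (X' * F')))).re := by
    rw [← stateFun_re_smul, ← stateFun_re_smul, ← Complex.add_re, ← Complex.add_re, ← map_add,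
      ← map_add]
    congr 2
    rw [hXF, hYF, hD, hD', hμ]
    simp only [mul_add, add_mul, mul_smul_comm, smul_mul_assoc, hXP.eq, hYP.eq, smul_add, smul_smul]
    module
  have hDD : (stateFun Ψ hΨ (star D * P * D)).re + (stateFun Ψ hΨ (star D' * P * D')).re =
      2 * (k ^ 2 * (stateFun Ψ hΨ (X * X * P)).re
        + l ^ 2 * g ^ 2 / h ^ 2 * (stateFun Ψ hΨ (Y * Y * P)).re) := by
    have e : star D * P * D + star D' * P * D' = ((2 * k ^ 2 : ℝ) : ℂ) • (X * X * P)
        + ((2 * (l ^ 2 * g ^ 2 / h ^ 2) : ℝ) : ℂ) • (Y * Y * P) := by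
      rw [hDs, hDs', show ((2 * (l ^ 2 * g ^ 2 / h ^ 2) : ℝ) : ℂ) = -(2 * (μ * μ)) by
        rw [hμμ]; push_cast; ring,
        show X * X * P = X * P * X by rw [mul_assoc, hXP.eq, ← mul_assoc, hXP.eq],
        show Y * Y * P = Y * P * Y by rw [mul_assoc, hYP.eq, ← mul_assoc, hYP.eq], hD, hD']
      simp only [mul_add, add_mul, mul_smul_comm, smul_mul_assoc, smul_add, smul_smul]
      push_cast
      module
    rw [← Complex.add_re, ← map_add, e, map_add, Complex.add_re, stateFun_re_smul,
      stateFun_re_smul]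
    ring
  have hQre : (stateFun Ψ hΨ F).re + (stateFun Ψ hΨ F').re = (stateFun Ψ hΨ Q).re := by
    rw [← Complex.add_re, ← map_add, hFF]
  have f0 := stateFun_re_nonneg Ψ hΨ hFp.nonneg
  have f0' := stateFun_re_nonneg Ψ hΨ hFp'.nonneg
  have p0 := stateFun_re_nonneg Ψ hΨ hP0
  have d0 := stateFun_re_nonneg Ψ hΨ (star_left_conjugate_nonneg hP0 D)
  have d0' := stateFun_re_nonneg Ψ hΨ (star_left_conjugate_nonneg hP0 D')
  rw [hsplit, ← hQre]
  set f := (stateFun Ψ hΨ F).re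
  set f' := (stateFun Ψ hΨ F').re
  set p := (stateFun Ψ hΨ P).re
  set d := (stateFun Ψ hΨ (star D * P * D)).re
  set d' := (stateFun Ψ hΨ (star D' * P * D')).re
  have hN : k ^ 2 * h ^ 2 * (stateFun Ψ hΨ (X * X * P)).re
      + l ^ 2 * g ^ 2 * (stateFun Ψ hΨ (Y * Y * P)).re = h ^ 2 * (d + d') / 2 := by
    rw [hDD]; field_simp
  rw [hN]
  have r1 : (stateFun Ψ hΨ (S * ((P * D) * (X' * F)))).re ≤ (√f * √f') * √(p * h ^ 2) * √d := by
    rw [← Real.sqrt_mul f0, ← Real.sqrt_mul (by positivity), ← Real.sqrt_mul (by positivity)]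
    exact Real.le_sqrt_of_sq_le (b1.trans_eq (by ring))
  have r2 : (stateFun Ψ hΨ (S * ((P * D') * (X' * F')))).re ≤ (√f * √f') * √(p * h ^ 2) * √d' := by
    rw [← Real.sqrt_mul f0, ← Real.sqrt_mul (by positivity), ← Real.sqrt_mul (by positivity)]
    exact Real.le_sqrt_of_sq_le (b2.trans_eq (by ring))
  have hff : √f * √f' ≤ (f + f') / 2 := by
    nlinarith [sq_nonneg (√f - √f'), Real.sq_sqrt f0, Real.sq_sqrt f0']
  have hdd : √d + √d' ≤ 2 * √((d + d') / 2) := by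
    rw [show (2 : ℝ) * √((d + d') / 2) = √(2 ^ 2 * ((d + d') / 2)) by
      rw [Real.sqrt_mul (by norm_num), Real.sqrt_sq (by norm_num)]]
    refine Real.le_sqrt_of_sq_le ?_
    nlinarith [sq_nonneg (√d - √d'), Real.sq_sqrt d0, Real.sq_sqrt d0']
  rw [show p * (h ^ 2 * (d + d') / 2) = p * h ^ 2 * ((d + d') / 2) by ring,
    Real.sqrt_mul (by positivity)]
  calc _ ≤ (√f * √f') * √(p * h ^ 2) * (√d + √d') := by linarith
    _ ≤ ((f + f') / 2) * √(p * h ^ 2) * (2 * √((d + d') / 2)) := by gcongr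
    _ = _ := by ring

end MixedBlock

/-! ### The ideal block and the block without an ideal side -/

section DoubleBlock

variable {H : Type*} [NormedAddCommGroup H] [InnerProductSpace ℂ H] [CompleteSpace H]
  {κ : Type*} {Ψ : κ → H} {hΨ : Summable fun k => ‖Ψ k‖ ^ 2}
  {𝓢 𝓣 : StarSubalgebra ℂ (H →L[ℂ] H)}

/-- An observable `T` of square `r²` on `Q` has expectation at most `r` after postselection on a
positive operator `B`. -/
lemma abs_stateFun_re_le {B T Q : H →L[ℂ] H} (hB : 0 ≤ B) (hT : IsSelfAdjoint T) (hQ : 0 ≤ Q)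
    (hBT : Commute B T) (hBQ : Commute B Q) (hTQ : Commute T Q) {r : ℝ} (hr : 0 ≤ r)
    (h : T * T * Q = ((r ^ 2 : ℝ) : ℂ) • Q) :
    |(stateFun Ψ hΨ (B * (T * Q))).re| ≤ r * (stateFun Ψ hΨ (B * Q)).re := by
  have hBQ0 : 0 ≤ B * Q := Commute.mul_nonneg hB hQ hBQ
  have cs := stateForm_sq_le (hΨ := hΨ) (Ψ := Ψ) hBQ0 1 T
  simp only [stateForm_apply, star_one, one_mul, mul_one, hT.star_eq] at cs
  have e : T * (B * Q) * T = ((r ^ 2 : ℝ) : ℂ) • (B * Q) := by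
    rw [mul_assoc, mul_assoc B, ← hTQ.eq, ← mul_assoc, ← hBT.eq, mul_assoc, ← mul_assoc T T, h,
      mul_smul_comm]
  rw [e, stateFun_re_smul, mul_assoc B, ← hTQ.eq] at cs
  exact abs_le_of_sq_le_sq (cs.trans_eq (by ring))
    (mul_nonneg hr (stateFun_re_nonneg Ψ hΨ hBQ0))

/-- Two bounds on the correlator `A₀ C₁ - A₁ C₀` of two pairs of contractions on independent systems,
mediated by a third party. The product of the imaginary parts of `tr (ρ A₀ P A₁)` and
`tr (ρ C₁ Q C₀)` enters them with opposite signs, so it can be eliminated. -/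
lemma sq_double_block_le (hI : Independent Ψ hΨ 𝓢 𝓣) {S : H →L[ℂ] H} (hS : ThirdParty 𝓢 𝓣 S)
    {P A₀ A₁ Q C₀ C₁ : H →L[ℂ] H} (hP : P ∈ 𝓢) (hP0 : 0 ≤ P) (hQ : Q ∈ 𝓣) (hQ0 : 0 ≤ Q)
    (hA₀ : A₀ ∈ 𝓢) (hA₁ : A₁ ∈ 𝓢) (hA₀s : IsSelfAdjoint A₀) (hA₁s : IsSelfAdjoint A₁)
    (hA₀1 : A₀ * A₀ ≤ 1) (hA₁1 : A₁ * A₁ ≤ 1) (hA₀P : Commute A₀ P) (hA₁P : Commute A₁ P)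
    (hC₀ : C₀ ∈ 𝓣) (hC₁ : C₁ ∈ 𝓣) (hC₀s : IsSelfAdjoint C₀) (hC₁s : IsSelfAdjoint C₁)
    (hC₀1 : C₀ * C₀ ≤ 1) (hC₁1 : C₁ * C₁ ≤ 1) (hC₀Q : Commute C₀ Q) (hC₁Q : Commute C₁ Q)
    {p q e : ℝ} (hp : p = (stateFun Ψ hΨ P).re) (hq : q = (stateFun Ψ hΨ Q).re)
    (he : e = (stateFun Ψ hΨ (S * ((A₀ * P) * (C₁ * Q)))).re
      - (stateFun Ψ hΨ (S * ((A₁ * P) * (C₀ * Q)))).re)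
    {z w : ℂ} (hz : z = stateFun Ψ hΨ (A₀ * P * A₁)) (hw : w = stateFun Ψ hΨ (C₁ * Q * C₀)) :
    e ^ 2 ≤ (p * q) * (2 * (p * q - z.re * w.re + z.im * w.im)) ∧
      e ^ 2 ≤ 4 * ((p * q) * (p * q - z.im * w.im)) := by
  -- Rewriting rules: `S` to the left, then `𝓢`, then `𝓣`.
  have c1 := fun X hX Y hY => (hI.comm X hX Y hY).symm
  have c2 : ∀ X ∈ 𝓢, ∀ Y ∈ 𝓣, ∀ Z, Y * (X * Z) = X * (Y * Z) := fun X hX Y hY Z => by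
    rw [← mul_assoc, c1 X hX Y hY, mul_assoc]
  have c3 : ∀ X ∈ 𝓢, ∀ Z, X * (S * Z) = S * (X * Z) := fun X hX Z => by
    rw [← mul_assoc, hS.left X hX, mul_assoc]
  have c4 : ∀ X ∈ 𝓣, ∀ Z, X * (S * Z) = S * (X * Z) := fun X hX Z => by
    rw [← mul_assoc, hS.right X hX, mul_assoc]
  have hPQ : 0 ≤ P * Q := Commute.mul_nonneg hP0 hQ0 (hI.comm P hP Q hQ)
  have hp0 : 0 ≤ p := hp ▸ stateFun_re_nonneg Ψ hΨ hP0
  have hq0 : 0 ≤ q := hq ▸ stateFun_re_nonneg Ψ hΨ hQ0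
  have hz' : stateFun Ψ hΨ (A₁ * P * A₀) = (starRingEnd ℂ) z := by
    rw [hz, ← stateFun_star]
    simp only [star_mul, hA₀s.star_eq, hA₁s.star_eq, hP0.isSelfAdjoint.star_eq, mul_assoc]
  have hw' : stateFun Ψ hΨ (C₀ * Q * C₁) = (starRingEnd ℂ) w := by
    rw [hw, ← stateFun_star]
    simp only [star_mul, hC₀s.star_eq, hC₁s.star_eq, hQ0.isSelfAdjoint.star_eq, mul_assoc]
  have nA : ∀ {T : H →L[ℂ] H}, IsSelfAdjoint T → T * T ≤ 1 → Commute T P →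
      0 ≤ (stateFun Ψ hΨ (T * P * T)).re ∧ (stateFun Ψ hΨ (T * P * T)).re ≤ p := fun {T} h1 h2 h3 =>
    ⟨stateFun_re_nonneg Ψ hΨ (by simpa [h1.star_eq] using star_left_conjugate_nonneg hP0 T),
      hp ▸ stateFun_re_mono Ψ hΨ (conj_contraction_le h2 hP0 h3.eq.symm)⟩
  have nC : ∀ {T : H →L[ℂ] H}, IsSelfAdjoint T → T * T ≤ 1 → Commute T Q →
      0 ≤ (stateFun Ψ hΨ (T * Q * T)).re ∧ (stateFun Ψ hΨ (T * Q * T)).re ≤ q := fun {T} h1 h2 h3 =>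
    ⟨stateFun_re_nonneg Ψ hΨ (by simpa [h1.star_eq] using star_left_conjugate_nonneg hQ0 T),
      hq ▸ stateFun_re_mono Ψ hΨ (conj_contraction_le h2 hQ0 h3.eq.symm)⟩
  obtain ⟨a0, a0'⟩ := nA hA₀s hA₀1 hA₀P
  obtain ⟨a1, a1'⟩ := nA hA₁s hA₁1 hA₁P
  obtain ⟨b0, b0'⟩ := nC hC₀s hC₀1 hC₀Q
  obtain ⟨b1, b1'⟩ := nC hC₁s hC₁1 hC₁Q
  constructor
  · have cs := stateForm_sq_le (hΨ := hΨ) (Ψ := Ψ) hPQ S (A₀ * C₁ - A₁ * C₀)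
    have l1 : stateForm Ψ hΨ (P * Q) S (A₀ * C₁ - A₁ * C₀) = e := by
      rw [stateForm_apply, he, ← Complex.sub_re, ← map_sub]
      congr 2
      rw [hS.sa.star_eq, mul_sub, mul_assoc S, mul_assoc S, ← mul_sub, ← mul_sub]
      rw [hA₀P.eq, hA₁P.eq, hC₀Q.eq, hC₁Q.eq]
      simp only [mul_sub, mul_assoc, c2 _ hA₀ _ hQ, c2 _ hA₁ _ hQ]
    have l2 : stateForm Ψ hΨ (P * Q) S S ≤ p * q := by
      rw [hp, hq, ← hI.re_mul hP hQ hP0.isSelfAdjoint, stateForm_apply]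
      exact stateFun_re_mono Ψ hΨ (hS.conj_le hPQ (by
        rw [mul_assoc, hS.right Q hQ, ← mul_assoc, hS.left P hP, mul_assoc]))
    have l3 : stateForm Ψ hΨ (P * Q) (A₀ * C₁ - A₁ * C₀) (A₀ * C₁ - A₁ * C₀) ≤
        2 * (p * q - z.re * w.re + z.im * w.im) := by
      have ex : star (A₀ * C₁ - A₁ * C₀) * (P * Q) * (A₀ * C₁ - A₁ * C₀) =
          (A₀ * P * A₀) * (C₁ * Q * C₁) - (A₀ * P * A₁) * (C₁ * Q * C₀)
            - (A₁ * P * A₀) * (C₀ * Q * C₁) + (A₁ * P * A₁) * (C₀ * Q * C₀) := by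
        simp only [star_sub, star_mul, hA₀s.star_eq, hA₁s.star_eq, hC₀s.star_eq, hC₁s.star_eq,
          c1 _ hA₀ _ hC₁, c1 _ hA₁ _ hC₀, sub_mul, mul_sub, mul_assoc, c2 _ hA₀ _ hQ, c2 _ hA₁ _ hQ,
          c2 _ hA₀ _ hC₁, c2 _ hA₁ _ hC₀, c2 _ hA₀ _ hC₀, c2 _ hA₁ _ hC₁, c2 _ hP _ hC₀,
          c2 _ hP _ hC₁]
        abel
      have mA : ∀ {T U : H →L[ℂ] H}, T ∈ 𝓢 → U ∈ 𝓢 → T * P * U ∈ 𝓢 := fun h1 h2 =>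
        mul_mem (mul_mem h1 hP) h2
      have mC : ∀ {T U : H →L[ℂ] H}, T ∈ 𝓣 → U ∈ 𝓣 → T * Q * U ∈ 𝓣 := fun h1 h2 =>
        mul_mem (mul_mem h1 hQ) h2
      rw [stateForm_apply, ex, map_add, map_sub, map_sub, Complex.add_re, Complex.sub_re,
        Complex.sub_re, hI.mul _ (mA hA₀ hA₁) _ (mC hC₁ hC₀), hI.mul _ (mA hA₁ hA₀) _ (mC hC₀ hC₁),
        hI.re_mul (mA hA₀ hA₀) (mC hC₁ hC₁), hI.re_mul (mA hA₁ hA₁) (mC hC₀ hC₀), hz', hw', ← hz,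
        ← hw, Complex.mul_re, Complex.mul_re, Complex.conj_re, Complex.conj_re, Complex.conj_im,
        Complex.conj_im]
      · have m1 := mul_le_mul a0' b1' b1 hp0
        have m2 := mul_le_mul a1' b0' b0 hp0
        linarith
      · simpa [hA₁s.star_eq] using hP0.isSelfAdjoint.conjugate' A₁
      · simpa [hA₀s.star_eq] using hP0.isSelfAdjoint.conjugate' A₀
    rw [l1] at cs
    exact cs.trans (mul_le_mul l2 l3 (stateForm_nonneg hPQ _) (by positivity))
  -- `A₀ C₁ - A₁ C₀` is the hermitian part of `(A₀ - t i A₁) (C₁ - t i C₀)` for both signs `t`, and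
  -- this product of independent operators satisfies the Cauchy-Schwarz inequality. The mixed terms
  -- in `z.im` and `w.im` that are linear in `t` cancel between the two signs.
  · have key : ∀ t : ℝ, t * t = 1 →
        e ^ 2 ≤ (p * q) * ((2 * p - 2 * t * z.im) * (2 * q + 2 * t * w.im)) := by
      intro t ht
      have htC : (t : ℂ) * t = 1 := by exact_mod_cast ht
      obtain ⟨v, hv⟩ : ∃ v : ℂ, v = t * Complex.I := ⟨_, rfl⟩
      have hvs : (starRingEnd ℂ) v = -v := by simp [hv]
      have hvv : v * v = -1 := by
        rw [hv]; linear_combination (Complex.I * Complex.I) * htC + Complex.I_mul_I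
      have mL : A₀ + v • A₁ ∈ 𝓢 := add_mem hA₀ (SMulMemClass.smul_mem _ hA₁)
      have mR : C₁ + (-v) • C₀ ∈ 𝓣 := add_mem hC₁ (SMulMemClass.smul_mem _ hC₀)
      have hLs : star (A₀ + v • A₁) = A₀ + (-v) • A₁ := by
        simp [star_smul, hA₀s.star_eq, hA₁s.star_eq, hvs]
      have hRs : star (C₁ + (-v) • C₀) = C₁ + v • C₀ := by
        simp [star_smul, hC₀s.star_eq, hC₁s.star_eq, hvs]
      have cs := sq_correlator_le hI hS hP hP0 mL (one_mem _) hQ hQ0 (one_mem _) mR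
      simp only [hLs, hRs, star_one, one_mul, mul_one] at cs
      rw [← hp, ← hq] at cs
      have real : ∀ {T U : H →L[ℂ] H}, T ∈ 𝓢 → U ∈ 𝓣 → IsSelfAdjoint T → IsSelfAdjoint U →
          Commute T P → Commute U Q → (stateFun Ψ hΨ (S * ((T * P) * (U * Q)))).im = 0 := by
        intro T U mT mU sT sU hTP hUQ
        refine stateFun_im_eq_zero ?_
        have h1 : IsSelfAdjoint (T * P) := (sT.commute_iff hP0.isSelfAdjoint).1 hTP
        have h2 : IsSelfAdjoint (U * Q) := (sU.commute_iff hQ0.isSelfAdjoint).1 hUQ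
        have m1 := mul_mem mT hP
        have m2 := mul_mem mU hQ
        have h3 : IsSelfAdjoint ((T * P) * (U * Q)) :=
          (h1.commute_iff h2).1 (hI.comm _ m1 _ m2)
        refine (hS.sa.commute_iff h3).1 ?_
        exact (Commute.mul_left (hS.left _ m1) (hS.right _ m2)).symm
      have l1 : (stateFun Ψ hΨ (S * ((A₀ + (-v) • A₁) * P * (Q * (C₁ + (-v) • C₀))))).re = e := by
        have ex : S * ((A₀ + (-v) • A₁) * P * (Q * (C₁ + (-v) • C₀))) =
            (S * ((A₀ * P) * (C₁ * Q)) - S * ((A₁ * P) * (C₀ * Q)))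
              + (-v) • (S * ((A₀ * P) * (C₀ * Q)) + S * ((A₁ * P) * (C₁ * Q))) := by
          rw [hC₀Q.eq, hC₁Q.eq]
          simp only [add_mul, mul_add, smul_mul_assoc, mul_smul_comm]
          linear_combination (norm := module) hvv • (S * ((A₁ * P) * (Q * C₀)))
        rw [ex, map_add, map_sub, map_smul, map_add, smul_eq_mul, Complex.add_re, Complex.sub_re,
          ← he, Complex.mul_re, Complex.add_im,
          real hA₀ hC₀ hA₀s hC₀s hA₀P hC₀Q, real hA₁ hC₁ hA₁s hC₁s hA₁P hC₁Q]
        simp [hv]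
      have l2 : (stateFun Ψ hΨ ((A₀ + (-v) • A₁) * P * (A₀ + v • A₁))).re ≤
          2 * p - 2 * t * z.im := by
        have ex : (A₀ + (-v) • A₁) * P * (A₀ + v • A₁) =
            A₀ * P * A₀ + A₁ * P * A₁ + v • (A₀ * P * A₁ - A₁ * P * A₀) := by
          simp only [add_mul, mul_add, smul_mul_assoc, mul_smul_comm]
          linear_combination (norm := module) hvv • (-(A₁ * P * A₁))
        rw [ex, map_add, map_add, map_smul, map_sub, hz', ← hz]
        simp only [hv, smul_eq_mul, Complex.add_re, Complex.mul_re, Complex.sub_re, Complex.conj_re,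
          Complex.sub_im, Complex.conj_im, Complex.mul_im, Complex.I_re, Complex.I_im,
          Complex.ofReal_re, Complex.ofReal_im]
        linarith
      have l3 : (stateFun Ψ hΨ ((C₁ + v • C₀) * Q * (C₁ + (-v) • C₀))).re ≤
          2 * q + 2 * t * w.im := by
        have ex : (C₁ + v • C₀) * Q * (C₁ + (-v) • C₀) =
            C₁ * Q * C₁ + C₀ * Q * C₀ - v • (C₁ * Q * C₀ - C₀ * Q * C₁) := by
          simp only [add_mul, mul_add, smul_mul_assoc, mul_smul_comm]
          linear_combination (norm := module) hvv • (-(C₀ * Q * C₀))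
        rw [ex, map_sub, map_add, map_smul, map_sub, hw', ← hw]
        simp only [hv, smul_eq_mul, Complex.add_re, Complex.mul_re, Complex.sub_re, Complex.conj_re,
          Complex.sub_im, Complex.conj_im, Complex.mul_im, Complex.I_re, Complex.I_im,
          Complex.ofReal_re, Complex.ofReal_im]
        linarith
      have n2 : 0 ≤ (stateFun Ψ hΨ ((A₀ + (-v) • A₁) * P * (A₀ + v • A₁))).re := by
        rw [← hLs]
        exact stateFun_re_nonneg Ψ hΨ (star_left_conjugate_nonneg hP0 _)
      have n3 : 0 ≤ (stateFun Ψ hΨ ((C₁ + v • C₀) * Q * (C₁ + (-v) • C₀))).re := by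
        rw [← hRs]
        exact stateFun_re_nonneg Ψ hΨ (star_left_conjugate_nonneg hQ0 _)
      rw [l1] at cs
      have m := mul_le_mul_of_nonneg_left (mul_le_mul l2 l3 n3 (n2.trans l2))
        (mul_nonneg hp0 hq0)
      linarith
    have k1 := key 1 (by norm_num)
    have k2 := key (-1) (by norm_num)
    linarith

end DoubleBlock

/-! ### The swap model and its ideal projections -/

section Model

variable {H : Type*} [NormedAddCommGroup H] [InnerProductSpace ℂ H] [CompleteSpace H]
  {κ : Type*} {Ψ : κ → H} {hΨ : Summable fun k => ‖Ψ k‖ ^ 2}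

/-- A vector of length zero for the form of `P` is annihilated by `P`. -/
lemma mul_apply_eq_zero_of_stateForm_eq_zero {P X : H →L[ℂ] H} (hP : 0 ≤ P)
    (h : stateForm Ψ hΨ P X X = 0) (k : κ) : P (X (Ψ k)) = 0 := by
  set Y := CFC.sqrt P with hY
  have hYsa : star Y = Y := (CFC.sqrt_nonneg P).isSelfAdjoint
  have hYY : Y * Y = P := CFC.sqrt_mul_sqrt_self P
  have h0 := apply_eq_zero_of_stateFun_re_eq_zero Ψ hΨ (star_left_conjugate_nonneg hP X) h k
  have h1 : ⟪Y (X (Ψ k)), Y (X (Ψ k))⟫_ℂ = 0 := by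
    rw [← adjoint_inner_right, ← star_eq_adjoint, hYsa, ← mul_apply_eq_comp, hYY,
      ← adjoint_inner_right, ← star_eq_adjoint, ← mul_apply_eq_comp, ← mul_apply_eq_comp,
      h0, inner_zero_right]
  rw [← hYY, mul_apply_eq_comp, inner_self_eq_zero.1 h1, map_zero]

/-- The von Neumann algebra generated by a pair of operators, as the double centralizer of the two
operators and their adjoints. -/
noncomputable def bicommutant (A : Fin 2 → H →L[ℂ] H) : StarSubalgebra ℂ (H →L[ℂ] H) :=
  StarSubalgebra.centralizer ℂ (StarSubalgebra.centralizer ℂ (Set.range A) : Set (H →L[ℂ] H))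

lemma mem_centralizer_range {A : Fin 2 → H →L[ℂ] H} (hA : ∀ x, IsSelfAdjoint (A x))
    {Y : H →L[ℂ] H} (hY : ∀ x, Commute Y (A x)) : Y ∈ StarSubalgebra.centralizer ℂ (Set.range A) := by
  rw [StarSubalgebra.mem_centralizer_iff]
  rintro _ ⟨x, rfl⟩
  rw [(hA x).star_eq]
  exact ⟨(hY x).eq.symm, (hY x).eq.symm⟩

lemma mem_bicommutant {A : Fin 2 → H →L[ℂ] H} {T : H →L[ℂ] H}
    (hT : ∀ Y, (∀ x, Commute Y (A x)) → Commute T Y) : T ∈ bicommutant A := by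
  have hc : ∀ Y ∈ StarSubalgebra.centralizer ℂ (Set.range A), ∀ x, Commute Y (A x) :=
    fun Y hY x => ((StarSubalgebra.mem_centralizer_iff ℂ).1 hY (A x) ⟨x, rfl⟩).1.symm
  rw [bicommutant, StarSubalgebra.mem_centralizer_iff]
  exact fun Y hY => ⟨(hT Y (hc Y hY)).eq.symm, (hT _ (hc _ (star_mem hY))).eq.symm⟩

lemma commute_of_mem_bicommutant {A : Fin 2 → H →L[ℂ] H} (hA : ∀ x, IsSelfAdjoint (A x))
    {T : H →L[ℂ] H} (hT : T ∈ bicommutant A) {Y : H →L[ℂ] H} (hY : ∀ x, Commute Y (A x)) :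
    Commute T Y :=
  ((StarSubalgebra.mem_centralizer_iff ℂ).1 hT Y (mem_centralizer_range hA hY)).1.symm

lemma self_mem_bicommutant (A : Fin 2 → H →L[ℂ] H) (x : Fin 2) : A x ∈ bicommutant A :=
  mem_bicommutant fun _ hY => (hY x).symm

/-- The operator form of a bilocality experiment: binary observables `A`, `C` of the two outer
parties, the four-outcome measurement `B` of the central party, all commuting, and a state in which
the algebras of the outer parties are independent. -/
structure SwapModel (Ψ : κ → H) (hΨ : Summable fun k => ‖Ψ k‖ ^ 2) (A C : Fin 2 → H →L[ℂ] H)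
    (B : BobOut → H →L[ℂ] H) : Prop where
  norm : HasSum (fun k => ‖Ψ k‖ ^ 2) 1
  A_sa : ∀ x, IsSelfAdjoint (A x)
  C_sa : ∀ x, IsSelfAdjoint (C x)
  A_le : ∀ x, A x * A x ≤ 1
  C_le : ∀ x, C x * C x ≤ 1
  B_nonneg : ∀ b, 0 ≤ B b
  B_sum : ∑ b, B b = 1
  AC : ∀ x z, Commute (A x) (C z)
  AB : ∀ x b, Commute (A x) (B b)
  CB : ∀ x b, Commute (C x) (B b)
  indep : ∀ X ∈ bicommutant A, ∀ Y ∈ bicommutant C,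
    stateFun Ψ hΨ (X * Y) = stateFun Ψ hΨ X * stateFun Ψ hΨ Y

/-- The tilted relations for the unnormalised correlators `tr (ρ B^b A_x C_z)`, with `s = sin δ` and
`c = cos δ`. -/
structure IsTilted (Ψ : κ → H) (hΨ : Summable fun k => ‖Ψ k‖ ^ 2) (A C : Fin 2 → H →L[ℂ] H)
    (B : BobOut → H →L[ℂ] H) (s c : ℝ) : Prop where
  pos : ∀ b, 0 < (stateFun Ψ hΨ (B b)).re
  c01 : ∀ b, (stateFun Ψ hΨ (B b * (A 0 * C 1))).re =
    (-1) ^ (b.1 : ℕ) * c * (stateFun Ψ hΨ (B b)).re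
  c10 : ∀ b, (stateFun Ψ hΨ (B b * (A 1 * C 0))).re =
    (-1) ^ (b.2 : ℕ) * c * (stateFun Ψ hΨ (B b)).re
  c00 : ∀ b, (stateFun Ψ hΨ (B b * (A 0 * C 0))).re = 0
  c11 : ∀ b, (stateFun Ψ hΨ (B b * (A 1 * C 1))).re =
    if b.1 = b.2 then (-1) ^ (b.1 : ℕ) * (2 * s * c) * (stateFun Ψ hΨ (B b)).re else 0

variable {A C : Fin 2 → H →L[ℂ] H} {B : BobOut → H →L[ℂ] H} {s c : ℝ}

namespace SwapModel

lemma independent (M : SwapModel Ψ hΨ A C B) :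
    Independent Ψ hΨ (bicommutant A) (bicommutant C) where
  comm X hX Y hY := by
    refine (commute_of_mem_bicommutant M.A_sa hX fun x => ?_).eq
    exact commute_of_mem_bicommutant M.C_sa hY fun z => M.AC x z
  mul := M.indep

lemma inner_eq (M : SwapModel Ψ hΨ A C B) (b : BobOut) (x z : Fin 2) :
    stateForm Ψ hΨ (B b) (A x) (C z) = (stateFun Ψ hΨ (B b * (A x * C z))).re := by
  rw [stateForm_apply, (M.A_sa x).star_eq, (M.AB x b).eq, mul_assoc]

lemma norm_A_le (M : SwapModel Ψ hΨ A C B) (b : BobOut) (x : Fin 2) :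
    stateForm Ψ hΨ (B b) (A x) (A x) ≤ (stateFun Ψ hΨ (B b)).re := by
  rw [stateForm_apply, (M.A_sa x).star_eq]
  exact stateFun_re_mono Ψ hΨ
    (conj_contraction_le (M.A_le x) (M.B_nonneg b) (M.AB x b).eq.symm)

lemma norm_C_le (M : SwapModel Ψ hΨ A C B) (b : BobOut) (x : Fin 2) :
    stateForm Ψ hΨ (B b) (C x) (C x) ≤ (stateFun Ψ hΨ (B b)).re := by
  rw [stateForm_apply, (M.C_sa x).star_eq]
  exact stateFun_re_mono Ψ hΨ
    (conj_contraction_le (M.C_le x) (M.B_nonneg b) (M.CB x b).eq.symm)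

/-- A contraction that preserves the length of the postselected vectors squares to one on them. -/
lemma apply_apply_of_norm_eq {T : H →L[ℂ] H} {b : BobOut} (M : SwapModel Ψ hΨ A C B)
    (hT : IsSelfAdjoint T) (hT1 : T * T ≤ 1) (hTB : Commute T (B b))
    (h : stateForm Ψ hΨ (B b) T T = (stateFun Ψ hΨ (B b)).re) (k : κ) :
    T (T (B b (Ψ k))) = B b (Ψ k) := by
  have h1 : 0 ≤ B b - T * B b * T :=
    sub_nonneg.2 (conj_contraction_le hT1 (M.B_nonneg b) hTB.eq.symm)
  have h2 := apply_eq_zero_of_stateFun_re_eq_zero Ψ hΨ h1 (by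
    rw [stateForm_apply, hT.star_eq] at h
    rw [map_sub, Complex.sub_re, h, sub_self]) k
  rw [mul_assoc, ← hTB.eq, sub_apply, sub_eq_zero] at h2
  exact h2.symm

/-- The two outcomes with `b₀ = b₁` show extremal correlations, so that the postselected vectors
satisfy the ideal relations. -/
lemma diagonal_relations (M : SwapModel Ψ hΨ A C B) (hT : IsTilted Ψ hΨ A C B s c)
    (hsc : s ^ 2 + c ^ 2 = 1) (hs : |s| < c) {b : BobOut} (hb : b.1 = b.2) {σ : ℝ}
    (hσ : σ = (-1) ^ (b.1 : ℕ)) (k : κ) :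
    (∀ x, A x (A x (B b (Ψ k))) = B b (Ψ k)) ∧ (∀ x, C x (C x (B b (Ψ k))) = B b (Ψ k)) ∧
      A 1 (B b (Ψ k)) = ((σ * c : ℝ) : ℂ) • C 0 (B b (Ψ k)) + (s : ℂ) • A 0 (B b (Ψ k)) ∧
      C 1 (B b (Ψ k)) = ((σ * c : ℝ) : ℂ) • A 0 (B b (Ψ k)) + (s : ℂ) • C 0 (B b (Ψ k)) := by
  have hσσ : σ * σ = 1 := by rw [hσ, ← mul_pow]; norm_num
  have hs0 := stateForm_symm (hΨ := hΨ) (Ψ := Ψ) (M.B_nonneg b)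
  -- The sign `σ` of the correlations is absorbed into Charlie's observables.
  have e01 : stateForm Ψ hΨ (B b) (A 0) (σ • C 1) = c * (stateFun Ψ hΨ (B b)).re := by
    rw [map_smul, M.inner_eq, hT.c01, ← hσ, smul_eq_mul]
    linear_combination (c * (stateFun Ψ hΨ (B b)).re) * hσσ
  have e10 : stateForm Ψ hΨ (B b) (A 1) (σ • C 0) = c * (stateFun Ψ hΨ (B b)).re := by
    rw [map_smul, M.inner_eq, hT.c10, ← hb, ← hσ, smul_eq_mul]
    linear_combination (c * (stateFun Ψ hΨ (B b)).re) * hσσ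
  have e00 : stateForm Ψ hΨ (B b) (A 0) (σ • C 0) = 0 := by
    rw [map_smul, M.inner_eq, hT.c00, smul_zero]
  have e11 : stateForm Ψ hΨ (B b) (A 1) (σ • C 1) = 2 * s * c * (stateFun Ψ hΨ (B b)).re := by
    rw [map_smul, M.inner_eq, hT.c11, if_pos hb, ← hσ, smul_eq_mul]
    linear_combination (2 * s * c * (stateFun Ψ hΨ (B b)).re) * hσσ
  have nC : ∀ x, stateForm Ψ hΨ (B b) (σ • C x) (σ • C x) = stateForm Ψ hΨ (B b) (C x) (C x) := by
    intro x
    rw [map_smul, map_smul, LinearMap.smul_apply, smul_smul, hσσ, one_smul]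
  obtain ⟨⟨n1, n2, n3, n4⟩, d1, d2⟩ := extremal_vectors (stateForm Ψ hΨ (B b)) hs0
    (stateForm_nonneg (M.B_nonneg b)) hsc hs (M.norm_A_le b 0) (M.norm_A_le b 1)
    ((nC 0).trans_le (M.norm_C_le b 0)) ((nC 1).trans_le (M.norm_C_le b 1)) e01 e10 e00 e11
  rw [nC] at n3 n4
  have z1 := mul_apply_eq_zero_of_stateForm_eq_zero (M.B_nonneg b) d1 k
  have z2 := mul_apply_eq_zero_of_stateForm_eq_zero (M.B_nonneg b) d2 k
  have cA : ∀ x v, B b (A x v) = A x (B b v) := fun x v => (DFunLike.congr_fun (M.AB x b).eq v).symm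
  have cC : ∀ x v, B b (C x v) = C x (B b v) := fun x v => (DFunLike.congr_fun (M.CB x b).eq v).symm
  have hreal : ∀ (r : ℝ) (v : H), r • v = (r : ℂ) • v := fun r v => (Complex.coe_smul r v).symm
  simp only [sub_apply, smul_apply, map_sub, hreal, map_smul, cA, cC] at z1 z2
  refine ⟨?_, ?_, ?_, ?_⟩
  · intro x
    refine M.apply_apply_of_norm_eq (M.A_sa x) (M.A_le x) (M.AB x b) ?_ k
    fin_cases x
    exacts [n1, n2]
  · intro x
    refine M.apply_apply_of_norm_eq (M.C_sa x) (M.C_le x) (M.CB x b) ?_ k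
    fin_cases x
    exacts [n3, n4]
  · rw [← sub_eq_zero, ← z1]
    push_cast
    module
  · have hσC : (σ : ℂ) * σ = 1 := by exact_mod_cast hσσ
    rw [← sub_eq_zero]
    have : (σ : ℂ) • ((σ : ℂ) • C 1 (B b (Ψ k)) - (c : ℂ) • A 0 (B b (Ψ k))
        - (s : ℂ) • (σ : ℂ) • C 0 (B b (Ψ k))) = 0 := by rw [z2, smul_zero]
    rw [← this]
    push_cast
    linear_combination (norm := module) hσC • ((s : ℂ) • C 0 (B b (Ψ k)) - C 1 (B b (Ψ k)))

end SwapModel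

/-- On a vector on which `A₁ - s A₀` acts like a multiple of a commuting observable `C₀`, and on which
the observables square to one, the anticommutator of `A₀` and `A₁` is fixed. -/
lemma anticommutator_apply {A₀ A₁ C₀ : H →L[ℂ] H} {χ : H} {t : ℝ} (hs : s ≠ 0)
    (ht : t ^ 2 + s ^ 2 = 1) (h0 : A₀ (A₀ χ) = χ) (h1 : A₁ (A₁ χ) = χ) (hC : C₀ (C₀ χ) = χ)
    (c0 : Commute A₀ C₀) (c1 : Commute A₁ C₀) (h : A₁ χ = (t : ℂ) • C₀ χ + (s : ℂ) • A₀ χ) :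
    A₀ (A₁ χ) + A₁ (A₀ χ) = (2 * s : ℂ) • χ := by
  have k0 : A₀ (C₀ χ) = C₀ (A₀ χ) := DFunLike.congr_fun c0.eq χ
  have k1 : A₁ (C₀ χ) = C₀ (A₁ χ) := DFunLike.congr_fun c1.eq χ
  have e1 : A₁ (A₁ χ) = (t : ℂ) • C₀ (A₁ χ) + (s : ℂ) • A₁ (A₀ χ) := by
    conv_lhs => rw [h, map_add, map_smul, map_smul, k1]
  have e2 : C₀ (A₁ χ) = (t : ℂ) • χ + (s : ℂ) • C₀ (A₀ χ) := by
    rw [h, map_add, map_smul, map_smul, hC]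
  have e3 : A₀ (A₁ χ) = (t : ℂ) • C₀ (A₀ χ) + (s : ℂ) • χ := by
    rw [h, map_add, map_smul, map_smul, k0, h0]
  rw [h1, e2] at e1
  have htC : (t : ℂ) ^ 2 + (s : ℂ) ^ 2 = 1 := by exact_mod_cast ht
  have hsC : (s : ℂ) ≠ 0 := by exact_mod_cast hs
  have key : (s : ℂ) • (A₀ (A₁ χ) + A₁ (A₀ χ) - (2 * s : ℂ) • χ) = 0 := by
    rw [e3]
    linear_combination (norm := module) -e1 - htC • χ
  rw [← sub_eq_zero]
  exact (smul_eq_zero.1 key).resolve_left hsC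

end Model

/-! ### Ideal projections of the outer parties -/

section Ideal

variable {H : Type*} [NormedAddCommGroup H] [InnerProductSpace ℂ H] [CompleteSpace H]
  {κ : Type*} {Ψ : κ → H} {hΨ : Summable fun k => ‖Ψ k‖ ^ 2}

/-- A projection on whose range two observables square to one and have anticommutator `2 s`. -/
structure IsIdeal (D₀ D₁ P : H →L[ℂ] H) (s : ℝ) : Prop where
  proj : IsStarProjection P
  comm₀ : Commute P D₀
  comm₁ : Commute P D₁
  sq₀ : D₀ * D₀ * P = P
  sq₁ : D₁ * D₁ * P = P
  anti : (D₀ * D₁ + D₁ * D₀) * P = (2 * s : ℂ) • P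

lemma IsIdeal.swap {D₀ D₁ P : H →L[ℂ] H} {s : ℝ} (h : IsIdeal D₀ D₁ P s) : IsIdeal D₁ D₀ P s :=
  ⟨h.proj, h.comm₁, h.comm₀, h.sq₁, h.sq₀, by rw [add_comm, h.anti]⟩

lemma IsIdeal.half_sub_sq {D₀ D₁ P : H →L[ℂ] H} {s : ℝ} (h : IsIdeal D₀ D₁ P s) :
    ((1 / 2 : ℂ) • (D₀ - D₁)) * ((1 / 2 : ℂ) • (D₀ - D₁)) * P = (((1 - s) / 2 : ℝ) : ℂ) • P := by
  have e := h.anti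
  have e0 := h.sq₀
  have e1 := h.sq₁
  simp only [add_mul] at e
  simp only [smul_mul_assoc, mul_smul_comm, sub_mul, mul_sub]
  push_cast
  linear_combination (norm := module) (1 / 4 : ℂ) • e0 + (1 / 4 : ℂ) • e1 - (1 / 4 : ℂ) • e

lemma IsIdeal.half_add_sq {D₀ D₁ P : H →L[ℂ] H} {s : ℝ} (h : IsIdeal D₀ D₁ P s) :
    ((1 / 2 : ℂ) • (D₀ + D₁)) * ((1 / 2 : ℂ) • (D₀ + D₁)) * P = (((1 + s) / 2 : ℝ) : ℂ) • P := by
  have e := h.anti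
  have e0 := h.sq₀
  have e1 := h.sq₁
  simp only [add_mul] at e
  simp only [smul_mul_assoc, mul_smul_comm, add_mul, mul_add]
  push_cast
  linear_combination (norm := module) (1 / 4 : ℂ) • e0 + (1 / 4 : ℂ) • e1 + (1 / 4 : ℂ) • e

lemma IsIdeal.half_anticommute {D₀ D₁ P : H →L[ℂ] H} {s : ℝ} (h : IsIdeal D₀ D₁ P s) :
    (((1 / 2 : ℂ) • (D₀ - D₁)) * ((1 / 2 : ℂ) • (D₀ + D₁))
      + ((1 / 2 : ℂ) • (D₀ + D₁)) * ((1 / 2 : ℂ) • (D₀ - D₁))) * P = 0 := by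
  have e0 := h.sq₀
  have e1 := h.sq₁
  simp only [smul_mul_assoc, mul_smul_comm, add_mul, mul_add, sub_mul, mul_sub]
  linear_combination (norm := module) (1 / 2 : ℂ) • e0 - (1 / 2 : ℂ) • e1

lemma isSelfAdjoint_half_smul {T : H →L[ℂ] H} (hT : IsSelfAdjoint T) :
    IsSelfAdjoint ((1 / 2 : ℂ) • T) := by
  rw [IsSelfAdjoint, star_smul, hT.star_eq]
  simp

/-- Weights of the half difference and the half sum of two contractions below a positive operator `P`
commuting with them. -/
lemma half_weights {D₀ D₁ P : H →L[ℂ] H} (h0 : IsSelfAdjoint D₀) (h1 : IsSelfAdjoint D₁)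
    (h0' : D₀ * D₀ ≤ 1) (h1' : D₁ * D₁ ≤ 1) (hP : 0 ≤ P) (c0 : Commute D₀ P) (c1 : Commute D₁ P) :
    (stateFun Ψ hΨ (((1 / 2 : ℂ) • (D₀ - D₁)) * ((1 / 2 : ℂ) • (D₀ - D₁)) * P)).re ≤
        ((stateFun Ψ hΨ P).re - (stateFun Ψ hΨ (D₀ * P * D₁)).re) / 2 ∧
      (stateFun Ψ hΨ (((1 / 2 : ℂ) • (D₀ + D₁)) * ((1 / 2 : ℂ) • (D₀ + D₁)) * P)).re ≤
        ((stateFun Ψ hΨ P).re + (stateFun Ψ hΨ (D₀ * P * D₁)).re) / 2 ∧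
      (stateFun Ψ hΨ (((1 / 2 : ℂ) • (D₀ - D₁)) * ((1 / 2 : ℂ) • (D₀ - D₁)) * P)).re
        + (stateFun Ψ hΨ (((1 / 2 : ℂ) • (D₀ + D₁)) * ((1 / 2 : ℂ) • (D₀ + D₁)) * P)).re ≤
        (stateFun Ψ hΨ P).re ∧
      0 ≤ (stateFun Ψ hΨ (((1 / 2 : ℂ) • (D₀ - D₁)) * ((1 / 2 : ℂ) • (D₀ - D₁)) * P)).re ∧
      0 ≤ (stateFun Ψ hΨ (((1 / 2 : ℂ) • (D₀ + D₁)) * ((1 / 2 : ℂ) • (D₀ + D₁)) * P)).re := by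
  have key : ∀ D : H →L[ℂ] H, IsSelfAdjoint D → D * D ≤ 1 → Commute D P →
      (stateFun Ψ hΨ (D * D * P)).re ≤ (stateFun Ψ hΨ P).re := by
    intro D hD hD' hc
    refine stateFun_re_mono Ψ hΨ ?_
    have := conj_contraction_le hD' hP hc.eq.symm
    rwa [mul_assoc, ← hc.eq, ← mul_assoc] at this
  have k0 := key D₀ h0 h0' c0
  have k1 := key D₁ h1 h1' c1
  have hpos : ∀ D : H →L[ℂ] H, IsSelfAdjoint D → Commute D P →
      0 ≤ (stateFun Ψ hΨ (D * D * P)).re := by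
    intro D hD hc
    refine stateFun_re_nonneg Ψ hΨ ?_
    have := star_left_conjugate_nonneg hP D
    rwa [hD.star_eq, mul_assoc, ← hc.eq, ← mul_assoc] at this
  have e10 : (stateFun Ψ hΨ (D₁ * (D₀ * P))).re = (stateFun Ψ hΨ (D₀ * P * D₁)).re := by
    have : D₁ * (D₀ * P) = star (D₀ * P * D₁) := by
      rw [star_mul, star_mul, h0.star_eq, h1.star_eq, hP.isSelfAdjoint.star_eq, c0.eq]
    rw [this, stateFun_star, Complex.conj_re]
  have r2 : ∀ w : ℂ, ((2⁻¹ : ℂ) * w).re = 2⁻¹ * w.re := fun w => by simp [Complex.mul_re]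
  have em : (stateFun Ψ hΨ (((1 / 2 : ℂ) • (D₀ - D₁)) * ((1 / 2 : ℂ) • (D₀ - D₁)) * P)).re =
      ((stateFun Ψ hΨ (D₀ * D₀ * P)).re + (stateFun Ψ hΨ (D₁ * D₁ * P)).re
        - 2 * (stateFun Ψ hΨ (D₀ * P * D₁)).re) / 4 := by
    simp only [smul_mul_assoc, mul_smul_comm, sub_mul, mul_sub, map_smul, map_sub, smul_eq_mul,
      one_div, r2, Complex.sub_re, mul_assoc, e10, ← c1.eq]
    ring
  have ep : (stateFun Ψ hΨ (((1 / 2 : ℂ) • (D₀ + D₁)) * ((1 / 2 : ℂ) • (D₀ + D₁)) * P)).re =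
      ((stateFun Ψ hΨ (D₀ * D₀ * P)).re + (stateFun Ψ hΨ (D₁ * D₁ * P)).re
        + 2 * (stateFun Ψ hΨ (D₀ * P * D₁)).re) / 4 := by
    simp only [smul_mul_assoc, mul_smul_comm, add_mul, mul_add, map_smul, map_add, smul_eq_mul,
      one_div, r2, Complex.add_re, mul_assoc, e10, ← c1.eq]
    ring
  refine ⟨by rw [em]; linarith, by rw [ep]; linarith, by rw [em, ep]; linarith,
    hpos _ (isSelfAdjoint_half_smul (h0.sub h1)) ?_, hpos _ (isSelfAdjoint_half_smul (h0.add h1)) ?_⟩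
  · exact (c0.sub_left c1).smul_left _
  · exact (c0.add_left c1).smul_left _

variable {A C : Fin 2 → H →L[ℂ] H} {B : BobOut → H →L[ℂ] H} {s c : ℝ}

namespace SwapModel

/-- The ideal projection of Alice. On the postselected vectors her observables act like combinations
of Charlie's, which commute with hers. -/
lemma exists_ideal_left (M : SwapModel Ψ hΨ A C B) (hT : IsTilted Ψ hΨ A C B s c)
    (hsc : s ^ 2 + c ^ 2 = 1) (hs : |s| < c) (hs0 : s ≠ 0) :
    ∃ P ∈ bicommutant A, IsIdeal (A 0) (A 1) P s ∧
      ∀ b : BobOut, b.1 = b.2 → ∀ k, P (B b (Ψ k)) = B b (Ψ k) := by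
  have hc : (c : ℂ) ≠ 0 := by exact_mod_cast ((abs_nonneg s).trans_lt hs).ne'
  have hσ : ∀ b : BobOut, ((-1 : ℝ) ^ (b.1 : ℕ)) ^ 2 = 1 := fun b => by
    rw [← pow_mul, mul_comm, pow_mul]; norm_num
  refine (exists_idealProjection (M.A_sa 0) (M.A_sa 1) (2 * s : ℂ)
    {χ | ∃ b : BobOut, b.1 = b.2 ∧ ∃ k, χ = B b (Ψ k)} ?_ ?_ ?_ ?_ ?_).elim ?_
  · rintro _ ⟨b, hb, k, rfl⟩
    exact (M.diagonal_relations hT hsc hs hb rfl k).1 0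
  · rintro _ ⟨b, hb, k, rfl⟩
    exact (M.diagonal_relations hT hsc hs hb rfl k).1 1
  · rintro _ ⟨b, hb, k, rfl⟩
    obtain ⟨r1, r2, r3, r4⟩ := M.diagonal_relations hT hsc hs hb rfl k
    refine anticommutator_apply hs0 ?_ (r1 0) (r1 1) (r2 0) (M.AC 0 0) (M.AC 1 0) r3
    rw [mul_pow, hσ]; linarith
  · rintro _ ⟨b, hb, k, rfl⟩
    obtain ⟨r1, r2, r3, r4⟩ := M.diagonal_relations hT hsc hs hb rfl k
    have hσC : (((-1 : ℝ) ^ (b.1 : ℕ) : ℝ) : ℂ) * (((-1 : ℝ) ^ (b.1 : ℕ) : ℝ) : ℂ) = 1 := by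
      have := hσ b
      rw [sq] at this
      exact_mod_cast this
    obtain ⟨σ, hσd⟩ : ∃ σ : ℝ, σ = (-1) ^ (b.1 : ℕ) := ⟨_, rfl⟩
    rw [← hσd] at r3 r4 hσC
    refine ⟨((σ : ℂ) / c) • (C 1 - (s : ℂ) • C 0), ?_, ?_, ?_⟩
    · exact (((M.AC 0 1).symm).sub_left ((M.AC 0 0).symm.smul_left _)).smul_left _
    · exact (((M.AC 1 1).symm).sub_left ((M.AC 1 0).symm.smul_left _)).smul_left _
    · simp only [smul_apply, sub_apply]
      rw [r4]
      have h1 : (σ : ℂ) / c * ((σ * c : ℝ) : ℂ) = 1 := by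
        push_cast
        field_simp
        linear_combination hσC
      linear_combination (norm := module) (-h1) • A 0 (B b (Ψ k))
  · rintro _ ⟨b, hb, k, rfl⟩
    obtain ⟨r1, r2, r3, r4⟩ := M.diagonal_relations hT hsc hs hb rfl k
    have hσC : (((-1 : ℝ) ^ (b.1 : ℕ) : ℝ) : ℂ) * (((-1 : ℝ) ^ (b.1 : ℕ) : ℝ) : ℂ) = 1 := by
      have := hσ b
      rw [sq] at this
      exact_mod_cast this
    obtain ⟨σ, hσd⟩ : ∃ σ : ℝ, σ = (-1) ^ (b.1 : ℕ) := ⟨_, rfl⟩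
    rw [← hσd] at r3 r4 hσC
    refine ⟨((σ * c : ℝ) : ℂ) • C 0 + (s : ℂ) • (((σ : ℂ) / c) • (C 1 - (s : ℂ) • C 0)), ?_, ?_, ?_⟩
    · exact ((M.AC 0 0).symm.smul_left _).add_left
        (((((M.AC 0 1).symm).sub_left ((M.AC 0 0).symm.smul_left _)).smul_left _).smul_left _)
    · exact ((M.AC 1 0).symm.smul_left _).add_left
        (((((M.AC 1 1).symm).sub_left ((M.AC 1 0).symm.smul_left _)).smul_left _).smul_left _)
    · simp only [smul_apply, sub_apply, add_apply]
      rw [r4, r3]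
      have h1 : (σ : ℂ) / c * ((σ * c : ℝ) : ℂ) = 1 := by
        push_cast
        field_simp
        linear_combination hσC
      linear_combination (norm := module) (-(s : ℂ) * h1) • A 0 (B b (Ψ k))
  · rintro P ⟨hP, p0, p1, pY, pχ, q0, q1, q01⟩
    exact ⟨P, mem_bicommutant fun Y hY => pY Y (hY 0) (hY 1), ⟨hP, p0, p1, q0, q1, q01⟩,
      fun b hb k => pχ _ ⟨b, hb, k, rfl⟩⟩

/-- Exchange of the two outer parties, together with the two bits of the central one. -/
lemma symm (M : SwapModel Ψ hΨ A C B) : SwapModel Ψ hΨ C A fun b => B b.swap where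
  norm := M.norm
  A_sa := M.C_sa
  C_sa := M.A_sa
  A_le := M.C_le
  C_le := M.A_le
  B_nonneg b := M.B_nonneg _
  B_sum := by rw [← M.B_sum]; exact (Equiv.prodComm _ _).sum_comp B
  AC x z := (M.AC z x).symm
  AB x b := M.CB _ _
  CB x b := M.AB _ _
  indep X hX Y hY := by
    rw [← M.independent.comm Y hY X hX, M.indep Y hY X hX, mul_comm]

end SwapModel

lemma IsTilted.symm (M : SwapModel Ψ hΨ A C B) (hT : IsTilted Ψ hΨ A C B s c) :
    IsTilted Ψ hΨ C A (fun b => B b.swap) s c where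
  pos b := hT.pos _
  c01 b := by rw [← (M.AC 1 0).eq, hT.c10]; rfl
  c10 b := by rw [← (M.AC 0 1).eq, hT.c01]; rfl
  c00 b := by rw [← (M.AC 0 0).eq, hT.c00]
  c11 b := by
    rw [← (M.AC 1 1).eq, hT.c11]
    by_cases h : b.1 = b.2
    · rw [if_pos h, if_pos (show b.swap.1 = b.swap.2 from h.symm), Prod.fst_swap, h]
    · rw [if_neg h, if_neg (show ¬ b.swap.1 = b.swap.2 from fun h' => h h'.symm)]

lemma SwapModel.exists_ideal_right (M : SwapModel Ψ hΨ A C B) (hT : IsTilted Ψ hΨ A C B s c)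
    (hsc : s ^ 2 + c ^ 2 = 1) (hs : |s| < c) (hs0 : s ≠ 0) :
    ∃ Q ∈ bicommutant C, IsIdeal (C 0) (C 1) Q s ∧
      ∀ b : BobOut, b.1 = b.2 → ∀ k, Q (B b (Ψ k)) = B b (Ψ k) := by
  obtain ⟨Q, hQ, h, hb⟩ := M.symm.exists_ideal_left (hT.symm M) hsc hs hs0
  exact ⟨Q, hQ, h, fun b hbb k => by simpa using hb b.swap hbb.symm k⟩

end Ideal

/-! ### Rigidity of the outer observables -/

section Rigidity

variable {H : Type*} [NormedAddCommGroup H] [InnerProductSpace ℂ H] [CompleteSpace H]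
  {κ : Type*} {Ψ : κ → H} {hΨ : Summable fun k => ‖Ψ k‖ ^ 2}
  {A C : Fin 2 → H →L[ℂ] H} {B : BobOut → H →L[ℂ] H} {s c : ℝ}

namespace SwapModel

lemma B_sum_eq (M : SwapModel Ψ hΨ A C B) : B (0, 0) + B (0, 1) + B (1, 0) + B (1, 1) = 1 := by
  rw [← M.B_sum, Fintype.sum_prod_type]
  simp only [Fin.sum_univ_two]
  abel

/-- `B (0, 1) - B (1, 0)` takes values between `-1` and `1`. -/
lemma thirdParty (M : SwapModel Ψ hΨ A C B) :
    ThirdParty (bicommutant A) (bicommutant C) (B (0, 1) - B (1, 0)) where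
  sa := (M.B_nonneg _).isSelfAdjoint.sub (M.B_nonneg _).isSelfAdjoint
  sq_le := by
    have h := M.B_sum_eq
    have h1 : 0 ≤ 1 - (B (0, 1) - B (1, 0)) := by
      have : 1 - (B (0, 1) - B (1, 0)) = B (0, 0) + B (1, 0) + B (1, 0) + B (1, 1) := by
        rw [← h]; abel
      rw [this]
      exact add_nonneg (add_nonneg (add_nonneg (M.B_nonneg _) (M.B_nonneg _)) (M.B_nonneg _))
        (M.B_nonneg _)
    have h2 : 0 ≤ 1 + (B (0, 1) - B (1, 0)) := by
      have : 1 + (B (0, 1) - B (1, 0)) = B (0, 0) + B (0, 1) + B (0, 1) + B (1, 1) := by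
        rw [← h]; abel
      rw [this]
      exact add_nonneg (add_nonneg (add_nonneg (M.B_nonneg _) (M.B_nonneg _)) (M.B_nonneg _))
        (M.B_nonneg _)
    have hc : Commute (1 - (B (0, 1) - B (1, 0))) (1 + (B (0, 1) - B (1, 0))) :=
      (Commute.one_left _).sub_left ((Commute.one_right _).add_right (Commute.refl _))
    have := Commute.mul_nonneg h1 h2 hc
    rw [← sub_nonneg]
    convert this using 1
    noncomm_ring
  left X hX := (commute_of_mem_bicommutant M.A_sa hX fun x =>
    ((M.AB x _).symm).sub_left (M.AB x _).symm).eq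
  right Y hY := (commute_of_mem_bicommutant M.C_sa hY fun x =>
    ((M.CB x _).symm).sub_left (M.CB x _).symm).eq

/-- The two correlators whose values the relations for the outcomes `01` and `10` determine. -/
lemma swap_correlators (hT : IsTilted Ψ hΨ A C B s c) :
    (stateFun Ψ hΨ ((B (0, 1) - B (1, 0)) *
      (((1 / 2 : ℂ) • (A 0 - A 1)) * ((1 / 2 : ℂ) • (C 1 + C 0))))).re =
        c / 2 * ((stateFun Ψ hΨ (B (0, 1))).re + (stateFun Ψ hΨ (B (1, 0))).re) ∧
    (stateFun Ψ hΨ ((B (0, 1) - B (1, 0)) *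
      (((1 / 2 : ℂ) • (A 0 + A 1)) * ((1 / 2 : ℂ) • (C 1 - C 0))))).re =
        c / 2 * ((stateFun Ψ hΨ (B (0, 1))).re + (stateFun Ψ hΨ (B (1, 0))).re) := by
  have r2 : ∀ w : ℂ, ((2⁻¹ : ℂ) * w).re = 2⁻¹ * w.re := fun w => by simp [Complex.mul_re]
  have h1 := hT.c01 (0, 1)
  have h2 := hT.c10 (0, 1)
  have h3 := hT.c00 (0, 1)
  have h4 := hT.c11 (0, 1)
  have k1 := hT.c01 (1, 0)
  have k2 := hT.c10 (1, 0)
  have k3 := hT.c00 (1, 0)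
  have k4 := hT.c11 (1, 0)
  simp at h1 h2 h4 k1 k2 k4
  constructor
  · simp only [smul_mul_assoc, mul_smul_comm, mul_add, sub_mul, mul_sub, map_smul, map_add,
      map_sub, smul_eq_mul, one_div, r2, Complex.add_re, Complex.sub_re]
    linarith
  · simp only [smul_mul_assoc, mul_smul_comm, add_mul, mul_add, sub_mul, mul_sub, map_smul, map_add,
      map_sub, smul_eq_mul, one_div, r2, Complex.add_re, Complex.sub_re]
    linarith

/-- On the ideal parts of both outer parties a correlator is bounded by its Tsirelson value. -/
lemma ideal_block_le (M : SwapModel Ψ hΨ A C B) {P Q X X' : H →L[ℂ] H} (hP : P ∈ bicommutant A)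
    (hQ : Q ∈ bicommutant C) (hPp : IsStarProjection P) (hQp : IsStarProjection Q)
    (hX : X ∈ bicommutant A) (hX' : X' ∈ bicommutant C) (hXsa : IsSelfAdjoint X)
    (hXsa' : IsSelfAdjoint X') (hXP : Commute X P) (hXQ : Commute X' Q) {g h : ℝ}
    (hg : X * X * P = (g : ℂ) • P) (hh : X' * X' * Q = (h : ℂ) • Q) (hc : 0 ≤ c)
    (hgh : g * h = (c / 2) ^ 2) :
    (stateFun Ψ hΨ ((B (0, 1) - B (1, 0)) * ((X * P) * (X' * Q)))).re ≤
      c / 2 * (stateFun Ψ hΨ ((B (0, 1) + B (1, 0)) * (P * Q))).re := by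
  have hI := M.independent
  have cXX' : Commute X X' := hI.comm X hX X' hX'
  have cPX' : Commute P X' := hI.comm P hP X' hX'
  have cXQ : Commute X Q := hI.comm X hX Q hQ
  have cPQ : Commute P Q := hI.comm P hP Q hQ
  have hBA : ∀ b, ∀ T ∈ bicommutant A, Commute (B b) T := fun b T hT =>
    (commute_of_mem_bicommutant M.A_sa hT fun x => (M.AB x b).symm).symm
  have hBC : ∀ b, ∀ T ∈ bicommutant C, Commute (B b) T := fun b T hT =>
    (commute_of_mem_bicommutant M.C_sa hT fun x => (M.CB x b).symm).symm
  have hT : IsSelfAdjoint (X * X') := by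
    rw [IsSelfAdjoint, star_mul, hXsa.star_eq, hXsa'.star_eq, cXX'.eq]
  have hPQ : 0 ≤ P * Q := Commute.mul_nonneg hPp.nonneg hQp.nonneg cPQ
  have e1 : (X * P) * (X' * Q) = (X * X') * (P * Q) := by
    rw [mul_assoc, ← mul_assoc P, cPX'.eq, mul_assoc X', ← mul_assoc X]
  have e2 : (X * X') * (X * X') * (P * Q) = (((c / 2) ^ 2 : ℝ) : ℂ) • (P * Q) := by
    calc (X * X') * (X * X') * (P * Q) = (X * (X' * X) * X') * (P * Q) := by simp only [mul_assoc]
      _ = (X * X) * ((X' * X') * P) * Q := by rw [← cXX'.eq]; simp only [mul_assoc]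
      _ = (X * X * P) * (X' * X' * Q) := by
        rw [← (cPX'.mul_right cPX').eq]; simp only [mul_assoc]
      _ = _ := by
        rw [hg, hh, smul_mul_smul_comm, ← hgh]; push_cast; rfl
  have key := fun b => abs_le.1 (abs_stateFun_re_le (Ψ := Ψ) (hΨ := hΨ) (M.B_nonneg b) hT hPQ
    ((hBA b X hX).mul_right (hBC b X' hX')) ((hBA b P hP).mul_right (hBC b Q hQ))
    ((hXP.mul_right cXQ).mul_left (cPX'.symm.mul_right hXQ)) (by positivity) e2)
  have k1 := (key (0, 1)).2
  have k2 := (key (1, 0)).1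
  rw [e1, sub_mul, add_mul, map_sub, map_add, Complex.sub_re, Complex.add_re]
  linarith

/-- The state is supported on the ideal parts of both outer parties: the bounds on the blocks of the
two correlators leave no weight for the complements `1 - P`, `1 - Q`. -/
theorem apply_ideal_eq (M : SwapModel Ψ hΨ A C B) (hT : IsTilted Ψ hΨ A C B s c)
    (hsc : s ^ 2 + c ^ 2 = 1) (hc : 0 < c) (hc2 : 3 / 4 ≤ c ^ 2) (hs0 : s ≠ 0)
    {P Q : H →L[ℂ] H} (hP : P ∈ bicommutant A) (hQ : Q ∈ bicommutant C)
    (iP : IsIdeal (A 0) (A 1) P s) (iQ : IsIdeal (C 0) (C 1) Q s)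
    (hPB : ∀ b : BobOut, b.1 = b.2 → ∀ k, P (B b (Ψ k)) = B b (Ψ k))
    (hQB : ∀ b : BobOut, b.1 = b.2 → ∀ k, Q (B b (Ψ k)) = B b (Ψ k)) (k : κ) :
    P (Ψ k) = Ψ k ∧ Q (Ψ k) = Ψ k := by
  have hs2 : s ^ 2 ≤ 1 / 4 := by linarith
  have hsl : -(1 / 2) ≤ s := by nlinarith
  have hsu : s ≤ 1 / 2 := by nlinarith
  have hI := M.independent
  have hS := M.thirdParty
  have hBA : ∀ b, ∀ T ∈ bicommutant A, Commute (B b) T := fun b T hT =>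
    (commute_of_mem_bicommutant M.A_sa hT fun x => (M.AB x b).symm).symm
  have hBC : ∀ b, ∀ T ∈ bicommutant C, Commute (B b) T := fun b T hT =>
    (commute_of_mem_bicommutant M.C_sa hT fun x => (M.CB x b).symm).symm
  have iQ' := iQ.swap
  obtain ⟨tX, tY⟩ := swap_correlators hT
  obtain ⟨XA, hXA⟩ : ∃ T, T = (1 / 2 : ℂ) • (A 0 - A 1) := ⟨_, rfl⟩
  obtain ⟨YA, hYA⟩ : ∃ T, T = (1 / 2 : ℂ) • (A 0 + A 1) := ⟨_, rfl⟩
  obtain ⟨XC, hXC⟩ : ∃ T, T = (1 / 2 : ℂ) • (C 1 + C 0) := ⟨_, rfl⟩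
  obtain ⟨YC, hYC⟩ : ∃ T, T = (1 / 2 : ℂ) • (C 1 - C 0) := ⟨_, rfl⟩
  have mA := self_mem_bicommutant A
  have mC := self_mem_bicommutant C
  have mXA : XA ∈ bicommutant A := hXA ▸ SMulMemClass.smul_mem _ (sub_mem (mA 0) (mA 1))
  have mYA : YA ∈ bicommutant A := hYA ▸ SMulMemClass.smul_mem _ (add_mem (mA 0) (mA 1))
  have mXC : XC ∈ bicommutant C := hXC ▸ SMulMemClass.smul_mem _ (add_mem (mC 1) (mC 0))
  have mYC : YC ∈ bicommutant C := hYC ▸ SMulMemClass.smul_mem _ (sub_mem (mC 1) (mC 0))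
  have sXA : IsSelfAdjoint XA := hXA ▸ isSelfAdjoint_half_smul ((M.A_sa 0).sub (M.A_sa 1))
  have sYA : IsSelfAdjoint YA := hYA ▸ isSelfAdjoint_half_smul ((M.A_sa 0).add (M.A_sa 1))
  have sXC : IsSelfAdjoint XC := hXC ▸ isSelfAdjoint_half_smul ((M.C_sa 1).add (M.C_sa 0))
  have sYC : IsSelfAdjoint YC := hYC ▸ isSelfAdjoint_half_smul ((M.C_sa 1).sub (M.C_sa 0))
  have cXA : Commute XA P := hXA ▸ ((iP.comm₀.symm).sub_left iP.comm₁.symm).smul_left _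
  have cYA : Commute YA P := hYA ▸ ((iP.comm₀.symm).add_left iP.comm₁.symm).smul_left _
  have cXC : Commute XC Q := hXC ▸ ((iQ.comm₁.symm).add_left iQ.comm₀.symm).smul_left _
  have cYC : Commute YC Q := hYC ▸ ((iQ.comm₁.symm).sub_left iQ.comm₀.symm).smul_left _
  have qXA := iP.half_sub_sq
  have qYA := iP.half_add_sq
  have qXC := iQ'.half_add_sq
  have qYC := iQ'.half_sub_sq
  have antiA := iP.half_anticommute
  have antiC := iQ'.half_anticommute
  have hP' : 1 - P ∈ bicommutant A := sub_mem (one_mem _) hP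
  have hQ' : 1 - Q ∈ bicommutant C := sub_mem (one_mem _) hQ
  have hP0' : 0 ≤ 1 - P := iP.proj.one_sub.nonneg
  have hQ0' : 0 ≤ 1 - Q := iQ.proj.one_sub.nonneg
  have cP' : ∀ {T}, Commute T P → Commute T (1 - P) := fun h => (Commute.one_right _).sub_right h
  have cQ' : ∀ {T}, Commute T Q → Commute T (1 - Q) := fun h => (Commute.one_right _).sub_right h
  have wA := half_weights (Ψ := Ψ) (hΨ := hΨ) (M.A_sa 0) (M.A_sa 1) (M.A_le 0) (M.A_le 1) hP0'
    (cP' iP.comm₀.symm) (cP' iP.comm₁.symm)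
  have wC := half_weights (Ψ := Ψ) (hΨ := hΨ) (M.C_sa 1) (M.C_sa 0) (M.C_le 1) (M.C_le 0) hQ0'
    (cQ' iQ.comm₁.symm) (cQ' iQ.comm₀.symm)
  have hdd := sq_double_block_le hI hS hP' hP0' hQ' hQ0' (mA 0) (mA 1) (M.A_sa 0) (M.A_sa 1)
    (M.A_le 0) (M.A_le 1) (cP' iP.comm₀.symm) (cP' iP.comm₁.symm) (mC 0) (mC 1) (M.C_sa 0)
    (M.C_sa 1) (M.C_le 0) (M.C_le 1) (cQ' iQ.comm₀.symm) (cQ' iQ.comm₁.symm) rfl rfl rfl rfl rfl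
  have he : (stateFun Ψ hΨ ((B (0, 1) - B (1, 0)) * ((XA * (1 - P)) * (XC * (1 - Q))))).re
      + (stateFun Ψ hΨ ((B (0, 1) - B (1, 0)) * ((YA * (1 - P)) * (YC * (1 - Q))))).re =
      ((stateFun Ψ hΨ ((B (0, 1) - B (1, 0)) * ((A 0 * (1 - P)) * (C 1 * (1 - Q))))).re
      - (stateFun Ψ hΨ ((B (0, 1) - B (1, 0)) * ((A 1 * (1 - P)) * (C 0 * (1 - Q))))).re) / 2 := by
    generalize B (0, 1) - B (1, 0) = S
    generalize 1 - P = P'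
    generalize 1 - Q = Q'
    have r2 : ∀ w : ℂ, ((2⁻¹ : ℂ) * w).re = 2⁻¹ * w.re := fun w => by simp [Complex.mul_re]
    rw [hXA, hYA, hXC, hYC]
    simp only [smul_mul_assoc, mul_smul_comm, add_mul, mul_add, sub_mul, mul_sub, map_smul, map_add,
      map_sub, smul_eq_mul, one_div, r2, Complex.add_re, Complex.sub_re]
    ring
  rw [← hXA, ← hXC] at tX
  rw [← hYA, ← hYC] at tY
  rw [← hXA] at qXA
  rw [← hYA] at qYA
  rw [← hXC] at qXC
  rw [← hYC] at qYC
  rw [← hXA, ← hYA] at antiA wA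
  rw [← hXC, ← hYC] at antiC wC
  have hG : 0 < (1 - s) / 2 := by linarith
  have hL : 0 < (1 + s) / 2 := by linarith
  have gG := Real.sq_sqrt hG.le
  have gL := Real.sq_sqrt hL.le
  have hGL : (1 - s) / 2 * ((1 + s) / 2) = (c / 2) ^ 2 := by linear_combination (-1 / 4) * hsc
  -- The four blocks of a correlator.
  have split : ∀ X X' : H →L[ℂ] H, (stateFun Ψ hΨ ((B (0, 1) - B (1, 0)) * (X * X'))).re =
      (stateFun Ψ hΨ ((B (0, 1) - B (1, 0)) * ((X * P) * (X' * Q)))).re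
      + (stateFun Ψ hΨ ((B (0, 1) - B (1, 0)) * ((X * (1 - P)) * (X' * Q)))).re
      + (stateFun Ψ hΨ ((B (0, 1) - B (1, 0)) * ((X * P) * (X' * (1 - Q))))).re
      + (stateFun Ψ hΨ ((B (0, 1) - B (1, 0)) * ((X * (1 - P)) * (X' * (1 - Q))))).re := by
    intro X X'
    simp only [← Complex.add_re, ← map_add]
    congr 2
    simp only [mul_sub, sub_mul, mul_one]
    abel
  have b10 := fun k l => mixed_block_le hI hS hP' hP0' mXA sXA (cP' cXA) mYA sYA (cP' cYA) mXC sXC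
    mYC sYC hQ iQ.proj cXC cYC (Real.sqrt_pos.2 hL) (Real.sqrt_pos.2 hG) (by rw [gL, qXC])
    (by rw [gG, qYC]) (by rw [add_comm, antiC]) k l
  have b01 := fun k l => mixed_block_le hI.symm hS.symm hQ' hQ0' mXC sXC (cQ' cXC) mYC sYC (cQ' cYC)
    mXA sXA mYA sYA hP iP.proj cXA cYA (Real.sqrt_pos.2 hG) (Real.sqrt_pos.2 hL) (by rw [gG, qXA])
    (by rw [gL, qYA]) antiA k l
  rw [gL, gG] at b10
  rw [gG, gL] at b01
  rw [hI.symm.comm _ (mul_mem mXC hQ') _ (mul_mem mXA hP),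
    hI.symm.comm _ (mul_mem mYC hQ') _ (mul_mem mYA hP)] at b01
  have bX := M.ideal_block_le hP hQ iP.proj iQ.proj mXA mXC sXA sXC cXA cXC qXA qXC hc.le hGL
  have bY := M.ideal_block_le hP hQ iP.proj iQ.proj mYA mYC sYA sYC cYA cYC qYA qYC hc.le
    (by rw [mul_comm, hGL])
  have hu := sq_block_le hI hS hP' hP0' mXA sXA (cP' cXA) hQ' hQ0' mXC sXC (cQ' cXC)
  have hv := sq_block_le hI hS hP' hP0' mYA sYA (cP' cYA) hQ' hQ0' mYC sYC (cQ' cYC)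
  -- The outcomes `00` and `11` have all their weight in the ideal block, which fixes the weight that
  -- the outcomes `01` and `10` have there.
  have hdiag : ∀ b : BobOut, b.1 = b.2 →
      (stateFun Ψ hΨ (B b * (P * Q))).re = (stateFun Ψ hΨ (B b)).re := by
    intro b hb
    rw [stateFun_congr Ψ hΨ (Y := B b)]
    intro k
    rw [((hBA b P hP).mul_right (hBC b Q hQ)).eq, mul_apply_eq_comp, mul_apply_eq_comp, hQB b hb,
      hPB b hb]
  have d0 := hdiag (0, 0) rfl
  have d1 := hdiag (1, 1) rfl
  have hPQ0 : 0 ≤ P * Q := Commute.mul_nonneg iP.proj.nonneg iQ.proj.nonneg (hI.comm P hP Q hQ)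
  have hRpos : ∀ b, 0 ≤ (stateFun Ψ hΨ (B b * (P * Q))).re := fun b => stateFun_re_nonneg Ψ hΨ
    (Commute.mul_nonneg (M.B_nonneg b) hPQ0 ((hBA b P hP).mul_right (hBC b Q hQ)))
  have hone := stateFun_one Ψ hΨ M.norm
  have hR : (stateFun Ψ hΨ ((B (0, 1) + B (1, 0)) * (P * Q))).re =
      (stateFun Ψ hΨ P).re * (stateFun Ψ hΨ Q).re
      - (stateFun Ψ hΨ (B (0, 0))).re - (stateFun Ψ hΨ (B (1, 1))).re := by
    rw [← hI.re_mul hP hQ iP.proj.isSelfAdjoint, ← d0, ← d1, ← Complex.sub_re, ← Complex.sub_re,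
      ← map_sub, ← map_sub]
    have h1 := congrArg (· * (P * Q)) M.B_sum_eq
    simp only [add_mul, one_mul] at h1
    have h2 : (B (0, 1) + B (1, 0)) * (P * Q) =
        P * Q - B (0, 0) * (P * Q) - B (1, 1) * (P * Q) := by
      rw [add_mul]
      linear_combination (norm := module) h1
    rw [h2]
  have hr : (stateFun Ψ hΨ (B (0, 1))).re + (stateFun Ψ hΨ (B (1, 0))).re =
      1 - (stateFun Ψ hΨ (B (0, 0))).re - (stateFun Ψ hΨ (B (1, 1))).re := by
    have := congrArg (fun T => (stateFun Ψ hΨ T).re) M.B_sum_eq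
    simp only [map_add, Complex.add_re, hone, Complex.one_re] at this
    linarith
  have a1 : (stateFun Ψ hΨ (1 - P)).re = 1 - (stateFun Ψ hΨ P).re := by simp [hone]
  have c1 : (stateFun Ψ hΨ (1 - Q)).re = 1 - (stateFun Ψ hΨ Q).re := by simp [hone]
  have a0nn := stateFun_re_nonneg Ψ hΨ iP.proj.nonneg
  have c0nn := stateFun_re_nonneg Ψ hΨ iQ.proj.nonneg
  have hac : 0 < (stateFun Ψ hΨ P).re * (stateFun Ψ hΨ Q).re := by
    have h1 := hT.pos (0, 0)
    have h2 := hT.pos (1, 1)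
    have h3 := add_nonneg (hRpos (0, 1)) (hRpos (1, 0))
    rw [← Complex.add_re, ← map_add, ← add_mul, hR] at h3
    linarith
  have a0 : 0 < (stateFun Ψ hΨ P).re := pos_of_mul_pos_left hac c0nn
  have c0 : 0 < (stateFun Ψ hΨ Q).re := pos_of_mul_pos_right hac a0nn
  have a1nn := stateFun_re_nonneg Ψ hΨ hP0'
  have c1nn := stateFun_re_nonneg Ψ hΨ hQ0'
  rw [split] at tX tY
  rw [hr] at tX tY
  rw [hR] at bX bY
  have key := nonideal_weights_eq_zero hc hc2 (G := (1 - s) / 2) (L := (1 + s) / 2)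
    (p₁ := (stateFun Ψ hΨ (A 0 * (1 - P) * A 1)).im)
    (p₂ := (stateFun Ψ hΨ (C 1 * (1 - Q) * C 0)).im) (by ring)
    (fun h => hs0 (by linarith)) hG.le (by linarith) hL.le (by linarith) a0 c0 a1nn c1nn
    wA.2.2.2.1 wA.2.2.2.2 wA.2.2.1 wC.2.2.2.2 wC.2.2.2.1 (by linarith [wC.2.2.1]) wA.1 wA.2.1
    wC.2.1 wC.1 (fun k l _ _ => b10 k l) (fun k l _ _ => b01 k l) hu hv
    (by rw [he]; linarith [hdd.1]) (by rw [he]; linarith [hdd.2])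
    (by rw [a1, c1]; linear_combination bX - tX) (by rw [a1, c1]; linear_combination bY - tY)
  have fP := apply_eq_zero_of_stateFun_re_eq_zero Ψ hΨ hP0' key.1 k
  have fQ := apply_eq_zero_of_stateFun_re_eq_zero Ψ hΨ hQ0' key.2 k
  rw [sub_apply, one_apply_eq_self, sub_eq_zero] at fP fQ
  exact ⟨fP.symm, fQ.symm⟩

end SwapModel

end Rigidity

/-! ### Pauli relations -/

section Pauli

variable {H : Type*} [NormedAddCommGroup H] [InnerProductSpace ℂ H] [CompleteSpace H]
  {κ : Type*} {Ψ : κ → H} {hΨ : Summable fun k => ‖Ψ k‖ ^ 2}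

/-- The normalised component of `D₁` that anticommutes with `D₀` on an ideal projection. -/
noncomputable def tilt (D₀ D₁ : H →L[ℂ] H) (s c : ℝ) : H →L[ℂ] H :=
  (c : ℂ)⁻¹ • (D₁ - (s : ℂ) • D₀)

lemma tilt_isSelfAdjoint {D₀ D₁ : H →L[ℂ] H} (h0 : IsSelfAdjoint D₀) (h1 : IsSelfAdjoint D₁)
    (s c : ℝ) : IsSelfAdjoint (tilt D₀ D₁ s c) := by
  rw [IsSelfAdjoint, tilt, star_smul, star_sub, star_smul, h0.star_eq, h1.star_eq]
  simp

lemma commute_tilt {G D₀ D₁ : H →L[ℂ] H} (h0 : Commute G D₀) (h1 : Commute G D₁) (s c : ℝ) :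
    Commute G (tilt D₀ D₁ s c) :=
  (h1.sub_right (h0.smul_right _)).smul_right _

lemma IsIdeal.tilt_anti {D₀ D₁ P : H →L[ℂ] H} {s : ℝ} (h : IsIdeal D₀ D₁ P s) (c : ℝ) :
    D₀ * tilt D₀ D₁ s c * P = -(tilt D₀ D₁ s c * D₀ * P) := by
  have e := h.anti
  have e0 := h.sq₀
  simp only [add_mul] at e
  simp only [tilt, smul_mul_assoc, mul_smul_comm, sub_mul, mul_sub]
  linear_combination (norm := module) (c : ℂ)⁻¹ • e - (2 * (c : ℂ)⁻¹ * s) • e0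

lemma IsIdeal.tilt_sq {D₀ D₁ P : H →L[ℂ] H} {s c : ℝ} (h : IsIdeal D₀ D₁ P s)
    (hsc : s ^ 2 + c ^ 2 = 1) (hc : c ≠ 0) : tilt D₀ D₁ s c * tilt D₀ D₁ s c * P = P := by
  have e := h.anti
  have e0 := h.sq₀
  have e1 := h.sq₁
  have hC : (c : ℂ) ≠ 0 := by exact_mod_cast hc
  have h2 : (s : ℂ) ^ 2 + (c : ℂ) ^ 2 = 1 := by exact_mod_cast hsc
  have h3 : (c : ℂ)⁻¹ * (c : ℂ)⁻¹ * (1 - (s : ℂ) ^ 2) = 1 := by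
    field_simp
    linear_combination -h2
  simp only [add_mul] at e
  simp only [tilt, smul_mul_assoc, mul_smul_comm, sub_mul, mul_sub]
  linear_combination (norm := module) ((c : ℂ)⁻¹ * (c : ℂ)⁻¹) • e1
    + ((c : ℂ)⁻¹ * (c : ℂ)⁻¹ * s ^ 2) • e0 - ((c : ℂ)⁻¹ * (c : ℂ)⁻¹ * s) • e + h3 • P

/-- If an observable `V`, anticommuting with `T`, agrees on the postselected state with an observable
`V'` that commutes with `T`, then `T` has vanishing expectation. -/
lemma stateFun_eq_zero_of_swap {B G T V V' P : H →L[ℂ] H} {τ : ℂ} (hV : IsSelfAdjoint V)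
    (hV' : IsSelfAdjoint V') (hB : IsSelfAdjoint B) (cBV : Commute B V) (cBV' : Commute B V')
    (cBT : Commute B T) (cBG : Commute B G) (cGV : Commute G V) (cGV' : Commute G V')
    (cVV' : Commute V V') (cTV' : Commute T V') (hTV : V * T * V * P = -(T * P))
    (hVV : V * V * T * P = T * P) (hP : ∀ k, P (Ψ k) = Ψ k) (hτ : (starRingEnd ℂ) τ = τ)
    (h : ∀ k, B (V (Ψ k)) = τ • B (V' (Ψ k))) :
    stateFun Ψ hΨ (B * G * T) = 0 := by
  -- `tr (V B G T V)` is `-tr (B G T)` by anticommutation. Replacing `V` by `τ V'` on the right, moving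
  -- `V'` to the left and replacing it by `V` again, it is also `tr (B G T)`.
  have hl : ∀ Y, stateFun Ψ hΨ (V * B * Y) = τ * stateFun Ψ hΨ (V' * B * Y) := by
    intro Y
    rw [← smul_eq_mul (a := τ), ← map_smul, stateFun_apply, stateFun_apply]
    refine tsum_congr fun k => ?_
    have e : ∀ W : H →L[ℂ] H, IsSelfAdjoint W → ⟪Ψ k, (W * B * Y) (Ψ k)⟫_ℂ =
        ⟪B (W (Ψ k)), Y (Ψ k)⟫_ℂ := by
      intro W hW
      rw [mul_apply_eq_comp, ← adjoint_inner_left, ← star_eq_adjoint, star_mul, hW.star_eq,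
        hB.star_eq, mul_apply_eq_comp]
    rw [smul_apply, inner_smul_right, e V hV, e V' hV', h k, inner_smul_left, hτ]
  have ha : stateFun Ψ hΨ (V * B * (G * T * V)) = -stateFun Ψ hΨ (B * G * T) := by
    have e1 : V * B * (G * T * V) = (B * G) * (V * T * V) := by
      rw [← cBV.eq, mul_assoc, mul_assoc G, ← mul_assoc V G, ← cGV.eq]
      simp only [mul_assoc]
    rw [e1, ← map_neg]
    refine stateFun_congr Ψ hΨ fun k => ?_
    have := DFunLike.congr_fun hTV (Ψ k)
    rw [mul_apply_eq_comp, hP, neg_apply, mul_apply_eq_comp T P, hP] at this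
    rw [mul_apply_eq_comp, this, map_neg, neg_apply, mul_apply_eq_comp (B * G)]
  have hb : stateFun Ψ hΨ (V * B * (G * T * V)) = τ * stateFun Ψ hΨ (V' * B * (V * G * T)) := by
    have e1 : V * B * (G * T * V) = V * G * T * (B * V) := by
      rw [cBV.eq, ← mul_assoc (V * G * T), mul_assoc V G T, mul_assoc V (G * T) V,
        mul_assoc V (G * T * V) B, mul_assoc V B, ← ((cBG.mul_right cBT).mul_right cBV).eq]
    have e2 : V' * B * (V * G * T) = V * G * T * (B * V') := by
      rw [mul_assoc V' B, ((cBV.mul_right cBG).mul_right cBT).eq, ← mul_assoc,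
        (((cVV'.symm).mul_right cGV'.symm).mul_right cTV'.symm).eq, mul_assoc, cBV'.eq]
    rw [e1, e2, ← smul_eq_mul (a := τ), ← map_smul]
    refine stateFun_congr Ψ hΨ fun k => ?_
    rw [mul_apply_eq_comp, mul_apply_eq_comp B, h, map_smul]
    rfl
  have hd : stateFun Ψ hΨ (V * B * (V * G * T)) = stateFun Ψ hΨ (B * G * T) := by
    have e1 : V * B * (V * G * T) = (B * G) * (V * V * T) := by
      rw [← cBV.eq, ← cGV.eq, mul_assoc, mul_assoc G, ← mul_assoc V G, ← cGV.eq]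
      simp only [mul_assoc]
    rw [e1]
    refine stateFun_congr Ψ hΨ fun k => ?_
    have := DFunLike.congr_fun hVV (Ψ k)
    rw [mul_apply_eq_comp, hP, mul_apply_eq_comp T P, hP] at this
    rw [mul_apply_eq_comp, this, mul_apply_eq_comp (B * G)]
  have hfin := hb.symm.trans ha
  rw [← hl, hd] at hfin
  have h2 : (2 : ℂ) * stateFun Ψ hΨ (B * G * T) = 0 := by linear_combination hfin
  exact (mul_eq_zero.1 h2).resolve_left two_ne_zero

variable {A C : Fin 2 → H →L[ℂ] H} {B : BobOut → H →L[ℂ] H} {s c : ℝ}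

/-- Perfect correlation: two observables, with square one and correlator `τ = ±1` after
postselection, agree up to sign on the postselected vectors. -/
lemma apply_eq_of_perfect_correlation {B V V' : H →L[ℂ] H} (hB : 0 ≤ B) (hV : IsSelfAdjoint V)
    (hV' : IsSelfAdjoint V') (cBV : Commute B V) (cBV' : Commute B V') {τ : ℝ} (hτ : τ * τ = 1)
    (h1 : ∀ k, V (V (Ψ k)) = Ψ k) (h2 : ∀ k, V' (V' (Ψ k)) = Ψ k)
    (h : (stateFun Ψ hΨ (B * (V * V'))).re = τ * (stateFun Ψ hΨ B).re) (k : κ) :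
    B (V (Ψ k)) = (τ : ℂ) • B (V' (Ψ k)) := by
  have n : ∀ W : H →L[ℂ] H, IsSelfAdjoint W → Commute B W → (∀ k, W (W (Ψ k)) = Ψ k) →
      stateForm Ψ hΨ B W W = (stateFun Ψ hΨ B).re := by
    intro W hW hc hk
    rw [stateForm_apply, hW.star_eq, ← hc.eq, mul_assoc, stateFun_congr Ψ hΨ (Y := B)]
    intro k
    rw [mul_apply_eq_comp, mul_apply_eq_comp, hk]
  have m : stateForm Ψ hΨ B V V' = τ * (stateFun Ψ hΨ B).re := by
    rw [stateForm_apply, hV.star_eq, ← cBV.eq, mul_assoc, h]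
  have hz : stateForm Ψ hΨ B (V - τ • V') (V - τ • V') = 0 := by
    rw [map_sub (stateForm Ψ hΨ B), LinearMap.sub_apply, map_sub, map_sub, map_smul,
      map_smul (stateForm Ψ hΨ B) τ V', LinearMap.smul_apply, LinearMap.smul_apply,
      stateForm_symm hB V' V, n V hV cBV h1, map_smul, n V' hV' cBV' h2, m, smul_eq_mul, smul_eq_mul, smul_eq_mul]
    linear_combination (-(stateFun Ψ hΨ B).re) * hτ
  have := mul_apply_eq_zero_of_stateForm_eq_zero hB hz k
  rw [sub_apply, smul_apply, map_sub, sub_eq_zero] at this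
  rw [this, ← Complex.coe_smul, map_smul]

/-- The relations of the self-tested state. `Z`, `X` anticommute on the support `P` of the state on
Alice's side, `X'`, `Z'` on the support `Q` of the state on Charlie's side, and each outcome of the
central party correlates the pairs perfectly. -/
structure PauliModel (Ψ : κ → H) (Z X X' Z' P Q : H →L[ℂ] H) (B : BobOut → H →L[ℂ] H) : Prop where
  Z_sa : IsSelfAdjoint Z
  X_sa : IsSelfAdjoint X
  X'_sa : IsSelfAdjoint X'
  Z'_sa : IsSelfAdjoint Z'
  PZ : Commute P Z
  PX : Commute P X
  QX' : Commute Q X'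
  QZ' : Commute Q Z'
  Z_sq : Z * Z * P = P
  X_sq : X * X * P = P
  X'_sq : X' * X' * Q = Q
  Z'_sq : Z' * Z' * Q = Q
  anti : Z * X * P = -(X * Z * P)
  anti' : X' * Z' * Q = -(Z' * X' * Q)
  P_apply : ∀ k, P (Ψ k) = Ψ k
  Q_apply : ∀ k, Q (Ψ k) = Ψ k
  corrZ : ∀ b k, B b (Z (Ψ k)) = (((-1) ^ (b.1 : ℕ) : ℝ) : ℂ) • B b (Z' (Ψ k))
  corrX : ∀ b k, B b (X (Ψ k)) = (((-1) ^ (b.2 : ℕ) : ℝ) : ℂ) • B b (X' (Ψ k))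

/-- Charlie's roles are exchanged: his `X'` is `C 0` and his `Z'` is the tilted part of `C 1`. -/
theorem SwapModel.exists_pauliModel (M : SwapModel Ψ hΨ A C B) (hT : IsTilted Ψ hΨ A C B s c)
    (hsc : s ^ 2 + c ^ 2 = 1) (hc : 0 < c) (hc2 : 3 / 4 ≤ c ^ 2) (hs0 : s ≠ 0) :
    ∃ P Q, PauliModel Ψ (A 0) (tilt (A 0) (A 1) s c) (C 0) (tilt (C 0) (C 1) s c) P Q B := by
  have hs : |s| < c := by
    refine abs_lt_of_sq_lt_sq ?_ hc.le
    linarith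
  obtain ⟨P, hP, iP, hPB⟩ := M.exists_ideal_left hT hsc hs hs0
  obtain ⟨Q, hQ, iQ, hQB⟩ := M.exists_ideal_right hT hsc hs hs0
  have hPQ := M.apply_ideal_eq hT hsc hc hc2 hs0 hP hQ iP iQ hPB hQB
  have happ : ∀ {W P : H →L[ℂ] H}, W * W * P = P → (∀ k, P (Ψ k) = Ψ k) →
      ∀ k, W (W (Ψ k)) = Ψ k := by
    intro W P h1 h2 k
    have := DFunLike.congr_fun h1 (Ψ k)
    rwa [mul_apply_eq_comp, h2, mul_apply_eq_comp] at this
  have hτ : ∀ n : ℕ, ((-1 : ℝ) ^ n) * ((-1 : ℝ) ^ n) = 1 := fun n => by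
    rw [← mul_pow]; norm_num
  have hre : ∀ z : ℂ, ((c : ℂ)⁻¹ * z).re = c⁻¹ * z.re := fun z => by
    rw [← Complex.ofReal_inv, Complex.re_ofReal_mul]
  have hres : ∀ z : ℂ, ((s : ℂ) * z).re = s * z.re := fun z => Complex.re_ofReal_mul s z
  have sX := tilt_isSelfAdjoint (M.A_sa 0) (M.A_sa 1) s c
  have sZ' := tilt_isSelfAdjoint (M.C_sa 0) (M.C_sa 1) s c
  refine ⟨P, Q, M.A_sa 0, sX, M.C_sa 0, sZ', iP.comm₀, commute_tilt iP.comm₀ iP.comm₁ s c, iQ.comm₀,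
    commute_tilt iQ.comm₀ iQ.comm₁ s c, iP.sq₀, iP.tilt_sq hsc hc.ne', iQ.sq₀,
    iQ.tilt_sq hsc hc.ne', iP.tilt_anti c, iQ.tilt_anti c, fun k => (hPQ k).1, fun k => (hPQ k).2,
    fun b k => ?_, fun b k => ?_⟩
  · refine apply_eq_of_perfect_correlation (Ψ := Ψ) (hΨ := hΨ) (M.B_nonneg b) (M.A_sa 0) sZ'
      (M.AB 0 b).symm (commute_tilt (M.CB 0 b).symm (M.CB 1 b).symm s c) (hτ _)
      (happ iP.sq₀ fun k => (hPQ k).1) (happ (iQ.tilt_sq hsc hc.ne') fun k => (hPQ k).2) ?_ k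
    rw [tilt, mul_smul_comm, mul_smul_comm, mul_sub, mul_sub, mul_smul_comm, mul_smul_comm, map_smul,
      map_sub, map_smul, smul_eq_mul, smul_eq_mul, hre, Complex.sub_re, hres, hT.c01, hT.c00]
    field_simp
    ring
  · refine apply_eq_of_perfect_correlation (Ψ := Ψ) (hΨ := hΨ) (M.B_nonneg b) sX (M.C_sa 0)
      (commute_tilt (M.AB 0 b).symm (M.AB 1 b).symm s c) (M.CB 0 b).symm (hτ _)
      (happ (iP.tilt_sq hsc hc.ne') fun k => (hPQ k).1) (happ iQ.sq₀ fun k => (hPQ k).2) ?_ k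
    rw [tilt, smul_mul_assoc, mul_smul_comm, sub_mul, mul_sub, smul_mul_assoc, mul_smul_comm, map_smul,
      map_sub, map_smul, smul_eq_mul, smul_eq_mul, hre, Complex.sub_re, hres, hT.c10, hT.c00]
    field_simp
    ring

namespace PauliModel

variable {Z X X' Z' P Q : H →L[ℂ] H}

/-- Operators commuting with all observables of the three parties. -/
structure CommutesWith (G : H →L[ℂ] H) (A C : Fin 2 → H →L[ℂ] H) (B : BobOut → H →L[ℂ] H) :
    Prop where
  A : ∀ x, Commute G (A x)
  C : ∀ z, Commute G (C z)
  B : ∀ b, Commute G (B b)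

lemma CommutesWith.tiltA {G : H →L[ℂ] H} (hG : CommutesWith G A C B) :
    Commute G (tilt (A 0) (A 1) s c) := commute_tilt (hG.A 0) (hG.A 1) s c

lemma CommutesWith.tiltC {G : H →L[ℂ] H} (hG : CommutesWith G A C B) :
    Commute G (tilt (C 0) (C 1) s c) := commute_tilt (hG.C 0) (hG.C 1) s c

end PauliModel

section Vanish

variable {P Q : H →L[ℂ] H}

/-- Given Bob's outcome, the expectations of `Z`, `X`, `Z X` and `X'` vanish even after multiplication
with an operator `G` of the environment, because each of them anticommutes with an observable that
has a perfectly correlated partner on the other side. -/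
theorem SwapModel.stateFun_mul_pauli (M : SwapModel Ψ hΨ A C B)
    (N : PauliModel Ψ (A 0) (tilt (A 0) (A 1) s c) (C 0) (tilt (C 0) (C 1) s c) P Q B)
    {G : H →L[ℂ] H} (hG : PauliModel.CommutesWith G A C B) (b : BobOut) :
    stateFun Ψ hΨ (B b * G * A 0) = 0 ∧ stateFun Ψ hΨ (B b * G * tilt (A 0) (A 1) s c) = 0 ∧
      stateFun Ψ hΨ (B b * G * (A 0 * tilt (A 0) (A 1) s c)) = 0 ∧
      stateFun Ψ hΨ (B b * G * C 0) = 0 := by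
  have cXC : ∀ z, Commute (tilt (A 0) (A 1) s c) (C z) := fun z =>
    (commute_tilt (M.AC 0 z).symm (M.AC 1 z).symm s c).symm
  have cZ'A : ∀ x, Commute (A x) (tilt (C 0) (C 1) s c) := fun x =>
    commute_tilt (M.AC x 0) (M.AC x 1) s c
  have cXZ' : Commute (tilt (A 0) (A 1) s c) (tilt (C 0) (C 1) s c) :=
    commute_tilt (cXC 0) (cXC 1) s c
  have cBX : Commute (B b) (tilt (A 0) (A 1) s c) :=
    commute_tilt (M.AB 0 b).symm (M.AB 1 b).symm s c
  have cBZ' : Commute (B b) (tilt (C 0) (C 1) s c) :=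
    commute_tilt (M.CB 0 b).symm (M.CB 1 b).symm s c
  have cGX := hG.tiltA (s := s) (c := c)
  have cGZ' := hG.tiltC (s := s) (c := c)
  have cZX' := M.AC 0 0
  have cXX' := cXC 0
  have cZZ' := cZ'A 0
  have cBZ := (M.AB 0 b).symm
  have cBX' := (M.CB 0 b).symm
  have cGZ := hG.A 0
  have cGX' := hG.C 0
  have cBG := (hG.B b).symm
  have hB := (M.B_nonneg b).isSelfAdjoint
  have hτ : ∀ n : ℕ, (starRingEnd ℂ) (((-1) ^ n : ℝ) : ℂ) = (((-1) ^ n : ℝ) : ℂ) :=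
    fun n => Complex.conj_ofReal _
  have hττ : (((-1) ^ (b.1 : ℕ) : ℝ) : ℂ) * (((-1) ^ (b.1 : ℕ) : ℝ) : ℂ) = 1 := by
    rw [← Complex.ofReal_mul, ← mul_pow]; norm_num
  generalize tilt (A 0) (A 1) s c = X at *
  generalize tilt (C 0) (C 1) s c = Z' at *
  generalize A 0 = Z at *
  generalize C 0 = X' at *
  have sand : ∀ {V T P : H →L[ℂ] H}, Commute P V → V * V * P = P → V * T * P = -(T * V * P) →
      V * T * V * P = -(T * P) := by
    intro V T P h1 h2 h3
    calc V * T * V * P = V * T * P * V := by rw [mul_assoc, ← h1.eq, ← mul_assoc]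
      _ = -(T * (V * P * V)) := by rw [h3]; simp only [neg_mul, mul_assoc]
      _ = -(T * P) := by
        rw [show V * P * V = P by rw [mul_assoc, h1.eq, ← mul_assoc, h2]]
  have hVV : ∀ {V T P : H →L[ℂ] H}, Commute P T → V * V * P = P → V * V * T * P = T * P := by
    intro V T P h1 h2
    rw [mul_assoc, ← h1.eq, ← mul_assoc, h2]
  have hanti : X * Z * P = -(Z * X * P) := by rw [N.anti, neg_neg]
  have hanti' : Z' * X' * Q = -(X' * Z' * Q) := by rw [N.anti', neg_neg]
  refine ⟨?_, ?_, ?_, ?_⟩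
  · exact stateFun_eq_zero_of_swap N.X_sa N.X'_sa hB cBX cBX' cBZ cBG cGX cGX' cXX' cZX'
      (sand N.PX N.X_sq hanti) (hVV N.PZ N.X_sq) N.P_apply (hτ _) (N.corrX b)
  · exact stateFun_eq_zero_of_swap N.Z_sa N.Z'_sa hB cBZ cBZ' cBX cBG cGZ cGZ' cZZ' cXZ'
      (sand N.PZ N.Z_sq N.anti) (hVV N.PX N.Z_sq) N.P_apply (hτ _) (N.corrZ b)
  · refine stateFun_eq_zero_of_swap N.Z_sa N.Z'_sa hB cBZ cBZ' (cBZ.mul_right cBX) cBG cGZ cGZ' cZZ'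
      (cZZ'.mul_left cXZ') (sand N.PZ N.Z_sq ?_) (hVV (N.PZ.mul_right N.PX) N.Z_sq) N.P_apply (hτ _)
      (N.corrZ b)
    rw [mul_assoc, N.anti]
    simp only [mul_neg, mul_assoc]
  · refine stateFun_eq_zero_of_swap N.Z'_sa N.Z_sa hB cBZ' cBZ cBX' cBG cGZ' cGZ cZZ'.symm cZX'.symm
      (sand N.QZ' N.Z'_sq hanti') (hVV N.QX' N.Z'_sq) N.Q_apply (hτ b.1) fun k => ?_
    rw [N.corrZ, smul_smul, hττ, one_smul]

end Vanish

end Pauli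

/-! ### Uniformity of the outcomes -/

section Uniform

variable {H : Type*} [NormedAddCommGroup H] [InnerProductSpace ℂ H] [CompleteSpace H]
  {κ : Type*} {Ψ : κ → H} {hΨ : Summable fun k => ‖Ψ k‖ ^ 2}
  {A C : Fin 2 → H →L[ℂ] H} {B : BobOut → H →L[ℂ] H} {s c : ℝ}

lemma stateFun_eq_mul {X Y : H →L[ℂ] H} {τ : ℂ} (h : ∀ k, X (Ψ k) = τ • Y (Ψ k)) :
    stateFun Ψ hΨ X = τ * stateFun Ψ hΨ Y := by
  rw [stateFun_congr Ψ hΨ (Y := τ • Y) h, map_smul, smul_eq_mul]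

open PauliModel in
/-- Given Bob's outcome, and whatever an operator `G` of the environment finds, the outcomes of the
outer parties for the settings `0`, `0` are uniform. -/
theorem SwapModel.outer_uniform (M : SwapModel Ψ hΨ A C B) (hT : IsTilted Ψ hΨ A C B s c)
    (hsc : s ^ 2 + c ^ 2 = 1) (hc : 0 < c) (hc2 : 3 / 4 ≤ c ^ 2) (hs0 : s ≠ 0)
    {G : H →L[ℂ] H} (hG : CommutesWith G A C B) (b : BobOut) (ε η : ℂ) :
    stateFun Ψ hΨ (((1 / 2 : ℂ) • (1 + ε • A 0)) * B b * ((1 / 2 : ℂ) • (1 + η • C 0)) * G) =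
      1 / 4 * stateFun Ψ hΨ (B b * G) := by
  obtain ⟨P, Q, N⟩ := M.exists_pauliModel hT hsc hc hc2 hs0
  obtain ⟨hZ, -, hZX, hX'⟩ := M.stateFun_mul_pauli N hG b
  -- `X'` acts like `X` up to sign, so `Z X'` reduces to `Z X`.
  have hZX' : stateFun Ψ hΨ (B b * G * (A 0 * C 0)) = 0 := by
    have e : ∀ T, Commute (B b) T → B b * G * (A 0 * T) = G * A 0 * (B b * T) := fun T hT => by
      rw [← (hG.B b).eq, mul_assoc, ← mul_assoc (B b), ← (M.AB 0 b).eq]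
      simp only [mul_assoc]
    rw [e _ (M.CB 0 b).symm, ← mul_zero (((-1) ^ (b.2 : ℕ) : ℝ) : ℂ), ← hZX,
      e _ (commute_tilt (M.AB 0 b).symm (M.AB 1 b).symm s c)]
    refine stateFun_eq_mul fun k => ?_
    have hττ : (((-1) ^ (b.2 : ℕ) : ℝ) : ℂ) * (((-1) ^ (b.2 : ℕ) : ℝ) : ℂ) = 1 := by
      rw [← Complex.ofReal_mul, ← mul_pow]; norm_num
    simp only [mul_apply_eq_comp]
    rw [N.corrX, map_smul, map_smul, smul_smul, hττ, one_smul]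
  have e : ((1 / 2 : ℂ) • (1 + ε • A 0)) * B b * ((1 / 2 : ℂ) • (1 + η • C 0)) * G =
      (1 / 4 : ℂ) • (B b * G + ε • (B b * G * A 0) + η • (B b * G * C 0)
        + (ε * η) • (B b * G * (A 0 * C 0))) := by
    have c1 := (M.AB 0 b).eq
    have c2 := (hG.A 0).eq
    have c3 := (hG.C 0).eq
    have c5 : ∀ W, G * (A 0 * W) = A 0 * (G * W) := fun W => by rw [← mul_assoc, c2, mul_assoc]
    simp only [smul_mul_assoc, mul_smul_comm, add_mul, mul_add, one_mul, mul_one, smul_add, smul_smul,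
      mul_assoc, c1, c2, c3, c5]
    module
  rw [e, map_smul, map_add, map_add, map_add, map_smul, map_smul, map_smul, hZ, hX', hZX']
  simp

open PauliModel in
/-- If an operator `G` of the environment mediates no correlations between operators of the outer
parties that are uncorrelated with the environment, then Bob's outcome is uniform as well. -/
theorem SwapModel.bob_uniform (M : SwapModel Ψ hΨ A C B) (hT : IsTilted Ψ hΨ A C B s c)
    (hsc : s ^ 2 + c ^ 2 = 1) (hc : 0 < c) (hc2 : 3 / 4 ≤ c ^ 2) (hs0 : s ≠ 0)
    {G : H →L[ℂ] H} (hG : CommutesWith G A C B)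
    (hsplit : ∀ T ∈ bicommutant A, ∀ T' ∈ bicommutant C,
      (∀ u, CommutesWith u A C B → stateFun Ψ hΨ (T * u) = 0) → stateFun Ψ hΨ (T * T' * G) = 0)
    (b : BobOut) : stateFun Ψ hΨ (B b * G) = 1 / 4 * stateFun Ψ hΨ G := by
  obtain ⟨P, Q, N⟩ := M.exists_pauliModel hT hsc hc hc2 hs0
  have van : ∀ T, (∀ u, CommutesWith u A C B → Commute u T ∧ ∀ b, stateFun Ψ hΨ (B b * u * T) = 0) →
      ∀ u, CommutesWith u A C B → stateFun Ψ hΨ (T * u) = 0 := by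
    intro T hT u hu
    rw [← (hT u hu).1.eq, ← one_mul (u * T), ← M.B_sum, Finset.sum_mul, map_sum]
    exact Finset.sum_eq_zero fun b _ => by rw [← mul_assoc, (hT u hu).2 b]
  have mX : tilt (A 0) (A 1) s c ∈ bicommutant A := SMulMemClass.smul_mem _ (sub_mem
    (self_mem_bicommutant A 1) (SMulMemClass.smul_mem _ (self_mem_bicommutant A 0)))
  have mZ' : tilt (C 0) (C 1) s c ∈ bicommutant C := SMulMemClass.smul_mem _ (sub_mem
    (self_mem_bicommutant C 1) (SMulMemClass.smul_mem _ (self_mem_bicommutant C 0)))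
  have mZ := self_mem_bicommutant A 0
  have mX' := self_mem_bicommutant C 0
  have v1 := hsplit _ mZ _ mZ' (van _ fun u hu =>
    ⟨hu.A 0, fun b => (M.stateFun_mul_pauli N hu b).1⟩)
  have v2 := hsplit _ mX _ mX' (van _ fun u hu =>
    ⟨hu.tiltA, fun b => (M.stateFun_mul_pauli N hu b).2.1⟩)
  have v3 := hsplit _ (mul_mem mZ mX) _ (mul_mem mZ' mX') (van _ fun u hu =>
    ⟨(hu.A 0).mul_right hu.tiltA, fun b => (M.stateFun_mul_pauli N hu b).2.2.1⟩)
  have comm := M.independent.comm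
  have cZZ' : Commute (A 0) (tilt (C 0) (C 1) s c) := comm _ mZ _ mZ'
  have cXX' : Commute (tilt (A 0) (A 1) s c) (C 0) := comm _ mX _ mX'
  have cXZ' : Commute (tilt (A 0) (A 1) s c) (tilt (C 0) (C 1) s c) := comm _ mX _ mZ'
  have cZX' : Commute (A 0) (C 0) := comm _ mZ _ mX'
  have cBZ := fun b => (M.AB 0 b).symm
  have cBX' := fun b => (M.CB 0 b).symm
  have cBX := fun b => commute_tilt (M.AB 0 b).symm (M.AB 1 b).symm s c
  have cBZ' := fun b => commute_tilt (M.CB 0 b).symm (M.CB 1 b).symm s c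
  have cGX := hG.tiltA (s := s) (c := c)
  have cGZ' := hG.tiltC (s := s) (c := c)
  have cGZ := hG.A 0
  have cGX' := hG.C 0
  generalize tilt (A 0) (A 1) s c = X at *
  generalize tilt (C 0) (C 1) s c = Z' at *
  generalize A 0 = Z at *
  generalize C 0 = X' at *
  have hsum : ∀ W, stateFun Ψ hΨ W = ∑ b, stateFun Ψ hΨ (W * B b) := fun W => by
    rw [← map_sum, ← Finset.mul_sum, M.B_sum, mul_one]
  have hττ : ∀ n : ℕ, (((-1) ^ n : ℝ) : ℂ) * (((-1) ^ n : ℝ) : ℂ) = 1 := fun n => by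
    rw [← Complex.ofReal_mul, ← mul_pow]; norm_num
  have inv : ∀ {τ : ℂ} {v w : H}, τ * τ = 1 → v = τ • w → w = τ • v := by
    intro τ v w h1 h2
    rw [h2, smul_smul, h1, one_smul]
  have kZ : ∀ b k, B b (Z' (Ψ k)) = (((-1) ^ (b.1 : ℕ) : ℝ) : ℂ) • B b (Z (Ψ k)) := fun b k =>
    inv (hττ _) (N.corrZ b k)
  have kX : ∀ b k, B b (X' (Ψ k)) = (((-1) ^ (b.2 : ℕ) : ℝ) : ℂ) • B b (X (Ψ k)) := fun b k =>
    inv (hττ _) (N.corrX b k)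
  have ap : ∀ {S T : H →L[ℂ] H}, Commute S T → ∀ v, S (T v) = T (S v) := fun h v =>
    DFunLike.congr_fun h.eq v
  have sZ : ∀ k, Z (Z (Ψ k)) = Ψ k := fun k => by
    have := DFunLike.congr_fun N.Z_sq (Ψ k)
    rwa [mul_apply_eq_comp, N.P_apply, mul_apply_eq_comp] at this
  have sX : ∀ k, X (X (Ψ k)) = Ψ k := fun k => by
    have := DFunLike.congr_fun N.X_sq (Ψ k)
    rwa [mul_apply_eq_comp, N.P_apply, mul_apply_eq_comp] at this
  have sXZ : ∀ k, X (X (Z (Ψ k))) = Z (Ψ k) := fun k => by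
    have := DFunLike.congr_fun N.X_sq (Z (Ψ k))
    rwa [mul_apply_eq_comp, ap N.PZ, N.P_apply, mul_apply_eq_comp] at this
  have cBG := fun b => (hG.B b).symm
  -- The correlators are the Fourier coefficients of `b ↦ tr (ρ B^b G)`.
  have t1 : stateFun Ψ hΨ (Z * Z' * G) =
      ∑ b : BobOut, (((-1) ^ (b.1 : ℕ) : ℝ) : ℂ) * stateFun Ψ hΨ (B b * G) := by
    rw [hsum]
    refine Finset.sum_congr rfl fun b _ => ?_
    refine stateFun_eq_mul fun k => ?_
    simp only [mul_apply_eq_comp]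
    rw [← ap cGZ', ← ap cGZ, ← ap (cBZ' b), kZ, map_smul, map_smul, ← ap (cBZ b), sZ, ap (cBG b)]
  have t2 : stateFun Ψ hΨ (X * X' * G) =
      ∑ b : BobOut, (((-1) ^ (b.2 : ℕ) : ℝ) : ℂ) * stateFun Ψ hΨ (B b * G) := by
    rw [hsum]
    refine Finset.sum_congr rfl fun b _ => ?_
    refine stateFun_eq_mul fun k => ?_
    simp only [mul_apply_eq_comp]
    rw [← ap cGX', ← ap cGX, ← ap (cBX' b), kX, map_smul, map_smul, ← ap (cBX b), sX, ap (cBG b)]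
  have t3 : stateFun Ψ hΨ (Z * X * (Z' * X') * G) = ∑ b : BobOut,
      ((((-1) ^ (b.1 : ℕ) : ℝ) : ℂ) * (((-1) ^ (b.2 : ℕ) : ℝ) : ℂ)) * stateFun Ψ hΨ (B b * G) := by
    rw [hsum]
    refine Finset.sum_congr rfl fun b _ => ?_
    refine stateFun_eq_mul fun k => ?_
    simp only [mul_apply_eq_comp]
    rw [← ap cGX', ← ap cGZ', ← ap cGX, ← ap cGZ, ← ap (cBX' b), kX, map_smul, ap (cBX b),
      ← ap cXZ', ← ap (cBZ' b), kZ]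
    simp only [map_smul]
    rw [← ap (cBX b), ← ap (cBX b), sXZ, ← ap (cBZ b), sZ, ap (cBG b), smul_smul, mul_comm]
  have t0 : stateFun Ψ hΨ G = ∑ b : BobOut, stateFun Ψ hΨ (B b * G) := by
    rw [hsum]
    exact Finset.sum_congr rfl fun b _ => by rw [(cBG b).eq]
  rw [v1] at t1
  rw [v2] at t2
  rw [v3] at t3
  simp only [Fintype.sum_prod_type, Fin.sum_univ_two] at t0 t1 t2 t3
  norm_num at t1 t2 t3
  -- Fourier inversion on the four outcomes of Bob.
  obtain ⟨b₀, b₁⟩ := b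
  fin_cases b₀ <;> fin_cases b₁ <;> simp only [Fin.zero_eta, Fin.mk_one]
  · linear_combination (-1 / 4) * (t0 + t1 + t2 + t3)
  · linear_combination (-1 / 4) * (t0 + t1 - t2 - t3)
  · linear_combination (-1 / 4) * (t0 - t1 + t2 - t3)
  · linear_combination (-1 / 4) * (t0 - t1 - t2 + t3)

end Uniform

/-! ### Product vectors and local operators -/

section Tensor

variable {ι κ : Type}

open Classical in
/-- The basis vector `e_i` of `ℓ²(ι)`. -/
noncomputable def basisVec (i : ι) : Hilb ι := lp.single 2 i (1 : ℂ)

open Classical in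
lemma basisVec_apply (i j : ι) : (basisVec j : ι → ℂ) i = if i = j then 1 else 0 := by
  simp [basisVec, Pi.single_apply]

lemma inner_basisVec_left (i : ι) (f : Hilb ι) : ⟪basisVec i, f⟫_ℂ = f i := by
  classical
  rw [basisVec]
  convert lp.inner_single_left i (1 : ℂ) f
  simp

lemma inner_basisVec_right (i : ι) (f : Hilb ι) :
    ⟪f, basisVec i⟫_ℂ = (starRingEnd ℂ) (f i) := by
  rw [← inner_conj_symm, inner_basisVec_left]

lemma matElem_eq (X : Op ι) (i j : ι) : matElem X i j = ⟪basisVec i, X (basisVec j)⟫_ℂ := by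
  rw [inner_basisVec_left]; rfl

lemma hasSum_basisVec (f : Hilb ι) : HasSum (fun i => f i • basisVec i) f := by
  classical
  have := lp.hasSum_single (E := fun _ : ι => ℂ) (p := 2) (by norm_num) f
  convert this using 2 with i
  rw [basisVec, ← lp.single_smul]
  congr 1
  simp

lemma clm_ext_basisVec {F : Type*} [NormedAddCommGroup F] [NormedSpace ℂ F] {S T : Hilb ι →L[ℂ] F}
    (h : ∀ i, S (basisVec i) = T (basisVec i)) : S = T := by
  ext f
  refine ((hasSum_basisVec f).mapL S).unique ?_
  convert (hasSum_basisVec f).mapL T using 2 with i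
  rw [map_smul, map_smul, h]

lemma op_ext {X Y : Op ι} (h : ∀ i j, matElem X i j = matElem Y i j) : X = Y :=
  clm_ext_basisVec fun j => lp.ext (funext fun i => h i j)

/-- Matrix multiplication. -/
lemma hasSum_matElem_mul (X Y : Op ι) (i j : ι) :
    HasSum (fun k => matElem X i k * matElem Y k j) (matElem (X * Y) i j) := by
  have h := ((hasSum_basisVec (Y (basisVec j))).mapL X).mapL (innerSL ℂ (basisVec i))
  have e : ∀ k, innerSL ℂ (basisVec i) (X (Y (basisVec j) k • basisVec k)) =
      matElem X i k * matElem Y k j := fun k => by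
    rw [innerSL_apply_apply, map_smul, inner_smul_right, ← matElem_eq, mul_comm]
    rfl
  simp only [e] at h
  rw [matElem_eq (X * Y)]
  exact h

/-- Operators on disjoint factors commute. In the matrix elements of either product only one
intermediate index contributes: `k`, with the coordinates of `i` outside the first factor and those of
`j` outside the second one, respectively `l`, with `i` and `j` exchanged. -/
lemma ActsOn.commute {τ σ μ σ' μ' : Type} {see : τ → σ} {rest : τ → μ} {see' : τ → σ'}
    {rest' : τ → μ'} {X Y : Op τ} (hX : ActsOn see rest X) (hY : ActsOn see' rest' Y)
    (hinj : ∀ k l, rest k = rest l → rest' k = rest' l → k = l)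
    (h1 : ∀ i j, rest i = rest j → see' i = see' j)
    (h2 : ∀ i j, rest' i = rest' j → see i = see j)
    (hswap : ∀ i j k, rest k = rest i → rest' k = rest' j →
      ∃ l, rest' l = rest' i ∧ rest l = rest j) : Commute X Y := by
  classical
  obtain ⟨m, hm⟩ := hX
  obtain ⟨m', hm'⟩ := hY
  refine op_ext fun i j => ?_
  have e1 := hasSum_matElem_mul X Y i j
  have e2 := hasSum_matElem_mul Y X i j
  simp only [hm, hm'] at e1 e2
  by_cases hk : ∃ k, rest k = rest i ∧ rest' k = rest' j
  · obtain ⟨k, k1, k2⟩ := hk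
    obtain ⟨l, l1, l2⟩ := hswap i j k k1 k2
    have f1 := hasSum_single (f := fun k => (if rest i = rest k then m (see i) (see k) else 0) *
      (if rest' k = rest' j then m' (see' k) (see' j) else 0)) k (by
        intro k' hk'
        by_cases a : rest i = rest k'
        · by_cases b : rest' k' = rest' j
          · exact absurd (hinj _ _ (a.symm.trans k1.symm) (b.trans k2.symm)) hk'
          · simp [b]
        · simp [a])
    have f2 := hasSum_single (f := fun k => (if rest' i = rest' k then m' (see' i) (see' k) else 0) *
      (if rest k = rest j then m (see k) (see j) else 0)) l (by
        intro k' hk'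
        by_cases a : rest k' = rest j
        · by_cases b : rest' i = rest' k'
          · exact absurd (hinj _ _ (a.trans l2.symm) (b.symm.trans l1.symm)) hk'
          · simp [b]
        · simp [a])
    rw [e1.unique f1, e2.unique f2, if_pos k1.symm, if_pos k2, if_pos l1.symm, if_pos l2,
      h1 k i k1, h2 k j k2, h1 l j l2, h2 l i l1, mul_comm]
  · have z1 : ∀ k, (if rest i = rest k then m (see i) (see k) else 0) *
        (if rest' k = rest' j then m' (see' k) (see' j) else 0) = 0 := by
      intro k
      by_cases a : rest i = rest k
      · by_cases b : rest' k = rest' j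
        · exact absurd ⟨k, a.symm, b⟩ hk
        · simp [b]
      · simp [a]
    have z2 : ∀ k, (if rest' i = rest' k then m' (see' i) (see' k) else 0) *
        (if rest k = rest j then m (see k) (see j) else 0) = 0 := by
      intro k
      by_cases a : rest k = rest j
      · by_cases b : rest' i = rest' k
        · obtain ⟨l, l1, l2⟩ := hswap j i k a b.symm
          exact absurd ⟨l, l2, l1⟩ hk
        · simp [b]
      · simp [a]
    simp only [z1] at e1
    simp only [z2] at e2
    rw [e1.unique hasSum_zero, e2.unique hasSum_zero]

lemma inner_prodVec (u u' : Hilb ι) (v v' : Hilb κ) :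
    ⟪prodVec u v, prodVec u' v'⟫_ℂ = ⟪u, u'⟫_ℂ * ⟪v, v'⟫_ℂ := by
  have hs : ∀ {ι : Type} (u u' : Hilb ι), Summable fun i => ‖⟪u i, u' i⟫_ℂ‖ := fun u u' =>
    (lp.summable_inner (𝕜 := ℂ) u u').norm
  rw [lp.inner_eq_tsum, lp.inner_eq_tsum u u', lp.inner_eq_tsum v v',
    tsum_mul_tsum_of_summable_norm (hs u u') (hs v v')]
  refine tsum_congr fun p => ?_
  simp only [prodVec, RCLike.inner_apply, map_mul]
  ring

lemma norm_prodVec (u : Hilb ι) (v : Hilb κ) : ‖prodVec u v‖ = ‖u‖ * ‖v‖ := by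
  have h := inner_prodVec u u v v
  rw [inner_self_eq_norm_sq_to_K, inner_self_eq_norm_sq_to_K, inner_self_eq_norm_sq_to_K,
    ← mul_pow] at h
  have h' : ‖prodVec u v‖ ^ 2 = (‖u‖ * ‖v‖) ^ 2 := by exact_mod_cast h
  exact (pow_left_inj₀ (norm_nonneg _) (by positivity) two_ne_zero).1 h'

/-- The operator `v ↦ v ⊗ w`. -/
noncomputable def tensorRight (w : Hilb κ) : Hilb ι →L[ℂ] Hilb (ι × κ) :=
  LinearMap.mkContinuous
    { toFun := fun v => prodVec v w
      map_add' := fun v v' => lp.ext (funext fun p => add_mul (v p.1) (v' p.1) (w p.2))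
      map_smul' := fun c v => lp.ext (funext fun p => by simp [prodVec, mul_assoc]) } ‖w‖
    fun v => by simp [norm_prodVec, mul_comm]

/-- The operator `w ↦ v ⊗ w`. -/
noncomputable def tensorLeft (v : Hilb ι) : Hilb κ →L[ℂ] Hilb (ι × κ) :=
  LinearMap.mkContinuous
    { toFun := fun w => prodVec v w
      map_add' := fun w w' => lp.ext (funext fun p => mul_add (v p.1) (w p.2) (w' p.2))
      map_smul' := fun c w => lp.ext (funext fun p => by simp [prodVec, mul_left_comm]) } ‖v‖
    fun w => by simp [norm_prodVec]

lemma tensorRight_apply (w : Hilb κ) (v : Hilb ι) : tensorRight w v = prodVec v w := rfl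

lemma tensorLeft_apply (v : Hilb ι) (w : Hilb κ) : tensorLeft v w = prodVec v w := rfl

lemma basisVec_prod (i : ι) (k : κ) : basisVec (i, k) = prodVec (basisVec i) (basisVec k) := by
  classical
  refine lp.ext (funext fun p => ?_)
  simp only [prodVec, basisVec_apply, Prod.ext_iff]
  by_cases h1 : p.1 = i <;> by_cases h2 : p.2 = k <;> simp [h1, h2]

lemma adjoint_tensorRight_apply (w : Hilb κ) (v : Hilb ι) (w' : Hilb κ) :
    adjoint (tensorRight w) (prodVec v w') = ⟪w, w'⟫_ℂ • v := by
  refine ext_inner_left ℂ fun u => ?_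
  rw [adjoint_inner_right, tensorRight_apply, inner_prodVec, inner_smul_right, mul_comm]

lemma adjoint_tensorLeft_apply (v : Hilb ι) (v' : Hilb ι) (w : Hilb κ) :
    adjoint (tensorLeft v) (prodVec v' w) = ⟪v, v'⟫_ℂ • w := by
  refine ext_inner_left ℂ fun u => ?_
  rw [adjoint_inner_right, tensorLeft_apply, inner_prodVec, inner_smul_right]

/-- The operator `1 ⊗ |w⟩⟨w'|`. -/
noncomputable def rankOneRight (w w' : Hilb κ) : Op (ι × κ) :=
  (tensorRight w).comp (adjoint (tensorRight w'))

/-- The operator `|v⟩⟨v'| ⊗ 1`. -/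
noncomputable def rankOneLeft (v v' : Hilb ι) : Op (ι × κ) :=
  (tensorLeft v).comp (adjoint (tensorLeft v'))

lemma rankOneRight_apply (w w' : Hilb κ) (u : Hilb ι) (x : Hilb κ) :
    rankOneRight w w' (prodVec u x) = ⟪w', x⟫_ℂ • prodVec u w := by
  rw [rankOneRight, comp_apply, adjoint_tensorRight_apply, map_smul, tensorRight_apply]

lemma rankOneLeft_apply (v v' : Hilb ι) (u : Hilb ι) (x : Hilb κ) :
    rankOneLeft v v' (prodVec u x) = ⟪v', u⟫_ℂ • prodVec v x := by
  rw [rankOneLeft, comp_apply, adjoint_tensorLeft_apply, map_smul, tensorLeft_apply]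

lemma rankOneRight_actsOn (w w' : Hilb κ) :
    ActsOn (fun t : ι × κ => t.2) (fun t => t.1) (rankOneRight w w') := by
  refine ⟨fun k l => w k * (starRingEnd ℂ) (w' l), fun i j => ?_⟩
  rw [matElem_eq, inner_basisVec_left, ← Prod.mk.eta (p := j), basisVec_prod, rankOneRight_apply,
    inner_basisVec_right]
  simp only [lp.coeFn_smul, Pi.smul_apply, prodVec, basisVec_apply, smul_eq_mul]
  split_ifs <;> ring

lemma rankOneLeft_actsOn (v v' : Hilb ι) :
    ActsOn (fun t : ι × κ => t.1) (fun t => t.2) (rankOneLeft v v') := by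
  refine ⟨fun k l => v k * (starRingEnd ℂ) (v' l), fun i j => ?_⟩
  rw [matElem_eq, inner_basisVec_left, ← Prod.mk.eta (p := j), basisVec_prod, rankOneLeft_apply,
    inner_basisVec_right]
  simp only [lp.coeFn_smul, Pi.smul_apply, prodVec, basisVec_apply, smul_eq_mul]
  split_ifs <;> ring

/-- The operator `T` is `N ⊗ 1`. -/
def IsLeft (T : Op (ι × κ)) (N : Op ι) : Prop := ∀ v w, T (prodVec v w) = prodVec (N v) w

/-- The operator `T` is `1 ⊗ N`. -/
def IsRight (T : Op (ι × κ)) (N : Op κ) : Prop := ∀ v w, T (prodVec v w) = prodVec v (N w)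

/-- An operator commuting with all `1 ⊗ |w⟩⟨w'|` is of the form `N ⊗ 1`. -/
lemma exists_isLeft (k : κ) {T : Op (ι × κ)}
    (hT : ∀ w w', Commute T (rankOneRight w w')) : ∃ N, IsLeft T N := by
  have h1 : ⟪basisVec k, basisVec k⟫_ℂ = 1 := by
    classical rw [inner_basisVec_left, basisVec_apply, if_pos rfl]
  refine ⟨(adjoint (tensorRight (basisVec k))).comp (T.comp (tensorRight (basisVec k))),
    fun v w => ?_⟩
  have e := DFunLike.congr_fun (hT w (basisVec k)).eq (prodVec v (basisVec k))
  rw [mul_apply_eq_comp, rankOneRight_apply, h1, one_smul, mul_apply_eq_comp] at e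
  rw [e]
  rfl

/-- An operator commuting with all `|v⟩⟨v'| ⊗ 1` is of the form `1 ⊗ N`. -/
lemma exists_isRight (i : ι) {T : Op (ι × κ)}
    (hT : ∀ v v', Commute T (rankOneLeft v v')) : ∃ N, IsRight T N := by
  have h1 : ⟪basisVec i, basisVec i⟫_ℂ = 1 := by
    classical rw [inner_basisVec_left, basisVec_apply, if_pos rfl]
  refine ⟨(adjoint (tensorLeft (basisVec i))).comp (T.comp (tensorLeft (basisVec i))),
    fun v w => ?_⟩
  have e := DFunLike.congr_fun (hT v (basisVec i)).eq (prodVec (basisVec i) w)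
  rw [mul_apply_eq_comp, rankOneLeft_apply, h1, one_smul, mul_apply_eq_comp] at e
  rw [e]
  rfl

end Tensor

/-! ### Amplification, slices and the product state -/

section Product

variable {ι κ : Type}

lemma prod_apply_eq_inner (f : Hilb (ι × κ)) (i : ι) (k : κ) :
    f (i, k) = ⟪prodVec (basisVec i) (basisVec k), f⟫_ℂ := by
  rw [← basisVec_prod, inner_basisVec_left]

lemma isLeft_of_basisVec {T : Op (ι × κ)} {N : Op ι}
    (h : ∀ v k, T (prodVec v (basisVec k)) = prodVec (N v) (basisVec k)) : IsLeft T N := by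
  intro v w
  have : T.comp (tensorLeft v) = tensorLeft (N v) := clm_ext_basisVec fun k => h v k
  exact DFunLike.congr_fun this w

/-- The amplification `N ⊗ 1`. -/
lemma exists_isLeft_amplification (κ : Type) (N : Op ι) : ∃ T : Op (ι × κ), IsLeft T N := by
  classical
  have one : ∀ k l : κ, ⟪basisVec k, basisVec l⟫_ℂ = if k = l then 1 else 0 := fun k l => by
    rw [inner_basisVec_left, basisVec_apply]
  -- `N ⊗ 1` is the diagonal operator with entries `N` on the Hilbert sum of the copies
  -- `ℓ²(ι) ⊗ e_k`, which `J` embeds isometrically.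
  obtain ⟨V, hV⟩ : ∃ V : κ → Hilb ι →ₗᵢ[ℂ] Hilb (ι × κ), ∀ k v, V k v = prodVec v (basisVec k) := by
    refine ⟨fun k => ⟨(tensorRight (basisVec k)).toLinearMap, fun v => ?_⟩, fun k v => rfl⟩
    have h : ‖(basisVec k : Hilb κ)‖ = 1 := by
      unfold basisVec
      exact (lp.norm_single (by norm_num) _ _).trans norm_one
    exact (norm_prodVec v (basisVec k)).trans (by rw [h, mul_one])
  have hO : OrthogonalFamily ℂ (fun _ : κ => Hilb ι) V := fun k l hkl v w => by
    rw [hV, hV, inner_prodVec, one, if_neg hkl, mul_zero]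
  obtain ⟨J, hJ⟩ : ∃ J : lp (fun _ : κ => Hilb ι) 2 →L[ℂ] Hilb (ι × κ),
      J = hO.linearIsometry.toContinuousLinearMap := ⟨_, rfl⟩
  have hJJ : ∀ v, adjoint J (J v) = v := fun v => ext_inner_left ℂ fun u => by
    rw [adjoint_inner_right, hJ]
    exact hO.linearIsometry.inner_map_map u v
  have hJs : ∀ k v, J (lp.single 2 k v) = prodVec v (basisVec k) := fun k v => by
    rw [hJ, ← hV]
    exact hO.linearIsometry_apply_single v
  refine ⟨J.comp ((lp.mapCLM 2 (fun _ : κ => N) (norm_nonneg N) fun _ => le_rfl).comp (adjoint J)),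
    isLeft_of_basisVec fun v k => ?_⟩
  rw [← hJs, comp_apply, comp_apply, hJJ, ← hJs]
  congr 1
  refine lp.ext (funext fun l => ?_)
  by_cases h : l = k
  · subst h
    simp [lp.mapCLM]
  · simp [lp.mapCLM, Pi.single_eq_of_ne h]

lemma IsLeft.adjoint {T : Op (ι × κ)} {N : Op ι} (h : IsLeft T N) :
    IsLeft (adjoint T) (adjoint N) := fun v w => lp.ext (funext fun ⟨i, k⟩ => by
  rw [prod_apply_eq_inner, prod_apply_eq_inner, adjoint_inner_right, h, inner_prodVec, inner_prodVec,
    adjoint_inner_right])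

lemma IsRight.adjoint {T : Op (ι × κ)} {N : Op κ} (h : IsRight T N) :
    IsRight (adjoint T) (adjoint N) := fun v w => lp.ext (funext fun ⟨i, k⟩ => by
  rw [prod_apply_eq_inner, prod_apply_eq_inner, adjoint_inner_right, h, inner_prodVec, inner_prodVec,
    adjoint_inner_right])

open Classical in
lemma IsLeft.matElem {T : Op (ι × κ)} {N : Op ι} (h : IsLeft T N) (p q : ι × κ) :
    matElem T p q = if p.2 = q.2 then matElem N p.1 q.1 else 0 := by
  obtain ⟨i, k⟩ := p
  obtain ⟨j, l⟩ := q
  rw [matElem_eq, basisVec_prod, basisVec_prod, h, inner_prodVec, ← matElem_eq, inner_basisVec_left,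
    basisVec_apply]
  simp

/-- The operator `⟨x| G |y⟩` on the first factor, for vectors `x`, `y` of the second one. -/
noncomputable def slice (G : Op (ι × κ)) (x y : Hilb κ) : Op ι :=
  (adjoint (tensorRight x)).comp (G.comp (tensorRight y))

lemma matElem_slice (G : Op (ι × κ)) (x y : Hilb κ) (i j : ι) :
    matElem (slice G x y) i j =
      ∑' l, y l * ∑' k, (starRingEnd ℂ) (x k) * matElem G (i, k) (j, l) := by
  have h := ((hasSum_basisVec y).mapL (G.comp (tensorLeft (basisVec j)))).mapL
    (innerSL ℂ (prodVec (basisVec i) x))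
  have e : ∀ f : Hilb (ι × κ), ⟪prodVec (basisVec i) x, f⟫_ℂ =
      ∑' k, (starRingEnd ℂ) (x k) * f (i, k) := by
    intro f
    rw [← tensorLeft_apply, ← adjoint_inner_right, lp.inner_eq_tsum]
    refine tsum_congr fun k => ?_
    rw [RCLike.inner_apply, mul_comm, ← inner_basisVec_left k (adjoint _ f), adjoint_inner_right,
      tensorLeft_apply, ← prod_apply_eq_inner]
  rw [matElem_eq, slice, comp_apply, adjoint_inner_right, comp_apply]
  refine h.tsum_eq.symm.trans (tsum_congr fun l => ?_)
  rw [map_smul, map_smul, smul_eq_mul, innerSL_apply_apply, comp_apply, tensorLeft_apply,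
    ← basisVec_prod, e]
  rfl

/-- The vectors of the decomposition of the product of two density operators. -/
noncomputable def prodFam (ψ : ℕ → Hilb ι) (φ : ℕ → Hilb κ) (k : ℕ × ℕ) : Hilb (ι × κ) :=
  prodVec (ψ k.1) (φ k.2)

variable {ψ : ℕ → Hilb ι} {φ : ℕ → Hilb κ}

lemma prodFam_hasSum (hψ : IsState ψ) (hφ : IsState φ) :
    HasSum (fun k => ‖prodFam ψ φ k‖ ^ 2) 1 := by
  have hs := hψ.summable.mul_of_nonneg hφ.summable (fun _ => by positivity) fun _ => by positivity
  have := hψ.mul hφ hs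
  rw [mul_one] at this
  simpa only [prodFam, norm_prodVec, mul_pow] using this

lemma stateFun_prodFam (hψ : IsState ψ) (hφ : IsState φ) {T T' : Op (ι × κ)} {N : Op ι} {N' : Op κ}
    (hT : IsLeft T N) (hT' : IsRight T' N') :
    stateFun (prodFam ψ φ) (prodFam_hasSum hψ hφ).summable (T * T') =
      stateFun ψ hψ.summable N * stateFun φ hφ.summable N' := by
  rw [stateFun_apply, stateFun_apply, stateFun_apply,
    tsum_mul_tsum_of_summable_norm (summable_inner_apply hψ.summable N).norm
      (summable_inner_apply hφ.summable N').norm]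
  refine tsum_congr fun k => ?_
  rw [mul_apply_eq_comp, prodFam, hT', hT, inner_prodVec]

lemma isLeft_one : IsLeft (1 : Op (ι × κ)) 1 := fun _ _ => rfl

lemma isRight_one : IsRight (1 : Op (ι × κ)) 1 := fun _ _ => rfl

/-- Operators of the two sources are independent in a product state. -/
lemma stateFun_prodFam_mul (hψ : IsState ψ) (hφ : IsState φ) {T T' : Op (ι × κ)} {N : Op ι}
    {N' : Op κ} (hT : IsLeft T N) (hT' : IsRight T' N') :
    stateFun (prodFam ψ φ) (prodFam_hasSum hψ hφ).summable (T * T') =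
      stateFun (prodFam ψ φ) (prodFam_hasSum hψ hφ).summable T *
      stateFun (prodFam ψ φ) (prodFam_hasSum hψ hφ).summable T' := by
  have h1 := stateFun_prodFam hψ hφ hT isRight_one
  have h2 := stateFun_prodFam hψ hφ isLeft_one hT'
  rw [mul_one, stateFun_one φ _ hφ, mul_one] at h1
  rw [one_mul, stateFun_one ψ _ hψ, one_mul] at h2
  rw [stateFun_prodFam hψ hφ hT hT', h1, h2]

/-- The expectation of `N ⊗ N'` together with a joint operator `G` is a sum over the second source of
expectations of `N` with the slices of `G`. -/
lemma stateFun_prodFam_eq_zero_of_slices (hψ : IsState ψ) (hφ : IsState φ) {T T' : Op (ι × κ)}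
    {N : Op ι} {N' : Op κ} (hT : IsLeft T N) (hT' : IsRight T' N') (G : Op (ι × κ))
    (h : ∀ x y, stateFun ψ hψ.summable (N * slice G x y) = 0) :
    stateFun (prodFam ψ φ) (prodFam_hasSum hψ hφ).summable (T * T' * G) = 0 := by
  have hs := summable_inner_apply (prodFam_hasSum hψ hφ).summable (T * T' * G)
  rw [stateFun_apply, ← (Equiv.prodComm ℕ ℕ).tsum_eq]
  refine (((Equiv.prodComm ℕ ℕ).summable_iff.2 hs).tsum_prod).trans ?_
  have key : ∀ l, ∑' k, ⟪prodFam ψ φ (k, l), (T * T' * G) (prodFam ψ φ (k, l))⟫_ℂ = 0 := by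
    intro l
    rw [← h (ContinuousLinearMap.adjoint N' (φ l)) (φ l), stateFun_apply]
    refine tsum_congr fun k => ?_
    rw [mul_apply_eq_comp, mul_apply_eq_comp, ← adjoint_inner_left, ← adjoint_inner_left, prodFam,
      hT.adjoint, hT'.adjoint, mul_apply_eq_comp, ← adjoint_inner_left N, slice, comp_apply,
      adjoint_inner_right]
    rfl
  exact (tsum_congr key).trans tsum_zero

end Product

/-! ### From network strategies to swap models -/

lemma IsState.nonempty {ι : Type} {ψ : ℕ → Hilb ι} (h : IsState ψ) : Nonempty ι := by
  by_contra hι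
  rw [not_nonempty_iff] at hι
  have : ∀ k, ‖ψ k‖ ^ 2 = 0 := fun k => by
    rw [show ψ k = 0 from lp.ext (funext fun i => (hι.false i).elim)]
    simp
  unfold IsState at h
  simp only [this] at h
  exact zero_ne_one (hasSum_zero.unique h)

section Observables

variable {H : Type*} [NormedAddCommGroup H] [InnerProductSpace ℂ H] [CompleteSpace H]

lemma sub_mul_self_le_one {P Q : H →L[ℂ] H} (hP : 0 ≤ P) (hQ : 0 ≤ Q) (h : P + Q = 1) :
    (P - Q) * (P - Q) ≤ 1 := by
  have hQ' : Q = 1 - P := by rw [← h]; abel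
  have hc : Commute P Q := by
    rw [hQ']; exact (Commute.one_right P).sub_right (Commute.refl P)
  have h4 := Commute.mul_nonneg hP hQ hc
  rw [← sub_nonneg]
  have e : 1 - (P - Q) * (P - Q) = P * Q + P * Q + (P * Q + P * Q) := by
    rw [hQ']; noncomm_ring
  rw [e]
  exact add_nonneg (add_nonneg h4 h4) (add_nonneg h4 h4)

lemma eq_half_smul_one_add {P Q : H →L[ℂ] H} (h : P + Q = 1) :
    P = (1 / 2 : ℂ) • (1 + (1 : ℂ) • (P - Q)) ∧ Q = (1 / 2 : ℂ) • (1 + (-1 : ℂ) • (P - Q)) := by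
  constructor <;> rw [← h] <;> module

end Observables

namespace Strategy

variable (S : Strategy)

/-- The expectation value `X ↦ tr ((ρ₁ ⊗ ρ₂) X)`. -/
noncomputable abbrev ev : Op S.Idx →ₗ[ℂ] ℂ :=
  stateFun (prodFam S.ψ S.φ) (prodFam_hasSum S.ψ_state S.φ_state).summable

lemma prob_eq (X : Op S.Idx) (a : Fin 2) (b : BobOut) (c x z : Fin 2) :
    S.prob X a b c x z = (S.ev (S.A x a * S.B b * S.C z c * X)).re := rfl

/-- The binary observable of a setting of Alice. -/
noncomputable def obsA (x : Fin 2) : Op S.Idx := S.A x 0 - S.A x 1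

/-- The binary observable of a setting of Charlie. -/
noncomputable def obsC (z : Fin 2) : Op S.Idx := S.C z 0 - S.C z 1

variable {S}

lemma commute_AC (x a z c : Fin 2) : Commute (S.A x a) (S.C z c) := by
  refine (S.A_local x a).commute (S.C_local z c) ?_ ?_ ?_ ?_
  · rintro ⟨⟨_, _, _⟩, _, _, _⟩ ⟨⟨_, _, _⟩, _, _, _⟩ h h'
    simp_all
  · rintro ⟨⟨_, _, _⟩, _, _, _⟩ ⟨⟨_, _, _⟩, _, _, _⟩ h
    simp_all
  · rintro ⟨⟨_, _, _⟩, _, _, _⟩ ⟨⟨_, _, _⟩, _, _, _⟩ h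
    simp_all
  · intro i j k h h'
    refine ⟨((i.1.1, j.1.2), j.2), ?_, ?_⟩ <;> simp_all [Prod.ext_iff]

lemma commute_AB (x a : Fin 2) (b : BobOut) : Commute (S.A x a) (S.B b) := by
  refine (S.A_local x a).commute (S.B_local b) ?_ ?_ ?_ ?_
  · rintro ⟨⟨_, _, _⟩, _, _, _⟩ ⟨⟨_, _, _⟩, _, _, _⟩ h h'
    simp_all
  · rintro ⟨⟨_, _, _⟩, _, _, _⟩ ⟨⟨_, _, _⟩, _, _, _⟩ h
    simp_all
  · rintro ⟨⟨_, _, _⟩, _, _, _⟩ ⟨⟨_, _, _⟩, _, _, _⟩ h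
    simp_all
  · intro i j k h h'
    refine ⟨((i.1.1, j.1.2), j.2), ?_, ?_⟩ <;> simp_all [Prod.ext_iff]

lemma commute_CB (z c : Fin 2) (b : BobOut) : Commute (S.C z c) (S.B b) := by
  refine (S.C_local z c).commute (S.B_local b) ?_ ?_ ?_ ?_
  · rintro ⟨⟨_, _, _⟩, _, _, _⟩ ⟨⟨_, _, _⟩, _, _, _⟩ h h'
    simp_all
  · rintro ⟨⟨_, _, _⟩, _, _, _⟩ ⟨⟨_, _, _⟩, _, _, _⟩ h
    simp_all
  · rintro ⟨⟨_, _, _⟩, _, _, _⟩ ⟨⟨_, _, _⟩, _, _, _⟩ h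
    simp_all
  · intro i j k h h'
    refine ⟨(j.1, j.2.1, i.2.2.1, j.2.2.2), ?_, ?_⟩ <;> simp_all [Prod.ext_iff]

lemma ActsOnE.commute_A {G : Op S.Idx} (hG : S.ActsOnE G) (x a : Fin 2) :
    Commute G (S.A x a) := by
  refine ((S.A_local x a).commute hG ?_ ?_ ?_ ?_).symm
  · rintro ⟨⟨_, _, _⟩, _, _, _⟩ ⟨⟨_, _, _⟩, _, _, _⟩ h h'
    simp_all
  · rintro ⟨⟨_, _, _⟩, _, _, _⟩ ⟨⟨_, _, _⟩, _, _, _⟩ h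
    simp_all
  · rintro ⟨⟨_, _, _⟩, _, _, _⟩ ⟨⟨_, _, _⟩, _, _, _⟩ h
    simp_all
  · intro i j k h h'
    refine ⟨((i.1.1, j.1.2), j.2), ?_, ?_⟩ <;> simp_all [Prod.ext_iff]

lemma ActsOnE.commute_C {G : Op S.Idx} (hG : S.ActsOnE G) (z c : Fin 2) :
    Commute G (S.C z c) := by
  refine ((S.C_local z c).commute hG ?_ ?_ ?_ ?_).symm
  · rintro ⟨⟨_, _, _⟩, _, _, _⟩ ⟨⟨_, _, _⟩, _, _, _⟩ h h'
    simp_all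
  · rintro ⟨⟨_, _, _⟩, _, _, _⟩ ⟨⟨_, _, _⟩, _, _, _⟩ h
    simp_all
  · rintro ⟨⟨_, _, _⟩, _, _, _⟩ ⟨⟨_, _, _⟩, _, _, _⟩ h
    simp_all
  · intro i j k h h'
    refine ⟨(j.1, j.2.1, i.2.2.1, j.2.2.2), ?_, ?_⟩ <;> simp_all [Prod.ext_iff]

lemma ActsOnE.commute_B {G : Op S.Idx} (hG : S.ActsOnE G) (b : BobOut) :
    Commute G (S.B b) := by
  refine ((S.B_local b).commute hG ?_ ?_ ?_ ?_).symm
  · rintro ⟨⟨_, _, _⟩, _, _, _⟩ ⟨⟨_, _, _⟩, _, _, _⟩ h h'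
    simp_all
  · rintro ⟨⟨_, _, _⟩, _, _, _⟩ ⟨⟨_, _, _⟩, _, _, _⟩ h
    simp_all
  · rintro ⟨⟨_, _, _⟩, _, _, _⟩ ⟨⟨_, _, _⟩, _, _, _⟩ h
    simp_all
  · intro i j k h h'
    refine ⟨((j.1.1, i.1.2.1, j.1.2.2), i.2.1, j.2.2), ?_, ?_⟩ <;> simp_all [Prod.ext_iff]

/-- Operators on one of the systems `E₁`, `E₂` are operators on both. -/
lemma ActsOnE₁.actsOnE {G : Op S.Idx} (hG : S.ActsOnE₁ G) : S.ActsOnE G := by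
  classical
  obtain ⟨m, hm⟩ := hG
  refine ⟨fun e e' => if e.2 = e'.2 then m e.1 e'.1 else 0, ?_⟩
  rintro ⟨⟨_, _, _⟩, _, _, _⟩ ⟨⟨_, _, _⟩, _, _, _⟩
  rw [hm]
  simp only [Prod.mk.injEq]
  split_ifs <;> simp_all

lemma ActsOnE₂.actsOnE {G : Op S.Idx} (hG : S.ActsOnE₂ G) : S.ActsOnE G := by
  classical
  obtain ⟨m, hm⟩ := hG
  refine ⟨fun e e' => if e.1 = e'.1 then m e.2 e'.2 else 0, ?_⟩
  rintro ⟨⟨_, _, _⟩, _, _, _⟩ ⟨⟨_, _, _⟩, _, _, _⟩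
  rw [hm]
  simp only [Prod.mk.injEq]
  split_ifs <;> simp_all

end Strategy

lemma IsLeft.mul {ι κ : Type} {T U : Op (ι × κ)} {N L : Op ι} (hT : IsLeft T N) (hU : IsLeft U L) :
    IsLeft (T * U) (N * L) := fun v w => by
  rw [mul_apply_eq_comp, hU, hT, mul_apply_eq_comp]

lemma IsRight.mul {ι κ : Type} {T U : Op (ι × κ)} {N L : Op κ} (hT : IsRight T N)
    (hU : IsRight U L) : IsRight (T * U) (N * L) := fun v w => by
  rw [mul_apply_eq_comp, hU, hT, mul_apply_eq_comp]

namespace Strategy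

variable {S : Strategy}

lemma A_add (x : Fin 2) : S.A x 0 + S.A x 1 = 1 := by
  rw [← (S.A_povm x).2, Fin.sum_univ_two]

lemma C_add (z : Fin 2) : S.C z 0 + S.C z 1 = 1 := by
  rw [← (S.C_povm z).2, Fin.sum_univ_two]

lemma A_nonneg (x a : Fin 2) : 0 ≤ S.A x a := (nonneg_iff_isPositive _).2 ((S.A_povm x).1 a)

lemma C_nonneg (z c : Fin 2) : 0 ≤ S.C z c := (nonneg_iff_isPositive _).2 ((S.C_povm z).1 c)

lemma obsA_sa (x : Fin 2) : IsSelfAdjoint (S.obsA x) :=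
  (A_nonneg x 0).isSelfAdjoint.sub (A_nonneg x 1).isSelfAdjoint

lemma obsC_sa (z : Fin 2) : IsSelfAdjoint (S.obsC z) :=
  (C_nonneg z 0).isSelfAdjoint.sub (C_nonneg z 1).isSelfAdjoint

lemma commute_rankOneRight_A (x a : Fin 2) (w w' : Hilb (S.β₂ × S.γ × S.ε₂)) :
    Commute (S.A x a) (rankOneRight w w') := by
  refine (S.A_local x a).commute (rankOneRight_actsOn w w') ?_ ?_ ?_ ?_
  · rintro ⟨⟨_, _, _⟩, _, _, _⟩ ⟨⟨_, _, _⟩, _, _, _⟩ h h'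
    simp_all
  · rintro ⟨⟨_, _, _⟩, _, _, _⟩ ⟨⟨_, _, _⟩, _, _, _⟩ h
    simp_all
  · rintro ⟨⟨_, _, _⟩, _, _, _⟩ ⟨⟨_, _, _⟩, _, _, _⟩ h
    simp_all
  · intro i j k h h'
    refine ⟨(i.1, j.2), ?_, ?_⟩ <;> simp_all [Prod.ext_iff]

lemma commute_rankOneLeft_C (z c : Fin 2) (v v' : Hilb (S.α × S.β₁ × S.ε₁)) :
    Commute (S.C z c) (rankOneLeft v v') := by
  refine (S.C_local z c).commute (rankOneLeft_actsOn v v') ?_ ?_ ?_ ?_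
  · rintro ⟨⟨_, _, _⟩, _, _, _⟩ ⟨⟨_, _, _⟩, _, _, _⟩ h h'
    simp_all
  · rintro ⟨⟨_, _, _⟩, _, _, _⟩ ⟨⟨_, _, _⟩, _, _, _⟩ h
    simp_all
  · rintro ⟨⟨_, _, _⟩, _, _, _⟩ ⟨⟨_, _, _⟩, _, _, _⟩ h
    simp_all
  · intro i j k h h'
    refine ⟨(j.1, i.2), ?_, ?_⟩ <;> simp_all [Prod.ext_iff]

lemma ActsOnE₁.exists_isLeft {G : Op S.Idx} (hG : S.ActsOnE₁ G) : ∃ N, IsLeft G N := by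
  obtain ⟨k⟩ := S.φ_state.nonempty
  refine Bilocal.exists_isLeft k fun w w' => ?_
  refine hG.commute (rankOneRight_actsOn w w') ?_ ?_ ?_ ?_
  · rintro ⟨⟨_, _, _⟩, _, _, _⟩ ⟨⟨_, _, _⟩, _, _, _⟩ h h'
    simp_all
  · rintro ⟨⟨_, _, _⟩, _, _, _⟩ ⟨⟨_, _, _⟩, _, _, _⟩ h
    simp_all
  · rintro ⟨⟨_, _, _⟩, _, _, _⟩ ⟨⟨_, _, _⟩, _, _, _⟩ h
    simp_all
  · intro i j k h h'
    refine ⟨(i.1, j.2), ?_, ?_⟩ <;> simp_all [Prod.ext_iff]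

lemma ActsOnE₂.exists_isRight {G : Op S.Idx} (hG : S.ActsOnE₂ G) : ∃ N, IsRight G N := by
  obtain ⟨i⟩ := S.ψ_state.nonempty
  refine Bilocal.exists_isRight i fun v v' => ?_
  refine hG.commute (rankOneLeft_actsOn v v') ?_ ?_ ?_ ?_
  · rintro ⟨⟨_, _, _⟩, _, _, _⟩ ⟨⟨_, _, _⟩, _, _, _⟩ h h'
    simp_all
  · rintro ⟨⟨_, _, _⟩, _, _, _⟩ ⟨⟨_, _, _⟩, _, _, _⟩ h
    simp_all
  · rintro ⟨⟨_, _, _⟩, _, _, _⟩ ⟨⟨_, _, _⟩, _, _, _⟩ h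
    simp_all
  · intro i j k h h'
    refine ⟨(j.1, i.2), ?_, ?_⟩ <;> simp_all [Prod.ext_iff]

lemma exists_isLeft_of_mem_bicommutant {T : Op S.Idx} (hT : T ∈ bicommutant S.obsA) :
    ∃ N, IsLeft T N := by
  obtain ⟨k⟩ := S.φ_state.nonempty
  exact Bilocal.exists_isLeft k fun w w' => commute_of_mem_bicommutant obsA_sa hT fun x =>
    ((commute_rankOneRight_A x 0 w w').sub_left (commute_rankOneRight_A x 1 w w')).symm

lemma exists_isRight_of_mem_bicommutant {T : Op S.Idx} (hT : T ∈ bicommutant S.obsC) :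
    ∃ N, IsRight T N := by
  obtain ⟨i⟩ := S.ψ_state.nonempty
  exact Bilocal.exists_isRight i fun v v' => commute_of_mem_bicommutant obsC_sa hT fun z =>
    ((commute_rankOneLeft_C z 0 v v').sub_left (commute_rankOneLeft_C z 1 v v')).symm

variable (S) in
/-- A strategy in the network is a swap model. Operators in the von Neumann algebras of Alice and
Charlie act on one source each, hence are independent. -/
lemma swapModel : SwapModel (prodFam S.ψ S.φ) (prodFam_hasSum S.ψ_state S.φ_state).summable
    S.obsA S.obsC S.B where
  norm := prodFam_hasSum S.ψ_state S.φ_state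
  A_sa := obsA_sa
  C_sa := obsC_sa
  A_le x := sub_mul_self_le_one (A_nonneg x 0) (A_nonneg x 1) (A_add x)
  C_le z := sub_mul_self_le_one (C_nonneg z 0) (C_nonneg z 1) (C_add z)
  B_nonneg b := (nonneg_iff_isPositive _).2 (S.B_povm.1 b)
  B_sum := S.B_povm.2
  AC x z := ((commute_AC x 0 z 0).sub_right (commute_AC x 0 z 1)).sub_left
    ((commute_AC x 1 z 0).sub_right (commute_AC x 1 z 1))
  AB x b := (commute_AB x 0 b).sub_left (commute_AB x 1 b)
  CB z b := (commute_CB z 0 b).sub_left (commute_CB z 1 b)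
  indep X hX Y hY := by
    obtain ⟨N, hN⟩ := exists_isLeft_of_mem_bicommutant hX
    obtain ⟨N', hN'⟩ := exists_isRight_of_mem_bicommutant hY
    exact stateFun_prodFam_mul S.ψ_state S.φ_state hN hN'

lemma ActsOnE.commutesWith {G : Op S.Idx} (hG : S.ActsOnE G) :
    PauliModel.CommutesWith G S.obsA S.obsC S.B where
  A x := (hG.commute_A x 0).sub_right (hG.commute_A x 1)
  C z := (hG.commute_C z 0).sub_right (hG.commute_C z 1)
  B := hG.commute_B

/-- Slicing a joint operator of the eavesdropper over the second source, one obtains operators on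
`E₁`. -/
lemma exists_actsOnE₁_of_slice {G : Op S.Idx} (hG : S.ActsOnE G) (x y : Hilb (S.β₂ × S.γ × S.ε₂)) :
    ∃ U, IsLeft U (slice G x y) ∧ S.ActsOnE₁ U := by
  classical
  obtain ⟨U, hU⟩ := exists_isLeft_amplification (S.β₂ × S.γ × S.ε₂) (slice G x y)
  refine ⟨U, hU, ?_⟩
  obtain ⟨m, hm⟩ := hG
  refine ⟨fun e e' => ∑' l, y l * ∑' k, (starRingEnd ℂ) (x k) *
    if (k.1, k.2.1) = (l.1, l.2.1) then m (e, k.2.2) (e', l.2.2) else 0, fun i j => ?_⟩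
  rw [hU.matElem, matElem_slice]
  simp only [hm]
  obtain ⟨⟨i₁, i₂, i₃⟩, i₄⟩ := i
  obtain ⟨⟨j₁, j₂, j₃⟩, j₄⟩ := j
  by_cases h : i₁ = j₁ ∧ i₂ = j₂
  · obtain ⟨rfl, rfl⟩ := h
    simp
  · have h1 : ¬ ((i₁, i₂, i₄) = (j₁, j₂, j₄)) := fun e => h (by simp_all)
    have h2 : ∀ u v : S.β₂ × S.γ, (((i₁, i₂), u) = ((j₁, j₂), v)) = False := fun u v =>
      eq_false fun e => h (by simp_all)
    simp only [h1, h2, if_false, mul_zero, tsum_zero, ite_self]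

/-- An operator `T` of Alice without correlations to the environment remains uncorrelated with Charlie
in the presence of a joint operator `G` on `E₁` and `E₂`: for a fixed vector of the second source `G`
reduces to its slices, which are operators on `E₁`. -/
lemma weak_split {G : Op S.Idx} (hG : S.ActsOnE G) {T T' : Op S.Idx} (hT : T ∈ bicommutant S.obsA)
    (hT' : T' ∈ bicommutant S.obsC)
    (h : ∀ u, PauliModel.CommutesWith u S.obsA S.obsC S.B → S.ev (T * u) = 0) :
    S.ev (T * T' * G) = 0 := by
  obtain ⟨N, hN⟩ := exists_isLeft_of_mem_bicommutant hT
  obtain ⟨N', hN'⟩ := exists_isRight_of_mem_bicommutant hT'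
  refine stateFun_prodFam_eq_zero_of_slices S.ψ_state S.φ_state hN hN' G fun x y => ?_
  obtain ⟨U, hU, hUE⟩ := exists_actsOnE₁_of_slice hG x y
  have h1 := h U (ActsOnE.commutesWith (ActsOnE₁.actsOnE hUE))
  have h2 := stateFun_prodFam S.ψ_state S.φ_state (hN.mul hU) isRight_one
  rw [mul_one, stateFun_one S.φ _ S.φ_state, mul_one] at h2
  exact h2.symm.trans h1

/-- The same for a product of an operator on `E₁` and one on `E₂`, by independence of the sources
alone. -/
lemma double_split {E F : Op S.Idx} (hE : S.ActsOnE₁ E) (hF : S.ActsOnE₂ F) {T T' : Op S.Idx}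
    (hT : T ∈ bicommutant S.obsA) (hT' : T' ∈ bicommutant S.obsC)
    (h : ∀ u, PauliModel.CommutesWith u S.obsA S.obsC S.B → S.ev (T * u) = 0) :
    S.ev (T * T' * (E * F)) = 0 := by
  obtain ⟨N, hN⟩ := exists_isLeft_of_mem_bicommutant hT
  obtain ⟨N', hN'⟩ := exists_isRight_of_mem_bicommutant hT'
  obtain ⟨L, hL⟩ := hE.exists_isLeft
  obtain ⟨L', hL'⟩ := hF.exists_isRight
  have hEC := ActsOnE.commutesWith hE.actsOnE
  have hc : Commute T' E := commute_of_mem_bicommutant obsC_sa hT' hEC.C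
  have e : T * T' * (E * F) = (T * E) * (T' * F) := by
    rw [mul_assoc, ← mul_assoc T', hc.eq]
    simp only [mul_assoc]
  rw [e]
  refine (stateFun_prodFam_mul S.ψ_state S.φ_state (hN.mul hL) (hN'.mul hL')).trans ?_
  have := h E hEC
  rw [this, zero_mul]

end Strategy

/-! ### The guessing probabilities -/

namespace Strategy

variable {S : Strategy} {p : Behaviour} {δ : ℝ}

lemma prob_sum {O : Type} [Fintype O] (X : O → Op S.Idx) (a : Fin 2) (b : BobOut) (c x z : Fin 2) :
    ∑ o, S.prob (X o) a b c x z = S.prob (∑ o, X o) a b c x z := by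
  simp only [prob_eq, ← Complex.re_sum, ← map_sum, ← Finset.mul_sum]

lemma probB_eq (hp : ∀ a b c x z, p a b c x z = S.prob 1 a b c x z) (b : BobOut) (x z : Fin 2) :
    probB p b x z = (S.ev (S.B b)).re := by
  have e : S.B b = S.A x 0 * S.B b * S.C z 0 * 1 + S.A x 0 * S.B b * S.C z 1 * 1
      + (S.A x 1 * S.B b * S.C z 0 * 1 + S.A x 1 * S.B b * S.C z 1 * 1) := by
    simp only [mul_one, ← mul_add, C_add, ← add_mul, A_add, one_mul]
  conv_rhs => rw [e]
  simp only [probB, Fin.sum_univ_two, hp, prob_eq, map_add, Complex.add_re]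

lemma corr_mul_probB (hp : ∀ a b c x z, p a b c x z = S.prob 1 a b c x z) {b : BobOut}
    {x z : Fin 2} (hb : 0 < probB p b x z) :
    (S.ev (S.B b * (S.obsA x * S.obsC z))).re = corr p x z b * (S.ev (S.B b)).re := by
  have e : S.B b * (S.obsA x * S.obsC z) = S.A x 0 * S.B b * S.C z 0 * 1 - S.A x 0 * S.B b * S.C z 1 * 1
      - S.A x 1 * S.B b * S.C z 0 * 1 + S.A x 1 * S.B b * S.C z 1 * 1 := by
    rw [← mul_assoc, ← (S.swapModel.AB x b).eq, obsA, obsC]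
    noncomm_ring
  rw [e, ← probB_eq hp b x z]
  have hb' := hb.ne'
  simp only [map_add, map_sub, Complex.add_re, Complex.sub_re, ← prob_eq, ← hp, corr, condAC,
    Fin.sum_univ_two]
  field_simp
  simp
  ring

lemma isTilted (hp : ∀ a b c x z, p a b c x z = S.prob 1 a b c x z) (hrel : TiltedRelations δ p) :
    IsTilted (prodFam S.ψ S.φ) (prodFam_hasSum S.ψ_state S.φ_state).summable S.obsA S.obsC S.B
      (Real.sin δ) (Real.cos δ) where
  pos b := by
    have := hrel.pos b 0 0
    rwa [probB_eq hp] at this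
  c01 b := (corr_mul_probB hp (hrel.pos b 0 1)).trans (by rw [hrel.corr01])
  c10 b := (corr_mul_probB hp (hrel.pos b 1 0)).trans (by rw [hrel.corr10])
  c00 b := (corr_mul_probB hp (hrel.pos b 0 0)).trans (by rw [hrel.corr00, zero_mul])
  c11 b := (corr_mul_probB hp (hrel.pos b 1 1)).trans (by
    rw [hrel.corr11, Real.sin_two_mul, ite_mul, zero_mul])

/-- Whatever an operator `X` of the eavesdropper finds, all outcomes for the settings `0`, `0` are
equally likely. -/
lemma prob_eq_uniform (hδ0 : δ ≠ 0) (hδ : |δ| ≤ Real.pi / 6)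
    (hp : ∀ a b c x z, p a b c x z = S.prob 1 a b c x z) (hrel : TiltedRelations δ p)
    {X : Op S.Idx} (hX : PauliModel.CommutesWith X S.obsA S.obsC S.B)
    (hsplit : ∀ T ∈ bicommutant S.obsA, ∀ T' ∈ bicommutant S.obsC,
      (∀ u, PauliModel.CommutesWith u S.obsA S.obsC S.B → S.ev (T * u) = 0) →
        S.ev (T * T' * X) = 0) (a : Fin 2) (b : BobOut) (c : Fin 2) :
    S.prob X a b c 0 0 = 1 / 16 * (S.ev X).re := by
  have hπ := Real.pi_pos
  have hsc := Real.sin_sq_add_cos_sq δ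
  -- `|δ| ≤ π / 6` enters through `cos δ ^ 2 ≥ 3 / 4` only.
  have hcos : √3 / 2 ≤ Real.cos δ := by
    rw [← Real.cos_pi_div_six, ← Real.cos_abs δ]
    exact Real.cos_le_cos_of_nonneg_of_le_pi (abs_nonneg δ) (by linarith) hδ
  have h3 : 0 < √3 := by positivity
  have hc : 0 < Real.cos δ := by linarith
  have hc2 : 3 / 4 ≤ Real.cos δ ^ 2 := by
    have := Real.sq_sqrt (show (0 : ℝ) ≤ 3 by norm_num)
    nlinarith
  have hs0 : Real.sin δ ≠ 0 := by
    intro h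
    have h1 := abs_le.1 hδ
    exact hδ0 ((Real.sin_eq_zero_iff_of_lt_of_lt (by linarith) (by linarith)).1 h)
  have hT := isTilted hp hrel
  have hA : ∃ ε : ℂ, S.A 0 a = (1 / 2 : ℂ) • (1 + ε • S.obsA 0) := by
    have := eq_half_smul_one_add (A_add (S := S) 0)
    fin_cases a
    exacts [⟨_, this.1⟩, ⟨_, this.2⟩]
  have hC : ∃ ε : ℂ, S.C 0 c = (1 / 2 : ℂ) • (1 + ε • S.obsC 0) := by
    have := eq_half_smul_one_add (C_add (S := S) 0)
    fin_cases c
    exacts [⟨_, this.1⟩, ⟨_, this.2⟩]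
  obtain ⟨ε, hε⟩ := hA
  obtain ⟨η, hη⟩ := hC
  rw [prob_eq, hε, hη]
  have h1 := S.swapModel.outer_uniform hT hsc hc hc2 hs0 hX b ε η
  have h2 := S.swapModel.bob_uniform hT hsc hc hc2 hs0 hX hsplit b
  rw [h2] at h1
  rw [show S.ev _ = _ from h1, ← mul_assoc, show (1 / 4 : ℂ) * (1 / 4) = ((1 / 16 : ℝ) : ℂ) by
    push_cast; norm_num, Complex.re_ofReal_mul]

lemma actsOnE₁_one : S.ActsOnE₁ 1 := by
  classical
  refine ⟨fun e e' => if e = e' then 1 else 0, ?_⟩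
  rintro ⟨⟨_, _, _⟩, _⟩ ⟨⟨_, _, _⟩, _⟩
  rw [matElem_eq, inner_basisVec_left, one_apply_eq_self, basisVec_apply]
  simp only [Prod.mk.injEq]
  split_ifs <;> simp_all

lemma actsOnE₂_one : S.ActsOnE₂ 1 := by
  classical
  refine ⟨fun e e' => if e = e' then 1 else 0, ?_⟩
  rintro ⟨_, _, _, _⟩ ⟨_, _, _, _⟩
  rw [matElem_eq, inner_basisVec_left, one_apply_eq_self, basisVec_apply]
  simp only [Prod.mk.injEq]
  split_ifs <;> simp_all

lemma actsOnE₁_zero : S.ActsOnE₁ 0 :=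
  ⟨fun _ _ => 0, fun i j => by rw [matElem_eq]; simp⟩

lemma ev_one : S.ev 1 = 1 := stateFun_one _ _ (prodFam_hasSum S.ψ_state S.φ_state)

end Strategy

open Strategy

variable {p : Behaviour} {δ : ℝ}

lemma prob_eq_uniform_of_quantum (hδ0 : δ ≠ 0) (hδ : |δ| ≤ Real.pi / 6)
    (hp : IsQuantum p) (hrel : TiltedRelations δ p) (a : Fin 2) (b : BobOut) (c : Fin 2) :
    p a b c 0 0 = 1 / 16 := by
  obtain ⟨S, hS⟩ := hp
  have h1 : S.ActsOnE 1 := actsOnE₁_one.actsOnE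
  rw [hS, prob_eq_uniform hδ0 hδ hS hrel (ActsOnE.commutesWith h1)
    (fun T hT T' hT' h => weak_split h1 hT hT' h), ev_one]
  simp

lemma informedABC_eq (h : ∀ a b c, p a b c 0 0 = 1 / 16) : informedABC p = 1 / 16 := by
  simp only [informedABC, h]
  exact ciSup_const

lemma informedAC_eq (h : ∀ a b c, p a b c 0 0 = 1 / 16) : informedAC p = 4 / 16 := by
  have hB : ∀ b, probB p b 0 0 = 1 / 4 := fun b => by
    simp only [probB, h, Fin.sum_univ_two]; norm_num
  simp only [informedAC, condAC, h, hB, ciSup_const, Fintype.sum_prod_type, Fin.sum_univ_two]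
  norm_num

section Guess

variable {G : Type} [Fintype G] [DecidableEq G] {tgt : Fin 2 → BobOut → Fin 2 → G} {n : ℝ}

/-- Every guess `g` is right for the same number `n` of outcomes `(a, b, c)`. -/
def IsBalanced (tgt : Fin 2 → BobOut → Fin 2 → G) (n : ℝ) : Prop :=
  ∀ g, ∑ a, ∑ b, ∑ c, (if tgt a b c = g then (1 : ℝ) else 0) = n

/-- All admissible strategies of a weak eavesdropper attain the same value. A constant guess is
admissible, so there is one. -/
lemma isGreatest_weak [Nonempty G] (hδ0 : δ ≠ 0) (hδ : |δ| ≤ Real.pi / 6)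
    (hp : IsQuantum p) (hrel : TiltedRelations δ p) (hn : IsBalanced tgt n) :
    IsGreatest (weakGuessProbs p tgt) (n / 16) := by
  have key : ∀ g ∈ weakGuessProbs p tgt, g = n / 16 := by
    rintro _ ⟨S, E, hE, hEE, hu, rfl⟩
    have hS : ∀ a b c x z, p a b c x z = S.prob 1 a b c x z := fun a b c x z => by
      rw [← hu, prob_sum, hE.2]
    have h : ∀ g a b c, S.prob (E g) a b c 0 0 = 1 / 16 * (S.ev (E g)).re := fun g a b c =>
      prob_eq_uniform hδ0 hδ hS hrel (hEE g).commutesWith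
        (fun T hT T' hT' h => weak_split (hEE g) hT hT' h) a b c
    have hg : ∀ a b c, (S.ev (E (tgt a b c))).re =
        ∑ g, (if tgt a b c = g then 1 else 0) * (S.ev (E g)).re := fun a b c => by simp
    simp only [h, hg, Finset.mul_sum]
    have hsum : ∑ g, (S.ev (E g)).re = 1 := by
      rw [← Complex.re_sum, ← map_sum, hE.2, ev_one, Complex.one_re]
    calc _ = ∑ g, (1 / 16 * (S.ev (E g)).re) *
          ∑ a, ∑ b, ∑ c, (if tgt a b c = g then (1 : ℝ) else 0) := by
          simp only [Finset.mul_sum]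
          symm
          rw [Finset.sum_comm]
          refine Finset.sum_congr rfl fun a _ => ?_
          rw [Finset.sum_comm]
          refine Finset.sum_congr rfl fun b _ => ?_
          rw [Finset.sum_comm]
          refine Finset.sum_congr rfl fun c _ => Finset.sum_congr rfl fun g _ => ?_
          ring
      _ = n / 16 := by
          simp only [hn _]
          rw [← Finset.sum_mul, ← Finset.mul_sum, hsum]
          ring
  refine ⟨?_, fun g hg => (key g hg).le⟩
  obtain ⟨S, hS⟩ := hp
  obtain ⟨g₀⟩ := ‹Nonempty G›
  have hE : IsPOVM (fun g : G => if g = g₀ then (1 : Op S.Idx) else 0) := by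
    refine ⟨fun g => ?_, by simp⟩
    dsimp only
    split_ifs
    exacts [isPositive_one, isPositive_zero]
  have hmem : _ ∈ weakGuessProbs p tgt :=
    ⟨S, fun g => if g = g₀ then 1 else 0, hE, fun g => by
      dsimp only
      split_ifs
      exacts [actsOnE₁_one.actsOnE, actsOnE₁_zero.actsOnE],
      fun a b c x z => by rw [prob_sum, hE.2, hS], rfl⟩
  rw [← key _ hmem]
  exact hmem

/-- All admissible strategies of a double eavesdropper attain the same value. A constant guess is
admissible, so there is one. -/
lemma isGreatest_double [Nonempty G] (hδ0 : δ ≠ 0) (hδ : |δ| ≤ Real.pi / 6)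
    (hp : IsQuantum p) (hrel : TiltedRelations δ p) (hn : IsBalanced tgt n) :
    IsGreatest (doubleGuessProbs p tgt) (n / 16) := by
  have key : ∀ g ∈ doubleGuessProbs p tgt, g = n / 16 := by
    rintro _ ⟨S, k, l, E, F, guess, hE, hEE, hF, hFF, hu, rfl⟩
    have hEF : ∑ e, ∑ f, E e * F f = 1 := by
      simp only [← Finset.mul_sum, hF.2, mul_one, hE.2]
    have hS : ∀ a b c x z, p a b c x z = S.prob 1 a b c x z := fun a b c x z => by
      rw [← hu]
      simp only [prob_sum, hEF]
    have h : ∀ e f a b c, S.prob (E e * F f) a b c 0 0 = 1 / 16 * (S.ev (E e * F f)).re := by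
      intro e f a b c
      have h1 := (hEE e).actsOnE.commutesWith
      have h2 := (hFF f).actsOnE.commutesWith
      exact prob_eq_uniform hδ0 hδ hS hrel ⟨fun x => (h1.A x).mul_left (h2.A x),
        fun z => (h1.C z).mul_left (h2.C z), fun b => (h1.B b).mul_left (h2.B b)⟩
        (fun T hT T' hT' h => double_split (hEE e) (hFF f) hT hT' h) a b c
    have hsum : ∑ e, ∑ f, (S.ev (E e * F f)).re = 1 := by
      simp only [← Complex.re_sum, ← map_sum, hEF, ev_one, Complex.one_re]
    simp only [h]
    calc _ = ∑ e, ∑ f, (1 / 16 * (S.ev (E e * F f)).re) *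
          ∑ a, ∑ b, ∑ c, (if tgt a b c = guess e f then (1 : ℝ) else 0) := by
          simp only [Finset.mul_sum]
          simp only [Finset.sum_comm (s := (Finset.univ : Finset (Fin l)))]
          symm
          rw [Finset.sum_comm]
          refine Finset.sum_congr rfl fun a _ => ?_
          rw [Finset.sum_comm]
          refine Finset.sum_congr rfl fun b _ => ?_
          rw [Finset.sum_comm]
          refine Finset.sum_congr rfl fun c _ => ?_
          refine Finset.sum_congr rfl fun e _ => Finset.sum_congr rfl fun f _ => ?_
          rw [mul_ite, mul_one, mul_zero]
          exact if_congr eq_comm rfl rfl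
      _ = n / 16 := by
          simp only [hn _]
          simp only [← Finset.sum_mul, ← Finset.mul_sum, hsum]
          ring
  refine ⟨?_, fun g hg => (key g hg).le⟩
  obtain ⟨S, hS⟩ := hp
  obtain ⟨g₀⟩ := ‹Nonempty G›
  have hE : IsPOVM (fun _ : Fin 1 => (1 : Op S.Idx)) := ⟨fun _ => isPositive_one, by simp⟩
  have hmem : _ ∈ doubleGuessProbs p tgt :=
    ⟨S, 1, 1, fun _ => 1, fun _ => 1, fun _ _ => g₀, hE, fun _ => actsOnE₁_one, hE,
      fun _ => actsOnE₂_one, fun a b c x z => by simp [hS], rfl⟩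
  rw [← key _ hmem]
  exact hmem

end Guess

lemma isBalanced_tgtABC : IsBalanced tgtABC 1 := by
  rintro ⟨a, ⟨b₀, b₁⟩, c⟩
  simp only [tgtABC, Prod.mk.injEq, Fintype.sum_prod_type, Fin.sum_univ_two]
  fin_cases a <;> fin_cases b₀ <;> fin_cases b₁ <;> fin_cases c <;> norm_num

lemma isBalanced_tgtAC : IsBalanced tgtAC 4 := by
  rintro ⟨a, c⟩
  simp only [tgtAC, Prod.mk.injEq, Fintype.sum_prod_type, Fin.sum_univ_two]
  fin_cases a <;> fin_cases c <;> norm_num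

end Bilocal

theorem mainTheorem1 (δ : ℝ) (hδ0 : δ ≠ 0) (hδ : |δ| ≤ Real.pi / 6)
    (p : Bilocal.Behaviour) (hp : Bilocal.IsQuantum p) (hrel : Bilocal.TiltedRelations δ p) :
    (IsGreatest (Bilocal.doubleGuessProbs p Bilocal.tgtABC) (Bilocal.informedABC p) ∧
      Bilocal.minEntropy (Bilocal.doubleGuessProbs p Bilocal.tgtABC)
        = -Real.logb 2 (Bilocal.informedABC p)) ∧
    (IsGreatest (Bilocal.doubleGuessProbs p Bilocal.tgtAC) (Bilocal.informedAC p) ∧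
      Bilocal.minEntropy (Bilocal.doubleGuessProbs p Bilocal.tgtAC)
        = -Real.logb 2 (Bilocal.informedAC p)) ∧
    (IsGreatest (Bilocal.weakGuessProbs p Bilocal.tgtABC) (Bilocal.informedABC p) ∧
      Bilocal.minEntropy (Bilocal.weakGuessProbs p Bilocal.tgtABC)
        = -Real.logb 2 (Bilocal.informedABC p)) ∧
    (IsGreatest (Bilocal.weakGuessProbs p Bilocal.tgtAC) (Bilocal.informedAC p) ∧
      Bilocal.minEntropy (Bilocal.weakGuessProbs p Bilocal.tgtAC)
        = -Real.logb 2 (Bilocal.informedAC p)) := by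
  have h := Bilocal.prob_eq_uniform_of_quantum hδ0 hδ hp hrel
  have entropy : ∀ {G : Set ℝ} {g : ℝ}, IsGreatest G g →
      IsGreatest G g ∧ Bilocal.minEntropy G = -Real.logb 2 g := fun hG =>
    ⟨hG, by rw [Bilocal.minEntropy, hG.csSup_eq]⟩
  rw [Bilocal.informedABC_eq h, Bilocal.informedAC_eq h]
  exact ⟨entropy (Bilocal.isGreatest_double hδ0 hδ hp hrel Bilocal.isBalanced_tgtABC),
    entropy (Bilocal.isGreatest_double hδ0 hδ hp hrel Bilocal.isBalanced_tgtAC),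
    entropy (Bilocal.isGreatest_weak hδ0 hδ hp hrel Bilocal.isBalanced_tgtABC),
    entropy (Bilocal.isGreatest_weak hδ0 hδ hp hrel Bilocal.isBalanced_tgtAC)⟩
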